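/- **Conventions.** Let $n\ge 1$ and let $\mathscr C$ be an additive category. A complex $X=(X^0\to X^1\to\cdots\to X^{n+1})$ in $\mathscr C$ is a cochain complex that vanishes outside degrees $0,\dots,n+1$. It is an *$n$-kernel sequence* if $0\to\mathscr C(-,X^0)\to\cdots\to\mathscr C(-,X^{n+1})$ is exact, an *$n$-cokernel sequence* if $0\to\mathscr C(X^{n+1},-)\to\cdots\to\mathscr C(X^0,-)$ is exact, and *$n$-exact* if it is both. The *mapping cone* $M_f$ of a morphism of complexes $f:X\to Y$ is $$X^1\to X^2\oplus Y^1\to\cdots\to X^{n+1}\oplus Y^n\to Y^{n+1}$$ with differentials $\begin{bmatrix}-d_X^1\\ f^1\end{bmatrix}$, $\begin{bmatrix}-d_X^{i+1}&0\\ f^{i+1}&d_Y^i\end{bmatrix}$ $(1\le i\le n-1)$, $[\,f^{n+1}\ d_Y^n\,]$; it does not involve $f^0$. The *mapping cocone* $N_f$ is the dual complex $$X^0\to X^1\oplus Y^0\to\cdots\to X^n\oplus Y^{n-1}\to Y^n$$ with differentials $\begin{bmatrix}d_X^0\\ f^0\end{bmatrix}$, $\begin{bmatrix}d_X^i&0\\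 f^i&-d_Y^{i-1}\end{bmatrix}$ $(1\le i\le n-1)$, $[\,f^n\ \,{-d_Y^{n-1}}\,]$; it does not involve $f^{n+1}$. Morphisms $(f^1,\dots,f^{n+1})$ form an *$n$-pullback diagram* if $M_f$ is an $n$-kernel sequence, and $(f^0,\dots,f^n)$ form an *$n$-pushout diagram* if $N_f$ is an $n$-cokernel sequence. For $A,C\in\mathscr C$, two complexes with $X^0=Y^0=A$ and $X^{n+1}=Y^{n+1}=C$ are *homotopically equivalent* if there are morphisms $f:X\to Y$, $g:Y\to X$, both the identity in degrees $0$ and $n+1$, with $gf\sim\mathrm{id}$ and $fg\sim\mathrm{id}$. The class of $X$ is denoted $[X]$. **$n$-exact categories (Jasso).** $(\mathscr C,\mathcal X)$ is *$n$-exact* if $\mathcal X$ is a class of $n$-exact sequences such that: * if $f:X\to Y$ is a morphism of $n$-exact sequences such that $f^k,f^{k+1}$ are isomorphisms for some $0\le k\le n$, or such that $f^0,f^{n+1}$ are isomorphisms, then $X\in\mathcal X\iff Y\in\mathcal X$; * (E0) the zero sequence is in $\mathcal X$; * (E1), (E1$^{op}$) the admissible monomorphisms (the $d_X^0$ with $X\in\mathcal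 X$) and the admissible epimorphisms (the $d_X^n$ with $X\in\mathcal X$) are closed under composition; * (E2) for $X\in\mathcal X$ and $f^0:X^0\to Y^0$ there is an $n$-pushout diagram $(f^0,\dots,f^n)$ from $X^0\to\cdots\to X^n$ to some $Y^0\to\cdots\to Y^n$ in which $d_Y^0$ is an admissible monomorphism; * (E2$^{op}$) for $Y\in\mathcal X$ and $f^{n+1}:X^{n+1}\to Y^{n+1}$ there is an $n$-pullback diagram $(f^1,\dots,f^{n+1})$ from some $X^1\to\cdots\to X^{n+1}$ to $Y^1\to\cdots\to Y^{n+1}$ in which $d_X^n$ is an admissible epimorphism. **$n$-exangulated categories.** Let $\mathbb E:\mathscr C^{op}\times\mathscr C\to\mathrm{Ab}$ be a biadditive functor; write $a_*=\mathbb E(C,a)$ and $c^*=\mathbb E(c,A)$. Let $\mathfrak s$ assign to each $\delta\in\mathbb E(C,A)$ a homotopy equivalence class $\mathfrak s(\delta)=[X]$ of complexes with $X^0=A$, $X^{n+1}=C$; then $X$ is said to *realize* $\delta$ and to be a *conflation*, $d_X^0$ is an *inflation*, and $d_X^n$ a *deflation*. The triple $(\mathscr C,\mathbb E,\mathfrak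 s)$ is *$n$-exangulated* if: * (R0) if $X,Y$ realize $\delta,\rho$ and $a_*\delta=c^*\rho$, then there is $f:X\to Y$ with $f^0=a$, $f^{n+1}=c$; * (R1) if $X$ realizes $\delta$, then $\mathscr C(-,X^0)\to\cdots\to\mathscr C(-,X^{n+1})\to\mathbb E(-,X^0)$ (last map $g\mapsto g^*\delta$) and $\mathscr C(X^{n+1},-)\to\cdots\to\mathscr C(X^0,-)\to\mathbb E(X^{n+1},-)$ (last map $g\mapsto g_*\delta$) are exact; * (R2) $A\xrightarrow{\mathrm{id}}A\to0\to\cdots\to0$ realizes $0\in\mathbb E(0,A)$, and $0\to\cdots\to0\to A\xrightarrow{\mathrm{id}}A$ realizes $0\in\mathbb E(A,0)$; * (EA1) inflations are closed under composition, and so are deflations; * (EA2) if $X$ realizes $c^*\rho$ and $Y$ realizes $\rho$, where $\rho\in\mathbb E(D,A)$ and $c:C\to D$, then there is $f:X\to Y$ with $f^0=\mathrm{id}_A$, $f^{n+1}=c$ such that $M_f$ realizes $(d_X^0)_*\rho$; * (EA2$^{op}$) if $X$ realizes $\delta$ and $Y$ realizes $a_*\delta$, where $\delta\in\mathbb E(C,A)$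 and $a:A\to B$, then there is $f:X\to Y$ with $f^0=a$, $f^{n+1}=\mathrm{id}_C$ such that $N_f$ realizes $(d_Y^n)^*\delta$. **Proposition.** Let $(\mathscr C,\mathcal X)$ be an $n$-exact category. For $A,C\in\mathscr C$ let $\mathbb E(C,A)$ be the class of all $[X]$ with $X\in\mathcal X$, $X^0=A$, $X^{n+1}=C$, and assume that every $\mathbb E(C,A)$ is a set. Then there is a biadditive functor $\mathbb E:\mathscr C^{op}\times\mathscr C\to\mathrm{Ab}$ with these values such that * for $c:C'\to C$ and $[Y]\in\mathbb E(C,A)$: $c^*[Y]=[X]$ if and only if (after replacing $X$ within its class) there is a morphism $f=(\mathrm{id}_A,f^1,\dots,f^n,c):X\to Y$ for which $(f^1,\dots,f^{n+1})$ is an $n$-pullback diagram; * dually, for $a:A\to A'$ and $[X]\in\mathbb E(C,A)$: $a_*[X]=[Y]$ if and only if (after replacing $Y$ within its class) there is a morphism $f=(a,f^1,\dots,f^n,\mathrm{id}_C):X\to Y$ for which $(f^0,\dots,f^n)$ is an $n$-pushout diagram; * the addition on $\mathbb E(C,A)$ is the Baer sum: $[X\oplus Y]\in\mathbb E(C\oplus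 C,A\oplus A)$ and $[X]+[Y]=(\Delta_C)^*(\nabla_A)_*[X\oplus Y]$, with $\Delta_C:C\to C\oplus C$ the diagonal and $\nabla_A:A\oplus A\to A$ the codiagonal. Moreover, with $\mathfrak s(\delta)=[X]$ for $\delta=[X]\in\mathbb E(C,A)$, the triple $(\mathscr C,\mathbb E,\mathfrak s)$ is an $n$-exangulated category. -/

import Mathlib

open CategoryTheory CategoryTheory.Limits Opposite

universe w v u

namespace NExang

section Complexes

variable {𝒞 : Type u} [Category.{v} 𝒞] [Preadditive 𝒞]

/-- Complexes `X⁰ ⟶ X¹ ⟶ ⋯ ⟶ Xⁿ⁺¹`: cochain complexes whose components vanish in all degrees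
outside `{0, …, n+1}`. -/
def IsNComplex (n : ℕ) (X : CochainComplex 𝒞 ℕ) : Prop :=
  ∀ i, n + 1 < i → IsZero (X.X i)

/-- For every object `T`, the sequence
`Hom(T, X⁰) ⟶ Hom(T, X¹) ⟶ ⋯ ⟶ Hom(T, Xⁿ⁺¹)` is exact at `Hom(T, Xⁱ)` for `1 ≤ i ≤ n`. -/
def CovariantExact (n : ℕ) (X : CochainComplex 𝒞 ℕ) : Prop :=
  ∀ (T : 𝒞) (i : ℕ), i < n → ∀ g : T ⟶ X.X (i + 1), g ≫ X.d (i + 1) (i + 2) = 0 →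
    ∃ h : T ⟶ X.X i, h ≫ X.d i (i + 1) = g

/-- For every object `T`, the sequence
`Hom(Xⁿ⁺¹, T) ⟶ Hom(Xⁿ, T) ⟶ ⋯ ⟶ Hom(X⁰, T)` is exact at `Hom(Xⁱ, T)` for `1 ≤ i ≤ n`. -/
def ContravariantExact (n : ℕ) (X : CochainComplex 𝒞 ℕ) : Prop :=
  ∀ (T : 𝒞) (i : ℕ), i < n → ∀ g : X.X (i + 1) ⟶ T, X.d i (i + 1) ≫ g = 0 →
    ∃ h : X.X (i + 2) ⟶ T, X.d (i + 1) (i + 2) ≫ h = g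

/-- `n`-kernel sequences: `0 ⟶ Hom(-, X⁰) ⟶ ⋯ ⟶ Hom(-, Xⁿ⁺¹)` is exact. -/
structure IsNKernel (n : ℕ) (X : CochainComplex 𝒞 ℕ) : Prop where
  isNComplex : IsNComplex n X
  mono : Mono (X.d 0 1)
  exact : CovariantExact n X

/-- `n`-cokernel sequences: `0 ⟶ Hom(Xⁿ⁺¹, -) ⟶ ⋯ ⟶ Hom(X⁰, -)` is exact. -/
structure IsNCokernel (n : ℕ) (X : CochainComplex 𝒞 ℕ) : Prop where
  isNComplex : IsNComplex n X
  epi : Epi (X.d n (n + 1))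
  exact : ContravariantExact n X

/-- `n`-exact sequences. -/
def IsNExact (n : ℕ) (X : CochainComplex 𝒞 ℕ) : Prop :=
  IsNKernel n X ∧ IsNCokernel n X

end Complexes

section Cones

variable {𝒞 : Type u} [Category.{v} 𝒞] [Preadditive 𝒞] [HasBinaryBiproducts 𝒞]

/-- The objects `P⁰, P¹ ⊕ Q⁰, P² ⊕ Q¹, …`. -/
noncomputable def totalObj (P Q : CochainComplex 𝒞 ℕ) : ℕ → 𝒞
  | 0 => P.X 0
  | k + 1 => P.X (k + 1) ⊞ Q.X k

/-- The differentials `[-d; g]` and `[[-d, 0], [g, d]]`. -/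
noncomputable def coneD {P Q : CochainComplex 𝒞 ℕ} (g : P ⟶ Q) :
    ∀ i, totalObj P Q i ⟶ totalObj P Q (i + 1)
  | 0 => biprod.lift (-P.d 0 1) (g.f 0)
  | k + 1 => biprod.lift (biprod.fst ≫ (-P.d (k + 1) (k + 2)))
      (biprod.fst ≫ g.f (k + 1) + biprod.snd ≫ Q.d k (k + 1))

/-- The differentials `[d; g]` and `[[d, 0], [g, -d]]`. -/
noncomputable def coconeD {P Q : CochainComplex 𝒞 ℕ} (g : P ⟶ Q) :
    ∀ i, totalObj P Q i ⟶ totalObj P Q (i + 1)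
  | 0 => biprod.lift (P.d 0 1) (g.f 0)
  | k + 1 => biprod.lift (biprod.fst ≫ P.d (k + 1) (k + 2))
      (biprod.fst ≫ g.f (k + 1) + biprod.snd ≫ (-Q.d k (k + 1)))

lemma lift_comp_matrix {A B₁ B₂ C₁ C₂ : 𝒞} {a : A ⟶ B₁} {b : A ⟶ B₂} {c : B₁ ⟶ C₁}
    {e : B₁ ⟶ C₂} {h : B₂ ⟶ C₂} (h₁ : a ≫ c = 0) (h₂ : a ≫ e + b ≫ h = 0) :
    biprod.lift a b ≫ biprod.lift (biprod.fst ≫ c) (biprod.fst ≫ e + biprod.snd ≫ h) = 0 := by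
  apply biprod.hom_ext
  · simpa using h₁
  · simpa using h₂

lemma matrix_comp_matrix {A₁ A₂ B₁ B₂ C₁ C₂ : 𝒞} {a : A₁ ⟶ B₁} {b : A₁ ⟶ B₂} {k : A₂ ⟶ B₂}
    {c : B₁ ⟶ C₁} {e : B₁ ⟶ C₂} {h : B₂ ⟶ C₂} (h₁ : a ≫ c = 0) (h₂ : a ≫ e + b ≫ h = 0)
    (h₃ : k ≫ h = 0) :
    (biprod.lift (biprod.fst ≫ a) (biprod.fst ≫ b + biprod.snd ≫ k) : A₁ ⊞ A₂ ⟶ B₁ ⊞ B₂) ≫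
      biprod.lift (biprod.fst ≫ c) (biprod.fst ≫ e + biprod.snd ≫ h) = 0 := by
  apply lift_comp_matrix
  · rw [Category.assoc, h₁, comp_zero]
  · rw [Preadditive.add_comp, Category.assoc, Category.assoc, Category.assoc, h₃, comp_zero,
      add_zero, ← Preadditive.comp_add, h₂, comp_zero]

lemma coneD_comp {P Q : CochainComplex 𝒞 ℕ} (g : P ⟶ Q) (i : ℕ) :
    coneD g i ≫ coneD g (i + 1) = 0 := by
  have h₁ : (-P.d i (i + 1)) ≫ (-P.d (i + 1) (i + 2)) = 0 := by
    rw [Preadditive.neg_comp, Preadditive.comp_neg, P.d_comp_d, neg_zero, neg_zero]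
  have h₂ : (-P.d i (i + 1)) ≫ g.f (i + 1) + g.f i ≫ Q.d i (i + 1) = 0 := by
    rw [g.comm, Preadditive.neg_comp, neg_add_cancel]
  cases i with
  | zero => exact lift_comp_matrix h₁ h₂
  | succ k => exact matrix_comp_matrix h₁ h₂ (Q.d_comp_d _ _ _)

lemma coconeD_comp {P Q : CochainComplex 𝒞 ℕ} (g : P ⟶ Q) (i : ℕ) :
    coconeD g i ≫ coconeD g (i + 1) = 0 := by
  have h₁ : P.d i (i + 1) ≫ P.d (i + 1) (i + 2) = 0 := P.d_comp_d _ _ _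
  have h₂ : P.d i (i + 1) ≫ g.f (i + 1) + g.f i ≫ (-Q.d i (i + 1)) = 0 := by
    rw [Preadditive.comp_neg, g.comm, add_neg_cancel]
  cases i with
  | zero => exact lift_comp_matrix h₁ h₂
  | succ k =>
    have h₃ : (-Q.d k (k + 1)) ≫ (-Q.d (k + 1) (k + 2)) = 0 := by
      rw [Preadditive.neg_comp, Preadditive.comp_neg, Q.d_comp_d, neg_zero, neg_zero]
    exact matrix_comp_matrix h₁ h₂ h₃

/-- The complex `P⁰ ⟶ P¹ ⊕ Q⁰ ⟶ P² ⊕ Q¹ ⟶ ⋯` with the differentials `coneD`. -/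
noncomputable def cone {P Q : CochainComplex 𝒞 ℕ} (g : P ⟶ Q) : CochainComplex 𝒞 ℕ :=
  CochainComplex.of (totalObj P Q) (coneD g) (coneD_comp g)

/-- The complex `P⁰ ⟶ P¹ ⊕ Q⁰ ⟶ P² ⊕ Q¹ ⟶ ⋯` with the differentials `coconeD`. -/
noncomputable def cocone {P Q : CochainComplex 𝒞 ℕ} (g : P ⟶ Q) : CochainComplex 𝒞 ℕ :=
  CochainComplex.of (totalObj P Q) (coconeD g) (coconeD_comp g)

/-- The mapping cone of `f : X ⟶ Y`, which ignores `X⁰`, `Y⁰` and `f⁰` (`truncate` removes the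
component of degree `0` and reindexes):
`X¹ ⟶ X² ⊕ Y¹ ⟶ ⋯ ⟶ Xⁿ⁺¹ ⊕ Yⁿ ⟶ Xⁿ⁺² ⊕ Yⁿ⁺¹`, with differentials
`[-d; f¹]` and `[[-d, 0], [f, d]]`. As `Xⁿ⁺²` is zero for a complex in degrees `0, …, n+1`,
the last term is `Yⁿ⁺¹` and the last differential is `[fⁿ⁺¹, d]`. -/
noncomputable def mappingCone {X Y : CochainComplex 𝒞 ℕ} (f : X ⟶ Y) : CochainComplex 𝒞 ℕ :=
  cone (CochainComplex.truncate.map f)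

/-- The identity of `X¹`, as a morphism to the first term of the mapping cone. -/
noncomputable def toConeZero {X Y : CochainComplex 𝒞 ℕ} (f : X ⟶ Y) :
    X.X 1 ⟶ (mappingCone f).X 0 :=
  𝟙 (X.X 1)

/-- The projection of the last term `0 ⊕ Yⁿ⁺¹` of the mapping cone to `Yⁿ⁺¹`. -/
noncomputable def fromConeLast (n : ℕ) {X Y : CochainComplex 𝒞 ℕ} (f : X ⟶ Y) :
    (mappingCone f).X (n + 1) ⟶ Y.X (n + 1) :=
  (biprod.snd : X.X (n + 2) ⊞ Y.X (n + 1) ⟶ Y.X (n + 1))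

/-- The diagram formed by `f¹, …, fⁿ⁺¹` is an `n`-pullback diagram. -/
def IsNPullback (n : ℕ) {X Y : CochainComplex 𝒞 ℕ} (f : X ⟶ Y) : Prop :=
  IsNKernel n (mappingCone f)

/-- The termwise direct sum of complexes. -/
noncomputable def directSum (X Y : CochainComplex 𝒞 ℕ) : CochainComplex 𝒞 ℕ where
  X i := X.X i ⊞ Y.X i
  d i j := biprod.map (X.d i j) (Y.d i j)
  shape i j h := by
    apply biprod.hom_ext <;> simp [X.shape i j h, Y.shape i j h]
  d_comp_d' i j k _ _ := by
    apply biprod.hom_ext <;> simp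

end Cones

section Cocones

variable {𝒞 : Type u} [Category.{v} 𝒞] [Preadditive 𝒞] [HasZeroObject 𝒞]

open scoped ZeroObject

/-- `Xⁱ` for `i ≤ n`, and zero for `i > n`. -/
noncomputable def upToObj (n : ℕ) (X : CochainComplex 𝒞 ℕ) (i : ℕ) : 𝒞 :=
  if i ≤ n then X.X i else 0

lemma upToObj_eq (n : ℕ) (X : CochainComplex 𝒞 ℕ) {i : ℕ} (hi : i ≤ n) :
    upToObj n X i = X.X i :=
  if_pos hi

/-- The morphism `Xⁱ ⟶ Yʲ` induced on the parts in degrees at most `n`. -/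
noncomputable def upToHom (n : ℕ) {X Y : CochainComplex 𝒞 ℕ} {i j : ℕ} (f : X.X i ⟶ Y.X j) :
    upToObj n X i ⟶ upToObj n Y j :=
  if h : i ≤ n ∧ j ≤ n then
    eqToHom (upToObj_eq n X h.1) ≫ f ≫ eqToHom (upToObj_eq n Y h.2).symm
  else 0

lemma upToHom_comp (n : ℕ) {X Y Z : CochainComplex 𝒞 ℕ} {i j k : ℕ} (f : X.X i ⟶ Y.X j)
    (g : Y.X j ⟶ Z.X k) (hjk : j ≤ k) :
    upToHom n f ≫ upToHom n g = upToHom n (f ≫ g) := by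
  unfold upToHom
  by_cases hi : i ≤ n <;> by_cases hj : j ≤ n <;> by_cases hk : k ≤ n
  all_goals first | omega | simp [hi, hj, hk]

lemma upToHom_zero (n : ℕ) {X Y : CochainComplex 𝒞 ℕ} (i j : ℕ) :
    upToHom n (0 : X.X i ⟶ Y.X j) = 0 := by
  simp [upToHom]

/-- The part of `X` in degrees `0, …, n`, extended by zero. -/
noncomputable def upTo (n : ℕ) (X : CochainComplex 𝒞 ℕ) : CochainComplex 𝒞 ℕ where
  X i := upToObj n X i
  d i j := upToHom n (X.d i j)
  shape i j hij := by rw [X.shape i j hij, upToHom_zero]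
  d_comp_d' i j k _ hjk := by
    obtain rfl : j + 1 = k := hjk
    rw [upToHom_comp n _ _ (Nat.le_succ j), X.d_comp_d, upToHom_zero]

/-- The restriction of a morphism to the degrees `0, …, n`. -/
noncomputable def upToMap (n : ℕ) {X Y : CochainComplex 𝒞 ℕ} (f : X ⟶ Y) :
    upTo n X ⟶ upTo n Y where
  f i := upToHom n (f.f i)
  comm' i j hij := by
    obtain rfl : i + 1 = j := hij
    exact (upToHom_comp n _ _ (Nat.le_succ i)).trans
      ((congrArg _ (f.comm i (i + 1))).trans (upToHom_comp n _ _ le_rfl).symm)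

variable [HasBinaryBiproducts 𝒞]

/-- The mapping cocone of `f : X ⟶ Y`, which ignores `Xⁿ⁺¹`, `Yⁿ⁺¹` and `fⁿ⁺¹`:
`X⁰ ⟶ X¹ ⊕ Y⁰ ⟶ ⋯ ⟶ Xⁿ ⊕ Yⁿ⁻¹ ⟶ 0 ⊕ Yⁿ`, with differentials `[d; f⁰]`, `[[d, 0], [f, -d]]`
and, into the last term `Yⁿ`, `[fⁿ, -d]`. It is the mapping cone formed in the opposite
category. -/
noncomputable def mappingCocone (n : ℕ) {X Y : CochainComplex 𝒞 ℕ} (f : X ⟶ Y) :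
    CochainComplex 𝒞 ℕ :=
  cocone (upToMap n f)

/-- The identification of `X⁰` with the first term of the mapping cocone. -/
noncomputable def toCoconeZero (n : ℕ) {X Y : CochainComplex 𝒞 ℕ} (f : X ⟶ Y) :
    X.X 0 ⟶ (mappingCocone n f).X 0 :=
  eqToHom (upToObj_eq n X (Nat.zero_le n)).symm

/-- The projection of the last term `0 ⊕ Yⁿ` of the mapping cocone to `Yⁿ`. -/
noncomputable def fromCoconeLast (n : ℕ) {X Y : CochainComplex 𝒞 ℕ} (f : X ⟶ Y) :
    (mappingCocone n f).X (n + 1) ⟶ Y.X n :=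
  (biprod.snd : (upTo n X).X (n + 1) ⊞ (upTo n Y).X n ⟶ (upTo n Y).X n) ≫
    eqToHom (upToObj_eq n Y le_rfl)

/-- The diagram formed by `f⁰, …, fⁿ` is an `n`-pushout diagram. -/
def IsNPushout (n : ℕ) {X Y : CochainComplex 𝒞 ℕ} (f : X ⟶ Y) : Prop :=
  IsNCokernel n (mappingCocone n f)

end Cocones

section NExactCategories

variable {𝒞 : Type u} [Category.{v} 𝒞] [Preadditive 𝒞]

/-- `f` is the differential `Xⁱ ⟶ Xⁱ⁺¹`. -/
def IsDifferential (X : CochainComplex 𝒞 ℕ) (i : ℕ) {A B : 𝒞} (f : A ⟶ B) : Prop :=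
  ∃ (h₀ : X.X i = A) (h₁ : X.X (i + 1) = B),
    f = eqToHom h₀.symm ≫ X.d i (i + 1) ≫ eqToHom h₁

/-- Admissible monomorphisms: the first morphisms `X⁰ ⟶ X¹` of the sequences in `𝒳`. -/
def IsAdmissibleMono (𝒳 : CochainComplex 𝒞 ℕ → Prop) {A B : 𝒞} (f : A ⟶ B) : Prop :=
  ∃ X, 𝒳 X ∧ IsDifferential X 0 f

/-- Admissible epimorphisms: the last morphisms `Xⁿ ⟶ Xⁿ⁺¹` of the sequences in `𝒳`. -/
def IsAdmissibleEpi (n : ℕ) (𝒳 : CochainComplex 𝒞 ℕ → Prop) {A B : 𝒞} (f : A ⟶ B) : Prop :=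
  ∃ X, 𝒳 X ∧ IsDifferential X n f

/-- `n`-exact categories in the sense of Jasso: `𝒳` is a class of `n`-exact sequences, closed
under weak isomorphisms, which satisfies (E0), (E1), (E1ᵒᵖ), (E2) and (E2ᵒᵖ). -/
structure IsNExactCategory [HasZeroObject 𝒞] [HasBinaryBiproducts 𝒞] (n : ℕ)
    (𝒳 : CochainComplex 𝒞 ℕ → Prop) : Prop where
  isNExact : ∀ X, 𝒳 X → IsNExact n X
  /-- closure under morphisms with two consecutive invertible components -/
  closed_consecutive : ∀ (X Y : CochainComplex 𝒞 ℕ) (f : X ⟶ Y), IsNExact n X → IsNExact n Y →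
    ∀ k, k ≤ n → IsIso (f.f k) → IsIso (f.f (k + 1)) → (𝒳 X ↔ 𝒳 Y)
  /-- closure under morphisms with invertible end components -/
  closed_ends : ∀ (X Y : CochainComplex 𝒞 ℕ) (f : X ⟶ Y), IsNExact n X → IsNExact n Y →
    IsIso (f.f 0) → IsIso (f.f (n + 1)) → (𝒳 X ↔ 𝒳 Y)
  /-- (E0) -/
  zero : ∀ X, IsZero X → 𝒳 X
  /-- (E1) -/
  mono_comp : ∀ {A B C : 𝒞} (f : A ⟶ B) (g : B ⟶ C),
    IsAdmissibleMono 𝒳 f → IsAdmissibleMono 𝒳 g → IsAdmissibleMono 𝒳 (f ≫ g)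
  /-- (E1ᵒᵖ) -/
  epi_comp : ∀ {A B C : 𝒞} (f : A ⟶ B) (g : B ⟶ C),
    IsAdmissibleEpi n 𝒳 f → IsAdmissibleEpi n 𝒳 g → IsAdmissibleEpi n 𝒳 (f ≫ g)
  /-- (E2): the lower row `Y⁰ ⟶ ⋯ ⟶ Yⁿ` of the `n`-pushout diagram is a complex in degrees
  `0, …, n`, so that a family `f⁰, …, fⁿ` of commuting squares is a morphism of complexes. -/
  pushout : ∀ (X : CochainComplex 𝒞 ℕ), 𝒳 X → ∀ {B : 𝒞} (a : X.X 0 ⟶ B),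
    ∃ (Y : CochainComplex 𝒞 ℕ) (_ : ∀ i, n < i → IsZero (Y.X i)) (h : Y.X 0 = B) (f : X ⟶ Y),
      f.f 0 = a ≫ eqToHom h.symm ∧ IsNPushout n f ∧ IsAdmissibleMono 𝒳 (Y.d 0 1)
  /-- (E2ᵒᵖ): the upper row `X¹ ⟶ ⋯ ⟶ Xⁿ⁺¹` of the `n`-pullback diagram is a complex in degrees
  `1, …, n+1`, so that a family `f¹, …, fⁿ⁺¹` of commuting squares is a morphism of complexes. -/
  pullback : ∀ (Y : CochainComplex 𝒞 ℕ), 𝒳 Y → ∀ {D : 𝒞} (c : D ⟶ Y.X (n + 1)),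
    ∃ (X : CochainComplex 𝒞 ℕ) (_ : IsNComplex n X) (_ : IsZero (X.X 0)) (h : X.X (n + 1) = D)
      (f : X ⟶ Y),
      f.f (n + 1) = eqToHom h ≫ c ∧ IsNPullback n f ∧ IsAdmissibleEpi n 𝒳 (X.d n (n + 1))

end NExactCategories

section FixedEnds

variable {𝒞 : Type u} [Category.{v} 𝒞] [Preadditive 𝒞]

/-- Complexes in degrees `0, …, n+1` with `X⁰ = A` and `Xⁿ⁺¹ = C`. -/
structure EndComplex (n : ℕ) (A C : 𝒞) where
  /-- the complex -/
  K : CochainComplex 𝒞 ℕ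
  isNComplex : IsNComplex n K
  left : K.X 0 = A
  right : K.X (n + 1) = C

namespace EndComplex

/-- A complex, regarded as a complex with its own end terms. -/
def ofComplex (n : ℕ) (X : CochainComplex 𝒞 ℕ) (hX : IsNComplex n X) :
    EndComplex n (X.X 0) (X.X (n + 1)) :=
  ⟨X, hX, rfl, rfl⟩

variable {n : ℕ}

/-- `f⁰ = a` and `fⁿ⁺¹ = c`. -/
def HasEnds {A C B D : 𝒞} {X : EndComplex n A C} {Y : EndComplex n B D} (f : X.K ⟶ Y.K)
    (a : A ⟶ B) (c : C ⟶ D) : Prop :=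
  f.f 0 = eqToHom X.left ≫ a ≫ eqToHom Y.left.symm ∧
    f.f (n + 1) = eqToHom X.right ≫ c ≫ eqToHom Y.right.symm

/-- Homotopy equivalence in the category of complexes with end terms `A` and `C`, whose morphisms
are the morphisms of complexes that are the identity on both end terms. -/
def HtpyEquiv {A C : 𝒞} (X Y : EndComplex n A C) : Prop :=
  ∃ (f : X.K ⟶ Y.K) (g : Y.K ⟶ X.K), HasEnds f (𝟙 A) (𝟙 C) ∧ HasEnds g (𝟙 A) (𝟙 C) ∧
    Nonempty (Homotopy (f ≫ g) (𝟙 X.K)) ∧ Nonempty (Homotopy (g ≫ f) (𝟙 Y.K))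

lemma HasEnds.comp {A C A' C' A'' C'' : 𝒞} {X : EndComplex n A C} {Y : EndComplex n A' C'}
    {Z : EndComplex n A'' C''} {f : X.K ⟶ Y.K} {g : Y.K ⟶ Z.K} {a : A ⟶ A'} {c : C ⟶ C'}
    {a' : A' ⟶ A''} {c' : C' ⟶ C''} (hf : HasEnds f a c) (hg : HasEnds g a' c') :
    HasEnds (f ≫ g) (a ≫ a') (c ≫ c') := by
  constructor
  · simp [hf.1, hg.1]
  · simp [hf.2, hg.2]

lemma htpyEquiv_equivalence (n : ℕ) (A C : 𝒞) :
    Equivalence (HtpyEquiv (n := n) (A := A) (C := C)) where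
  refl X := ⟨𝟙 _, 𝟙 _, by simp [HasEnds], by simp [HasEnds],
    ⟨Homotopy.ofEq (by simp)⟩, ⟨Homotopy.ofEq (by simp)⟩⟩
  symm := fun ⟨f, g, hf, hg, h₁, h₂⟩ => ⟨g, f, hg, hf, h₂, h₁⟩
  trans := by
    rintro X Y Z ⟨f, g, hf, hg, ⟨h₁⟩, ⟨h₂⟩⟩ ⟨f', g', hf', hg', ⟨h₁'⟩, ⟨h₂'⟩⟩
    refine ⟨f ≫ f', g' ≫ g, by simpa using hf.comp hf', by simpa using hg'.comp hg, ⟨?_⟩, ⟨?_⟩⟩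
    · exact (Homotopy.ofEq (by simp)).trans
        ((((h₁'.compLeft f).compRight g).trans (Homotopy.ofEq (by simp))).trans h₁)
    · exact (Homotopy.ofEq (by simp)).trans
        ((((h₂.compLeft g').compRight f').trans (Homotopy.ofEq (by simp))).trans h₂')

instance setoid (n : ℕ) (A C : 𝒞) : Setoid (EndComplex n A C) :=
  ⟨HtpyEquiv, htpyEquiv_equivalence n A C⟩

/-- The direct sum of complexes with fixed ends. -/
noncomputable def sum [HasBinaryBiproducts 𝒞] {A C B D : 𝒞} (X : EndComplex n A C)
    (Y : EndComplex n B D) : EndComplex n (A ⊞ B) (C ⊞ D) where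
  K := directSum X.K Y.K
  isNComplex i hi := by
    have hX := X.isNComplex i hi
    have hY := Y.isNComplex i hi
    rw [IsZero.iff_id_eq_zero]
    exact biprod.hom_ext _ _ (hX.eq_of_tgt _ _) (hY.eq_of_tgt _ _)
  left := by
    obtain ⟨X, _, rfl, rfl⟩ := X
    obtain ⟨Y, _, rfl, rfl⟩ := Y
    rfl
  right := by
    obtain ⟨X, _, rfl, rfl⟩ := X
    obtain ⟨Y, _, rfl, rfl⟩ := Y
    rfl

end EndComplex

/-- Homotopy equivalence classes `[X]` of complexes with end terms `A` and `C`. -/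
def HtpyClass (n : ℕ) (A C : 𝒞) : Type (max u v) :=
  Quotient (EndComplex.setoid n A C)

/-- The homotopy equivalence class of a complex with end terms `A` and `C`. -/
def htpyClass {n : ℕ} {A C : 𝒞} (X : EndComplex n A C) : HtpyClass n A C :=
  Quotient.mk (EndComplex.setoid n A C) X

/-- The Yoneda extension classes of `C` by `A`: the classes `[X]` with `X` in `𝒳`. -/
def YonedaExt (n : ℕ) (𝒳 : CochainComplex 𝒞 ℕ → Prop) (A C : 𝒞) : Type (max u v) :=
  {ξ : HtpyClass n A C // ∃ X : EndComplex n A C, 𝒳 X.K ∧ ξ = htpyClass X}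

end FixedEnds

section Extensions

variable {𝒞 : Type u} [Category.{v} 𝒞]

/-- The group `E(C, A)` of extensions. -/
abbrev Extn (E : 𝒞ᵒᵖ ⥤ 𝒞 ⥤ AddCommGrpCat.{w}) (C A : 𝒞) : Type w :=
  (E.obj (op C)).obj A

/-- `a_* δ = E(C, a)(δ)`. -/
def push (E : 𝒞ᵒᵖ ⥤ 𝒞 ⥤ AddCommGrpCat.{w}) {A B C : 𝒞} (a : A ⟶ B) (δ : Extn E C A) :
    Extn E C B :=
  ((E.obj (op C)).map a).hom δ

/-- `c^* δ = E(c, A)(δ)`. -/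
def pull (E : 𝒞ᵒᵖ ⥤ 𝒞 ⥤ AddCommGrpCat.{w}) {A C D : 𝒞} (c : D ⟶ C) (δ : Extn E C A) :
    Extn E D A :=
  ((E.map c.op).app A).hom δ

variable [Preadditive 𝒞]

/-- Biadditive functors `𝒞ᵒᵖ × 𝒞 ⥤ Ab`. -/
structure IsBiadditive (E : 𝒞ᵒᵖ ⥤ 𝒞 ⥤ AddCommGrpCat.{w}) : Prop where
  push_add : ∀ {A B C : 𝒞} (a a' : A ⟶ B) (δ : Extn E C A),
    push E (a + a') δ = push E a δ + push E a' δ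
  pull_add : ∀ {A C D : 𝒞} (c c' : D ⟶ C) (δ : Extn E C A),
    pull E (c + c') δ = pull E c δ + pull E c' δ

/-- `n`-exangles `⟨X, δ⟩`: the sequences
`Hom(-, X⁰) ⟶ ⋯ ⟶ Hom(-, Xⁿ⁺¹) ⟶ E(-, X⁰)` and
`Hom(Xⁿ⁺¹, -) ⟶ ⋯ ⟶ Hom(X⁰, -) ⟶ E(Xⁿ⁺¹, -)` are exact. -/
structure IsNExangle (n : ℕ) (E : 𝒞ᵒᵖ ⥤ 𝒞 ⥤ AddCommGrpCat.{w}) (X : CochainComplex 𝒞 ℕ)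
    (δ : Extn E (X.X (n + 1)) (X.X 0)) : Prop where
  isNComplex : IsNComplex n X
  covariantExact : CovariantExact n X
  covariantExact_last : ∀ (T : 𝒞) (g : T ⟶ X.X (n + 1)),
    pull E g δ = 0 ↔ ∃ h : T ⟶ X.X n, h ≫ X.d n (n + 1) = g
  contravariantExact : ContravariantExact n X
  contravariantExact_last : ∀ (T : 𝒞) (g : X.X 0 ⟶ T),
    push E g δ = 0 ↔ ∃ h : X.X 1 ⟶ T, X.d 0 1 ≫ h = g

/-- A correspondence that assigns to each extension `δ` in `E(C, A)` a homotopy equivalence class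
of complexes with end terms `A` and `C`. -/
abbrev Correspondence (n : ℕ) (E : 𝒞ᵒᵖ ⥤ 𝒞 ⥤ AddCommGrpCat.{w}) : Type (max u v w) :=
  ∀ (A C : 𝒞), Extn E C A → HtpyClass n A C

variable {n : ℕ} {E : 𝒞ᵒᵖ ⥤ 𝒞 ⥤ AddCommGrpCat.{w}}

/-- `s(δ) = [X]`. -/
def Realizes (s : Correspondence n E) (X : CochainComplex 𝒞 ℕ)
    (δ : Extn E (X.X (n + 1)) (X.X 0)) : Prop :=
  ∃ hX : IsNComplex n X, s _ _ δ = htpyClass (EndComplex.ofComplex n X hX)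

/-- Exact realizations: (R0), (R1) and both parts of (R2). -/
structure IsExactRealization (s : Correspondence n E) : Prop where
  lift : ∀ (X Y : CochainComplex 𝒞 ℕ) (δ : Extn E (X.X (n + 1)) (X.X 0))
    (ρ : Extn E (Y.X (n + 1)) (Y.X 0)), Realizes s X δ → Realizes s Y ρ →
    ∀ (a : X.X 0 ⟶ Y.X 0) (c : X.X (n + 1) ⟶ Y.X (n + 1)), push E a δ = pull E c ρ →
      ∃ f : X ⟶ Y, f.f 0 = a ∧ f.f (n + 1) = c
  isNExangle : ∀ (X : CochainComplex 𝒞 ℕ) (δ : Extn E (X.X (n + 1)) (X.X 0)),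
    Realizes s X δ → IsNExangle n E X δ
  /-- complexes of the form `A ≅ A ⟶ 0 ⟶ ⋯ ⟶ 0` realize zero -/
  zero_left : ∀ X : CochainComplex 𝒞 ℕ, IsIso (X.d 0 1) → (∀ i, 2 ≤ i → IsZero (X.X i)) →
    Realizes s X 0
  /-- complexes of the form `0 ⟶ ⋯ ⟶ 0 ⟶ A ≅ A` realize zero -/
  zero_right : ∀ X : CochainComplex 𝒞 ℕ, IsNComplex n X → IsIso (X.d n (n + 1)) →
    (∀ i, i < n → IsZero (X.X i)) → Realizes s X 0

/-- Inflations: the first morphisms `X⁰ ⟶ X¹` of conflations. -/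
def IsInflation (s : Correspondence n E) {A B : 𝒞} (f : A ⟶ B) : Prop :=
  ∃ (X : CochainComplex 𝒞 ℕ) (δ : Extn E (X.X (n + 1)) (X.X 0)),
    Realizes s X δ ∧ IsDifferential X 0 f

/-- Deflations: the last morphisms `Xⁿ ⟶ Xⁿ⁺¹` of conflations. -/
def IsDeflation (s : Correspondence n E) {A B : 𝒞} (f : A ⟶ B) : Prop :=
  ∃ (X : CochainComplex 𝒞 ℕ) (δ : Extn E (X.X (n + 1)) (X.X 0)),
    Realizes s X δ ∧ IsDifferential X n f

variable [HasZeroObject 𝒞] [HasBinaryBiproducts 𝒞]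

/-- `(𝒞, E, s)` is an `n`-exangulated category. -/
structure IsNExangulated (n : ℕ) (E : 𝒞ᵒᵖ ⥤ 𝒞 ⥤ AddCommGrpCat.{w})
    (s : Correspondence n E) : Prop where
  isBiadditive : IsBiadditive E
  isExactRealization : IsExactRealization s
  /-- (EA1), for inflations -/
  inflation_comp : ∀ {A B C : 𝒞} (f : A ⟶ B) (g : B ⟶ C),
    IsInflation s f → IsInflation s g → IsInflation s (f ≫ g)
  /-- (EA1), for deflations -/
  deflation_comp : ∀ {A B C : 𝒞} (f : A ⟶ B) (g : B ⟶ C),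
    IsDeflation s f → IsDeflation s g → IsDeflation s (f ≫ g)
  /-- (EA2): if `X` realizes `c^* ρ`, `Y` realizes `ρ` and `X⁰ = Y⁰`, then `(1, c)` has a lift `f`
  such that `⟨M_f, (d_X⁰)_* ρ⟩` is distinguished. -/
  good_lift : ∀ (X Y : CochainComplex 𝒞 ℕ) (h : X.X 0 = Y.X 0)
    (c : X.X (n + 1) ⟶ Y.X (n + 1)) (ρ : Extn E (Y.X (n + 1)) (Y.X 0)),
    Realizes s X (pull E c (push E (eqToHom h.symm) ρ)) → Realizes s Y ρ →
      ∃ f : X ⟶ Y, f.f 0 = eqToHom h ∧ f.f (n + 1) = c ∧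
        Realizes s (mappingCone f) (push E (toConeZero f) (pull E (fromConeLast n f)
          (push E (X.d 0 1) (push E (eqToHom h.symm) ρ))))
  /-- (EA2ᵒᵖ): if `X` realizes `δ`, `Y` realizes `a_* δ` and `Xⁿ⁺¹ = Yⁿ⁺¹`, then `(a, 1)` has a
  lift `f` whose mapping cocone `N_f` gives a distinguished `⟨N_f, (d_Yⁿ)^* δ⟩`. -/
  good_colift : ∀ (X Y : CochainComplex 𝒞 ℕ) (h : X.X (n + 1) = Y.X (n + 1))
    (a : X.X 0 ⟶ Y.X 0) (δ : Extn E (X.X (n + 1)) (X.X 0)),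
    Realizes s X δ → Realizes s Y (push E a (pull E (eqToHom h.symm) δ)) →
      ∃ f : X ⟶ Y, f.f 0 = a ∧ f.f (n + 1) = eqToHom h ∧
        Realizes s (mappingCocone n f) (push E (toCoconeZero n f) (pull E (fromCoconeLast n f)
          (pull E (Y.d n (n + 1)) (pull E (eqToHom h.symm) δ))))

/-- The bifunctor `E`, together with the identifications `cls` of `E(C, A)` with the classes `[X]`
of sequences `X` in `𝒳` with end terms `A` and `C`, is the Yoneda extension bifunctor:
`c^* [Y] = [X]` is given by `n`-pullback diagrams, `a_* [X] = [Y]` by `n`-pushout diagrams, and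
the addition of `E(C, A)` is the Baer sum `[X] + [Y] = Δ^* ∇_* [X ⊕ Y]`. -/
structure IsYonedaBifunctor (n : ℕ) (𝒳 : CochainComplex 𝒞 ℕ → Prop)
    (E : 𝒞ᵒᵖ ⥤ 𝒞 ⥤ AddCommGrpCat.{w})
    (cls : ∀ A C : 𝒞, Extn E C A ≃ YonedaExt n 𝒳 A C) : Prop where
  pull_iff : ∀ {A C D : 𝒞} (c : D ⟶ C) (ξ : Extn E C A) (η : Extn E D A) (Y : EndComplex n A C),
    (cls A C ξ).1 = htpyClass Y →
      (pull E c ξ = η ↔ ∃ (X : EndComplex n A D) (f : X.K ⟶ Y.K), (cls A D η).1 = htpyClass X ∧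
        EndComplex.HasEnds f (𝟙 A) c ∧ IsNPullback n f)
  push_iff : ∀ {A B C : 𝒞} (a : A ⟶ B) (ξ : Extn E C A) (η : Extn E C B) (X : EndComplex n A C),
    (cls A C ξ).1 = htpyClass X →
      (push E a ξ = η ↔ ∃ (Y : EndComplex n B C) (f : X.K ⟶ Y.K), (cls B C η).1 = htpyClass Y ∧
        EndComplex.HasEnds f a (𝟙 C) ∧ IsNPushout n f)
  baer_sum : ∀ {A C : 𝒞} (ξ η : Extn E C A) (X Y : EndComplex n A C),
    (cls A C ξ).1 = htpyClass X → (cls A C η).1 = htpyClass Y →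
      ∃ σ : Extn E (C ⊞ C) (A ⊞ A), (cls (A ⊞ A) (C ⊞ C) σ).1 = htpyClass (X.sum Y) ∧
        ξ + η = pull E (biprod.lift (𝟙 C) (𝟙 C)) (push E (biprod.desc (𝟙 A) (𝟙 A)) σ)

end Extensions

end NExang

/-! The proof rests on one principle: a morphism `f : X ⟶ Y` between sequences in `𝒳` that is
invertible in degree `n + 1` exhibits `Y` as the pushout of `X` along `f⁰`; dually, one that is
invertible in degree `0` exhibits a pullback. So extension classes can be handled through morphisms
with prescribed end components alone.

The principle comes from a contractibility argument (`exists_desc_of_isIso`). Suppose `φ : Y⁰ ⟶ T`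
is such that `f⁰ ≫ φ` extends over `d_X⁰`. Push `Y` out along `φ` to `W`. In degree `0` the
composite `X ⟶ Y ⟶ W` factors through `d_X⁰`, so it is null-homotopic; its last component is
invertible and factors through `d_Wⁿ`. Hence `W` is contractible, `d_W⁰` splits, and the splitting
extends `φ` over `d_Y⁰`. This gives the universal properties `exists_hom_of_pushout` and
`exists_hom_of_pullback`.

It follows that `a_* ξ = c^* η` holds exactly when some morphism between representatives has ends
`a` and `c` (`pushExt_eq_pullExt_iff`). Functoriality, the interchange of `a_*` with `c^*`, and (R0)
are formal consequences.

For the group structure, `a_* ξ + b_* ξ = (a + b)_* ξ`, and any two classes are the images of one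
class under the two projections of `A ⊞ B`. The group axioms thus reduce to identities between
morphisms of `𝒞`.

For (EA2), let `f : X ⟶ Y` be any lift that is invertible in degree `0`. Its cone is `n`-exact and
receives from `Y` a morphism that is `d_X⁰` in degree `0`, up to `f⁰`, and invertible in degree `n +
1`. Hence the cone is in `𝒳` and represents `(d_X⁰)_* ρ` (`mappingCone_mem`): every lift is good.
Cocones are dual. Conflations are exactly the sequences in `𝒳`, so (EA1) is (E1), and (R1) at the
ends holds because a morphism out of or into a sequence that is zero at the relevant end is
null-homotopic. -/

namespace NExang

/-! ### Recursive choice of sequences -/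

section Sequences

lemma exists_seq {T : ℕ → Type*} (P : ∀ i, T i → Prop) (R : ∀ i, T i → T (i + 1) → Prop)
    (t₀ : T 0) (h₀ : P 0 t₀) (step : ∀ i t, P i t → ∃ t', R i t t' ∧ P (i + 1) t') :
    ∃ t : ∀ i, T i, t 0 = t₀ ∧ ∀ i, R i (t i) (t (i + 1)) := by
  choose F hF using step
  let s : ∀ i, {t : T i // P i t} :=
    Nat.rec ⟨t₀, h₀⟩ fun i x => ⟨F i x.1 x.2, (hF i x.1 x.2).2⟩
  exact ⟨fun i => (s i).1, rfl, fun i => (hF i (s i).1 (s i).2).1⟩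

/-- Downward recursion from `N` to `0`. The values above `N` are zero, as a homotopy into a bounded
complex requires, and `P 0` is returned because degree `0` needs a separate argument. -/
lemma exists_seq_desc {T : ℕ → Type*} [∀ i, Zero (T i)] (P : ∀ i, T i → Prop)
    (R : ∀ i, T i → T (i + 1) → Prop) (N : ℕ) (t₀ : T N) (h₀ : P N t₀)
    (step : ∀ i, i < N → ∀ t, P (i + 1) t → ∃ t', R i t' t ∧ P i t') :
    ∃ t : ∀ i, T i, t N = t₀ ∧ P 0 (t 0) ∧ (∀ i, i < N → R i (t i) (t (i + 1))) ∧
      ∀ i, N < i → t i = 0 := by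
  induction N with
  | zero =>
    refine ⟨Function.update 0 0 t₀, by simp, by simpa using h₀, by simp, fun i hi => ?_⟩
    rw [Function.update_of_ne (by omega)]
    rfl
  | succ N ih =>
    obtain ⟨t', ht', hP⟩ := step N (Nat.lt_succ_self N) t₀ h₀
    obtain ⟨t, h1, h2, h3, h4⟩ := ih t' hP fun i hi => step i (by omega)
    refine ⟨Function.update t (N + 1) t₀, by simp, ?_, fun i hi => ?_, fun i hi => ?_⟩
    · rwa [Function.update_of_ne (by omega)]
    · rw [Function.update_of_ne (by omega)]
      obtain rfl | hi := Nat.lt_succ_iff_lt_or_eq.mp hi |>.symm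
      · rw [Function.update_self, h1]
        exact ht'
      · rw [Function.update_of_ne (by omega)]
        exact h3 i hi
    · rw [Function.update_of_ne (by omega)]
      exact h4 i (by omega)

end Sequences

/-! ### Null-homotopic morphisms and the comparison principle -/

section Homotopies

variable {𝒞 : Type u} [Category.{v} 𝒞] [Preadditive 𝒞] {n : ℕ}

/-- At `i = n` the last differential is epi, which forces `g = 0`; beyond that the objects vanish.
Without the bound `i < n`, upward recursions need no case distinction. -/
lemma IsNCokernel.exists_desc {X : CochainComplex 𝒞 ℕ} (hX : IsNCokernel n X) {T : 𝒞} (i : ℕ)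
    (g : X.X (i + 1) ⟶ T) (hg : X.d i (i + 1) ≫ g = 0) :
    ∃ h : X.X (i + 2) ⟶ T, X.d (i + 1) (i + 2) ≫ h = g := by
  rcases lt_trichotomy i n with hi | rfl | hi
  · exact hX.exact T i hi g hg
  · have := hX.epi
    exact ⟨0, by rw [comp_zero, ((cancel_epi _).mp (hg.trans comp_zero.symm))]⟩
  · exact ⟨0, (hX.isNComplex (i + 1) (by omega)).eq_of_src _ _⟩

/-- The morphism of complexes `d h + h d`. -/
def nullMap {X Y : CochainComplex 𝒞 ℕ} (h : ∀ i, X.X (i + 1) ⟶ Y.X i) : X ⟶ Y :=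
  CochainComplex.ofHom
    (fun i => match i with
      | 0 => X.d 0 1 ≫ h 0
      | i + 1 => h i ≫ Y.d i (i + 1) + X.d (i + 1) (i + 2) ≫ h (i + 1))
    (fun i => by
      cases i with
      | zero => simp
      | succ i => simp; rfl)

section

variable {X Y : CochainComplex 𝒞 ℕ}

lemma nullMap_zero (h : ∀ i, X.X (i + 1) ⟶ Y.X i) : (nullMap h).f 0 = X.d 0 1 ≫ h 0 := rfl

lemma nullMap_succ (h : ∀ i, X.X (i + 1) ⟶ Y.X i) (i : ℕ) :
    (nullMap h).f (i + 1) = h i ≫ Y.d i (i + 1) + X.d (i + 1) (i + 2) ≫ h (i + 1) := rfl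

lemma nullMap_last (hX : IsNComplex n X)
    (h : ∀ i, X.X (i + 1) ⟶ Y.X i) : (nullMap h).f (n + 1) = h n ≫ Y.d n (n + 1) := by
  rw [nullMap_succ, (hX (n + 2) (by omega)).eq_of_src (h (n + 1)) 0, comp_zero, add_zero]

lemma eq_nullMap {f : X ⟶ Y} {h : ∀ i, X.X (i + 1) ⟶ Y.X i} (h₀ : f.f 0 = X.d 0 1 ≫ h 0)
    (h₁ : ∀ i, f.f (i + 1) = h i ≫ Y.d i (i + 1) + X.d (i + 1) (i + 2) ≫ h (i + 1)) :
    f = nullMap h := by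
  ext i
  cases i with
  | zero => exact h₀
  | succ i => exact h₁ i

/-- The null-homotopic morphism given by a single morphism `h : Xᵏ⁺¹ ⟶ Yᵏ`. -/
def singleNullMap (k : ℕ) (h : X.X (k + 1) ⟶ Y.X k) : X ⟶ Y :=
  nullMap (Pi.single k h)

lemma singleNullMap_self (k : ℕ) (h : X.X (k + 1) ⟶ Y.X k) :
    (singleNullMap k h).f k = X.d k (k + 1) ≫ h := by
  cases k with
  | zero => rw [singleNullMap, nullMap_zero, Pi.single_eq_same]
  | succ k =>
    rw [singleNullMap, nullMap_succ, Pi.single_eq_same, Pi.single_eq_of_ne (by omega), zero_comp,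
      zero_add]

lemma singleNullMap_succ (k : ℕ) (h : X.X (k + 1) ⟶ Y.X k) :
    (singleNullMap k h).f (k + 1) = h ≫ Y.d k (k + 1) := by
  rw [singleNullMap, nullMap_succ, Pi.single_eq_same, Pi.single_eq_of_ne (by omega), comp_zero,
      add_zero]

lemma singleNullMap_of_ne (k : ℕ) (h : X.X (k + 1) ⟶ Y.X k) (i : ℕ) (h₁ : i ≠ k)
    (h₂ : i ≠ k + 1) : (singleNullMap k h).f i = 0 := by
  cases i with
  | zero => rw [singleNullMap, nullMap_zero, Pi.single_eq_of_ne h₁, comp_zero]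
  | succ i =>
    rw [singleNullMap, nullMap_succ, Pi.single_eq_of_ne h₁, Pi.single_eq_of_ne (by omega),
      comp_zero, zero_comp, add_zero]

lemma nonempty_homotopy_zero (h : ∀ i, X.X (i + 1) ⟶ Y.X i) :
    Nonempty (Homotopy (nullMap h) 0) := by
  have r : ∀ i, (ComplexShape.up ℕ).Rel i (i + 1) := fun _ => rfl
  refine ⟨(Homotopy.ofEq ?_).trans (Homotopy.nullHomotopy'
    (fun i j (hij : (ComplexShape.up ℕ).Rel j i) =>
      eqToHom (congrArg X.X (show i = j + 1 from Eq.symm hij)) ≫ h j))⟩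
  ext i
  cases i with
  | zero =>
    rw [Homotopy.nullHomotopicMap'_f_of_not_rel_right (r 0) (by simp)]
    simp [nullMap_zero]
  | succ i =>
    rw [Homotopy.nullHomotopicMap'_f (r i) (r (i + 1))]
    simp [nullMap_succ, add_comm]

lemma exists_sub_eq_nullMap {f g : X ⟶ Y} (H : Homotopy f g) :
    ∃ h : ∀ i, X.X (i + 1) ⟶ Y.X i, f - g = nullMap h := by
  refine ⟨fun i => H.hom (i + 1) i, eq_nullMap ?_ fun i => ?_⟩
  · have := H.comm 0
    rw [dNext_eq _ (show (ComplexShape.up ℕ).Rel 0 1 from rfl), prevD_eq_zero _ _ (by simp)] at this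
    simp [this]
  · have := H.comm (i + 1)
    rw [dNext_eq _ (show (ComplexShape.up ℕ).Rel (i + 1) (i + 2) from rfl),
      prevD_eq _ (show (ComplexShape.up ℕ).Rel i (i + 1) from rfl)] at this
    simp [this, add_comm]

lemma nonempty_homotopy {f g : X ⟶ Y} {h : ∀ i, X.X (i + 1) ⟶ Y.X i} (hfg : f - g = nullMap h) :
    Nonempty (Homotopy f g) := by
  obtain ⟨H⟩ := nonempty_homotopy_zero h
  exact ⟨Homotopy.equivSubZero.symm ((Homotopy.ofEq hfg).trans H)⟩

/-- The homotopy is built upwards: the defect of `f` in degree `i + 1` is killed by the incoming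
differential of `X`, so it extends over the outgoing one. -/
lemma IsNCokernel.exists_nullMap (hX : IsNCokernel n X) (f : X ⟶ Y) (h₀ : X.X 1 ⟶ Y.X 0)
    (hf : f.f 0 = X.d 0 1 ≫ h₀) :
    ∃ h : ∀ i, X.X (i + 1) ⟶ Y.X i, h 0 = h₀ ∧ f = nullMap h := by
  obtain ⟨h, e, hh⟩ := exists_seq (T := fun i => X.X (i + 1) ⟶ Y.X i)
    (fun i t => X.d i (i + 1) ≫ (f.f (i + 1) - t ≫ Y.d i (i + 1)) = 0)
    (fun i t t' => f.f (i + 1) = t ≫ Y.d i (i + 1) + X.d (i + 1) (i + 2) ≫ t') h₀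
    (by rw [Preadditive.comp_sub, ← f.comm, hf, Category.assoc, sub_self])
    (fun i t ht => by
      obtain ⟨t', ht'⟩ := hX.exists_desc i _ ht
      refine ⟨t', by rw [ht']; abel, ?_⟩
      rw [Preadditive.comp_sub, ← f.comm, ← Category.assoc, ht']
      simp)
  exact ⟨h, e, eq_nullMap (by rw [hf, e]) hh⟩

/-- Dually, the homotopy is built downwards by lifting along the differentials of `Y`. The recursion
leaves the equation in degree `0` only after composition with `d_Y⁰`, which is mono. -/
lemma IsNKernel.exists_nullMap (hY : IsNKernel n Y) (f : X ⟶ Y) (h₀ : X.X (n + 1) ⟶ Y.X n)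
    (hf : f.f (n + 1) = h₀ ≫ Y.d n (n + 1)) :
    ∃ h : ∀ i, X.X (i + 1) ⟶ Y.X i, h n = h₀ ∧ f = nullMap h := by
  have := hY.mono
  obtain ⟨h, e, hz, hh, hh'⟩ := exists_seq_desc (T := fun i => X.X (i + 1) ⟶ Y.X i)
    (fun i t => (f.f i - X.d i (i + 1) ≫ t) ≫ Y.d i (i + 1) = 0)
    (fun i t' t => f.f (i + 1) = t' ≫ Y.d i (i + 1) + X.d (i + 1) (i + 2) ≫ t) n h₀
    (by rw [Preadditive.sub_comp, f.comm, hf, Category.assoc, sub_self])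
    (fun i hi t ht => by
      obtain ⟨t', ht'⟩ := hY.exact _ i hi _ ht
      refine ⟨t', by rw [ht']; abel, ?_⟩
      rw [Preadditive.sub_comp, f.comm, Category.assoc, ht']
      simp)
  refine ⟨h, e, eq_nullMap ?_ fun i => ?_⟩
  · rw [← sub_eq_zero, ← cancel_mono (Y.d 0 1), hz, zero_comp]
  · rcases lt_trichotomy i n with hi | rfl | hi
    · exact hh i hi
    · rw [hf, e, hh' (i + 1) (by omega), comp_zero, add_zero]
    · exact (hY.isNComplex _ (by omega)).eq_of_tgt _ _

lemma IsNCokernel.exists_hom (hX : IsNCokernel n X) (f₀ : X.X 0 ⟶ Y.X 0) (f₁ : X.X 1 ⟶ Y.X 1)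
    (h : f₀ ≫ Y.d 0 1 = X.d 0 1 ≫ f₁) : ∃ f : X ⟶ Y, f.f 0 = f₀ ∧ f.f 1 = f₁ := by
  obtain ⟨t, e, ht⟩ := exists_seq (T := fun i => X.X (i + 1) ⟶ Y.X (i + 1))
    (fun i t => X.d i (i + 1) ≫ t ≫ Y.d (i + 1) (i + 2) = 0)
    (fun i t t' => t ≫ Y.d (i + 1) (i + 2) = X.d (i + 1) (i + 2) ≫ t') f₁
    (by rw [← Category.assoc, ← h]; simp)
    (fun i t ht => by
      obtain ⟨t', ht'⟩ := hX.exists_desc i _ ht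
      refine ⟨t', ht'.symm, ?_⟩
      rw [← Category.assoc, ht']
      simp)
  refine ⟨CochainComplex.ofHom
    (fun i => match i with
      | 0 => f₀
      | i + 1 => t i)
    (fun i => ?_), rfl, e⟩
  cases i with
  | zero => exact h.trans (by rw [← e]; rfl)
  | succ i => exact ht i

lemma IsNKernel.exists_hom (hY : IsNKernel n Y) (f₀ : X.X n ⟶ Y.X n)
    (f₁ : X.X (n + 1) ⟶ Y.X (n + 1)) (h : f₀ ≫ Y.d n (n + 1) = X.d n (n + 1) ≫ f₁) :
    ∃ f : X ⟶ Y, f.f n = f₀ ∧ f.f (n + 1) = f₁ := by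
  obtain ⟨t, e, -, ht, -⟩ := exists_seq_desc (T := fun i => X.X i ⟶ Y.X i)
    (fun i t => ∀ j, X.d j i ≫ t ≫ Y.d i (i + 1) = 0)
    (fun i t' t => t' ≫ Y.d i (i + 1) = X.d i (i + 1) ≫ t) n f₀
    (fun j => by rw [h]; simp)
    (fun i hi t ht => by
      obtain ⟨t', ht'⟩ := hY.exact _ i hi (X.d i (i + 1) ≫ t) (by simpa using ht i)
      refine ⟨t', ht', fun j => ?_⟩
      rw [ht']
      simp)
  refine ⟨CochainComplex.ofHom (Function.update t (n + 1) f₁) (fun i => ?_), ?_, by simp⟩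
  · rcases lt_trichotomy i n with hi | rfl | hi
    · rw [Function.update_of_ne (by omega), Function.update_of_ne (by omega)]
      exact ht i hi
    · rw [Function.update_of_ne (by omega), Function.update_self, e]
      exact h
    · exact (hY.isNComplex _ (by omega)).eq_of_tgt _ _
  · simp [Function.update_of_ne, e]

/-- `Y` is a retract of `X` up to homotopy: move a cocycle to `X`, solve there, move the solution
back and correct it by the homotopy. -/
lemma IsNCokernel.of_nullMap (hX : IsNCokernel n X) (hY : IsNComplex n Y) (f : X ⟶ Y) (g : Y ⟶ X)
    {h : ∀ i, Y.X (i + 1) ⟶ Y.X i} (hfg : 𝟙 Y - g ≫ f = nullMap h) : IsNCokernel n Y := by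
  have key : ∀ (T : 𝒞) (i : ℕ) (φ : Y.X (i + 1) ⟶ T), Y.d i (i + 1) ≫ φ = 0 →
      ∃ ψ : Y.X (i + 2) ⟶ T, Y.d (i + 1) (i + 2) ≫ ψ = φ := by
    intro T i φ hφ
    obtain ⟨ψ, hψ⟩ := hX.exists_desc i (f.f (i + 1) ≫ φ) (by
      rw [← Category.assoc, ← f.comm, Category.assoc, hφ, comp_zero])
    refine ⟨g.f (i + 2) ≫ ψ + h (i + 1) ≫ φ, ?_⟩
    have e := congrArg (fun k : Y ⟶ Y => k.f (i + 1) ≫ φ) hfg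
    simp only [nullMap_succ, HomologicalComplex.sub_f_apply, HomologicalComplex.id_f,
      HomologicalComplex.comp_f, Preadditive.sub_comp, Preadditive.add_comp, Category.assoc,
      Category.id_comp, hφ, comp_zero, zero_add] at e
    rw [Preadditive.comp_add, ← e, ← Category.assoc, ← g.comm, Category.assoc, hψ]
    abel
  refine ⟨hY, ⟨fun a b hab => ?_⟩, fun T i _ φ hφ => key T i φ hφ⟩
  rw [← sub_eq_zero, ← Preadditive.comp_sub] at hab
  obtain ⟨ψ, hψ⟩ := key _ n _ hab
  rw [← sub_eq_zero, ← hψ, (hY (n + 2) (by omega)).eq_of_src ψ 0, comp_zero]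

lemma IsNKernel.of_nullMap (hX : IsNKernel n X) (hY : IsNComplex n Y) (f : X ⟶ Y) (g : Y ⟶ X)
    {h : ∀ i, Y.X (i + 1) ⟶ Y.X i} (hfg : 𝟙 Y - g ≫ f = nullMap h) : IsNKernel n Y := by
  have := hX.mono
  refine ⟨hY, ⟨fun a b hab => ?_⟩, fun T i hi φ hφ => ?_⟩
  · rw [← sub_eq_zero, ← Preadditive.sub_comp] at hab
    have e := congrArg (fun k : Y ⟶ Y => (a - b) ≫ k.f 0) hfg
    have e' : (a - b) ≫ g.f 0 = 0 := by
      rw [← cancel_mono (X.d 0 1), Category.assoc, g.comm, ← Category.assoc, hab]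
      simp
    simp only [nullMap_zero, HomologicalComplex.sub_f_apply, HomologicalComplex.id_f,
      HomologicalComplex.comp_f, Preadditive.comp_sub, Category.comp_id] at e
    rw [← sub_eq_zero]
    simpa only [reassoc_of% hab, reassoc_of% e', zero_comp, sub_zero,
      ← Category.assoc, ← Preadditive.comp_sub, hab, e'] using e
  · obtain ⟨ψ, hψ⟩ := hX.exact T i hi (φ ≫ g.f (i + 1)) (by
      rw [Category.assoc, g.comm, ← Category.assoc, hφ, zero_comp])
    refine ⟨ψ ≫ f.f i + φ ≫ h i, ?_⟩
    have e := congrArg (fun k : Y ⟶ Y => φ ≫ k.f (i + 1)) hfg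
    simp only [nullMap_succ, HomologicalComplex.sub_f_apply, HomologicalComplex.id_f,
      HomologicalComplex.comp_f, Preadditive.comp_sub, Preadditive.comp_add,
      Category.comp_id, reassoc_of% hφ, zero_comp, add_zero] at e
    rw [Preadditive.add_comp, Category.assoc, Category.assoc, ← e, f.comm, reassoc_of% hψ]
    abel

end

end Homotopies

/-! ### Exactness of cones and cocones in terms of components -/

section TotalComplexes

variable {𝒞 : Type u} [Category.{v} 𝒞] [Preadditive 𝒞] {n : ℕ}

/-- A decomposition of `Z` as `P⁰ ⟶ P¹ ⊕ Q⁰ ⟶ P² ⊕ Q¹ ⟶ ⋯`, with the differentials `[a; g]`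
and `[[a, 0], [g, b]]`. -/
structure TotalData (Z : CochainComplex 𝒞 ℕ) (P Q : ℕ → 𝒞) (a : ∀ i, P i ⟶ P (i + 1))
    (g : ∀ i, P i ⟶ Q i) (b : ∀ i, Q i ⟶ Q (i + 1)) where
  inl : ∀ i, P i ⟶ Z.X i
  fst : ∀ i, Z.X i ⟶ P i
  inr : ∀ i, Q i ⟶ Z.X (i + 1)
  snd : ∀ i, Z.X (i + 1) ⟶ Q i
  inl_fst : ∀ i, inl i ≫ fst i = 𝟙 _
  inr_snd : ∀ i, inr i ≫ snd i = 𝟙 _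
  inl_snd : ∀ i, inl (i + 1) ≫ snd i = 0
  inr_fst : ∀ i, inr i ≫ fst (i + 1) = 0
  total_zero : fst 0 ≫ inl 0 = 𝟙 _
  total : ∀ i, fst (i + 1) ≫ inl (i + 1) + snd i ≫ inr i = 𝟙 _
  inl_d : ∀ i, inl i ≫ Z.d i (i + 1) = a i ≫ inl (i + 1) + g i ≫ inr i
  inr_d : ∀ i, inr i ≫ Z.d (i + 1) (i + 2) = b i ≫ inr (i + 1)

namespace TotalData

variable {Z : CochainComplex 𝒞 ℕ} {P Q : ℕ → 𝒞} {a : ∀ i, P i ⟶ P (i + 1)} {g : ∀ i, P i ⟶ Q i}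
  {b : ∀ i, Q i ⟶ Q (i + 1)} (t : TotalData Z P Q a g b)

include t

lemma hom_ext {T : 𝒞} {i : ℕ} {u v : T ⟶ Z.X (i + 1)} (h₁ : u ≫ t.fst (i + 1) = v ≫ t.fst (i + 1))
    (h₂ : u ≫ t.snd i = v ≫ t.snd i) : u = v := by
  rw [← Category.comp_id u, ← Category.comp_id v, ← t.total, Preadditive.comp_add,
    Preadditive.comp_add, reassoc_of% h₁, reassoc_of% h₂]

lemma hom_ext' {T : 𝒞} {i : ℕ} {u v : Z.X (i + 1) ⟶ T} (h₁ : t.inl (i + 1) ≫ u = t.inl (i + 1) ≫ v)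
    (h₂ : t.inr i ≫ u = t.inr i ≫ v) : u = v := by
  rw [← Category.id_comp u, ← Category.id_comp v, ← t.total, Preadditive.add_comp,
    Preadditive.add_comp, Category.assoc, Category.assoc, Category.assoc, Category.assoc, h₁, h₂]

lemma d_fst (i : ℕ) : Z.d i (i + 1) ≫ t.fst (i + 1) = t.fst i ≫ a i := by
  cases i with
  | zero =>
    rw [← Category.id_comp (Z.d 0 (0 + 1)), ← t.total_zero, Category.assoc, Category.assoc,
      reassoc_of% t.inl_d 0, Preadditive.add_comp, Category.assoc, Category.assoc, t.inl_fst,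
      t.inr_fst, comp_zero, add_zero, Category.comp_id]
  | succ i =>
    apply t.hom_ext'
    · rw [reassoc_of% t.inl_d (i + 1), Preadditive.add_comp, Category.assoc, Category.assoc,
        t.inl_fst, t.inr_fst, reassoc_of% t.inl_fst (i + 1), comp_zero, add_zero, Category.comp_id]
    · rw [reassoc_of% t.inr_d i, t.inr_fst, reassoc_of% t.inr_fst i, zero_comp, comp_zero]

lemma d_snd_zero : Z.d 0 1 ≫ t.snd 0 = t.fst 0 ≫ g 0 := by
  rw [← Category.id_comp (Z.d 0 1), ← t.total_zero, Category.assoc, Category.assoc,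
      reassoc_of% t.inl_d 0, Preadditive.add_comp, Category.assoc, Category.assoc, t.inl_snd,
      t.inr_snd, comp_zero, zero_add, Category.comp_id]

lemma d_snd_succ (i : ℕ) :
    Z.d (i + 1) (i + 2) ≫ t.snd (i + 1) = t.fst (i + 1) ≫ g (i + 1) + t.snd i ≫ b i := by
  apply t.hom_ext'
  · rw [reassoc_of% t.inl_d (i + 1), Preadditive.add_comp, Category.assoc, Category.assoc,
        t.inl_snd, t.inr_snd, Preadditive.comp_add, reassoc_of% t.inl_fst (i + 1),
        reassoc_of% t.inl_snd i, comp_zero, zero_comp, zero_add, add_zero, Category.comp_id]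
  · rw [reassoc_of% t.inr_d i, t.inr_snd, Preadditive.comp_add, reassoc_of% t.inr_fst i,
      reassoc_of% t.inr_snd i, zero_comp, zero_add, Category.comp_id]

lemma isNComplex (hP : ∀ i, n + 1 < i → IsZero (P i)) (hQ : ∀ i, n < i → IsZero (Q i)) : IsNComplex n Z := by
  intro i hi
  obtain ⟨j, rfl⟩ : ∃ j, i = j + 1 := ⟨i - 1, by omega⟩
  rw [IsZero.iff_id_eq_zero]
  exact t.hom_ext ((hP _ hi).eq_of_tgt _ _) ((hQ j (by omega)).eq_of_tgt _ _)

lemma isNKernel (hP : IsNComplex n Z)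
    (h₀ : ∀ (T : 𝒞) (x : T ⟶ P 0), x ≫ a 0 = 0 → x ≫ g 0 = 0 → x = 0)
    (h₁ : 0 < n → ∀ (T : 𝒞) (x : T ⟶ P 1) (y : T ⟶ Q 0), x ≫ a 1 = 0 →
      x ≫ g 1 + y ≫ b 0 = 0 → ∃ x', x' ≫ a 0 = x ∧ x' ≫ g 0 = y)
    (h₂ : ∀ j, j + 1 < n → ∀ (T : 𝒞) (x : T ⟶ P (j + 2)) (y : T ⟶ Q (j + 1)),
      x ≫ a (j + 2) = 0 → x ≫ g (j + 2) + y ≫ b (j + 1) = 0 →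
        ∃ x' y', x' ≫ a (j + 1) = x ∧ x' ≫ g (j + 1) + y' ≫ b j = y) :
    IsNKernel n Z := by
  refine ⟨hP, ⟨fun {T} u v huv => ?_⟩, fun T i hi u hu => ?_⟩
  · rw [← sub_eq_zero, ← Preadditive.sub_comp] at huv
    have e : (u - v) ≫ t.fst 0 = 0 := h₀ T _
      (by rw [Category.assoc, ← t.d_fst, reassoc_of% huv, zero_comp])
      (by rw [Category.assoc, ← t.d_snd_zero, reassoc_of% huv, zero_comp])
    rw [← sub_eq_zero, ← Category.comp_id (u - v), ← t.total_zero, reassoc_of% e, zero_comp]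
  · have e₁ : (u ≫ t.fst (i + 1)) ≫ a (i + 1) = 0 := by
      rw [Category.assoc, ← t.d_fst, reassoc_of% hu, zero_comp]
    have e₂ : (u ≫ t.fst (i + 1)) ≫ g (i + 1) + (u ≫ t.snd i) ≫ b i = 0 := by
      rw [Category.assoc, Category.assoc, ← Preadditive.comp_add, ← t.d_snd_succ, reassoc_of% hu,
        zero_comp]
    cases i with
    | zero =>
      obtain ⟨x', h, h'⟩ := h₁ hi T _ _ e₁ e₂
      refine ⟨x' ≫ t.inl 0, t.hom_ext ?_ ?_⟩
      · rw [Category.assoc, t.d_fst, Category.assoc, reassoc_of% t.inl_fst 0, h]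
      · rw [Category.assoc, t.d_snd_zero, Category.assoc, reassoc_of% t.inl_fst 0, h']
    | succ j =>
      obtain ⟨x', y', h, h'⟩ := h₂ j hi T _ _ e₁ e₂
      refine ⟨x' ≫ t.inl (j + 1) + y' ≫ t.inr j, t.hom_ext ?_ ?_⟩
      · rw [Category.assoc, t.d_fst, Preadditive.add_comp, Category.assoc, Category.assoc,
          reassoc_of% t.inl_fst (j + 1), reassoc_of% t.inr_fst j, h, zero_comp, comp_zero, add_zero]
      · rw [Category.assoc, t.d_snd_succ, Preadditive.add_comp, Preadditive.comp_add,
          Preadditive.comp_add, Category.assoc, Category.assoc, Category.assoc, Category.assoc,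
          reassoc_of% t.inl_fst (j + 1), reassoc_of% t.inr_fst j, reassoc_of% t.inl_snd j,
          reassoc_of% t.inr_snd j, ← h']
        simp

lemma isNCokernel (hP : IsNComplex n Z) (hn : 1 ≤ n)
    (h₀ : ∀ (m : ℕ), n = m + 1 → ∀ (T : 𝒞) (α : P (m + 2) ⟶ T) (β : Q (m + 1) ⟶ T),
      a (m + 1) ≫ α + g (m + 1) ≫ β = 0 → b m ≫ β = 0 → α = 0 ∧ β = 0)
    (h₁ : ∀ (T : 𝒞) (α : P 1 ⟶ T) (β : Q 0 ⟶ T), a 0 ≫ α + g 0 ≫ β = 0 →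
      ∃ γ δ, a 1 ≫ γ + g 1 ≫ δ = α ∧ b 0 ≫ δ = β)
    (h₂ : ∀ j, j + 1 < n → ∀ (T : 𝒞) (α : P (j + 2) ⟶ T) (β : Q (j + 1) ⟶ T),
      a (j + 1) ≫ α + g (j + 1) ≫ β = 0 → b j ≫ β = 0 →
        ∃ γ δ, a (j + 2) ≫ γ + g (j + 2) ≫ δ = α ∧ b (j + 1) ≫ δ = β) :
    IsNCokernel n Z := by
  have k₁ : ∀ (T : 𝒞) (i : ℕ) (u : Z.X (i + 1) ⟶ T), Z.d i (i + 1) ≫ u = 0 →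
      a i ≫ t.inl (i + 1) ≫ u + g i ≫ t.inr i ≫ u = 0 := fun T i u hu => by
    rw [← Category.assoc, ← Category.assoc, ← Preadditive.add_comp, ← t.inl_d, Category.assoc, hu,
      comp_zero]
  have k₂ : ∀ (T : 𝒞) (i : ℕ) (u : Z.X (i + 2) ⟶ T), Z.d (i + 1) (i + 2) ≫ u = 0 →
      b i ≫ t.inr (i + 1) ≫ u = 0 := fun T i u hu => by
    rw [← Category.assoc, ← t.inr_d, Category.assoc, hu, comp_zero]
  have k₃ : ∀ (T : 𝒞) (i : ℕ) (u : Z.X (i + 1) ⟶ T) (γ : P (i + 2) ⟶ T) (δ : Q (i + 1) ⟶ T),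
      a (i + 1) ≫ γ + g (i + 1) ≫ δ = t.inl (i + 1) ≫ u → b i ≫ δ = t.inr i ≫ u →
      ∃ v, Z.d (i + 1) (i + 2) ≫ v = u := fun T i u γ δ h h' => by
    refine ⟨t.fst (i + 2) ≫ γ + t.snd (i + 1) ≫ δ, ?_⟩
    rw [Preadditive.comp_add, reassoc_of% t.d_fst (i + 1), reassoc_of% t.d_snd_succ i,
      Preadditive.add_comp, Category.assoc, Category.assoc, h', ← add_assoc,
      ← Preadditive.comp_add, h, ← Category.assoc, ← Category.assoc, ← Preadditive.add_comp,
      t.total, Category.id_comp]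
  refine ⟨hP, ⟨fun {T} u v huv => ?_⟩, fun T i hi u hu => ?_⟩
  · rw [← sub_eq_zero, ← Preadditive.comp_sub] at huv
    obtain ⟨m, rfl⟩ : ∃ m, n = m + 1 := ⟨n - 1, by omega⟩
    obtain ⟨e₁, e₂⟩ := h₀ m rfl T _ _ (k₁ _ _ _ huv) (k₂ _ _ _ huv)
    rw [← sub_eq_zero]
    exact t.hom_ext' (e₁.trans comp_zero.symm) (e₂.trans comp_zero.symm)
  · cases i with
    | zero =>
      obtain ⟨γ, δ, h, h'⟩ := h₁ T _ _ (k₁ _ _ _ hu)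
      exact k₃ T 0 u γ δ h h'
    | succ j =>
      obtain ⟨γ, δ, h, h'⟩ := h₂ j hi T _ _ (k₁ _ _ _ hu) (k₂ _ _ _ hu)
      exact k₃ T _ u γ δ h h'

lemma eq_zero_of_isNKernel (hk : IsNKernel n Z) {T : 𝒞} (x : T ⟶ P 0) (h₁ : x ≫ a 0 = 0)
    (h₂ : x ≫ g 0 = 0) : x = 0 := by
  have := hk.mono
  have e : x ≫ t.inl 0 = 0 := by
    rw [← cancel_mono (Z.d 0 1), Category.assoc, t.inl_d, Preadditive.comp_add, reassoc_of% h₁,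
      reassoc_of% h₂]
    simp
  rw [← Category.comp_id x, ← t.inl_fst, reassoc_of% e, zero_comp]

/-- The second component is recorded only for `i = 0`, where the preceding term is `P⁰` alone and
both components of a cocycle come from the same `x'`. -/
lemma exists_of_isNKernel (hk : IsNKernel n Z) {T : 𝒞} {i : ℕ} (hi : i < n) (x : T ⟶ P (i + 1))
    (y : T ⟶ Q i) (h₁ : x ≫ a (i + 1) = 0) (h₂ : x ≫ g (i + 1) + y ≫ b i = 0) :
    ∃ x', x' ≫ a i = x ∧ (i = 0 → x' ≫ g i = y) := by
  obtain ⟨u, hu⟩ := hk.exact T i hi (x ≫ t.inl (i + 1) + y ≫ t.inr i) (by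
    rw [Preadditive.add_comp, Category.assoc, Category.assoc, t.inl_d, t.inr_d,
      Preadditive.comp_add, reassoc_of% h₁, zero_comp, zero_add, ← Category.assoc, ← Category.assoc,
      ← Preadditive.add_comp, h₂, zero_comp])
  refine ⟨u ≫ t.fst i, ?_, ?_⟩
  · rw [Category.assoc, ← t.d_fst, reassoc_of% hu, Preadditive.add_comp, Category.assoc,
      Category.assoc, t.inl_fst, t.inr_fst]
    simp
  · rintro rfl
    rw [Category.assoc, ← t.d_snd_zero, reassoc_of% hu, Preadditive.add_comp, Category.assoc,
      Category.assoc, t.inl_snd, t.inr_snd]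
    simp

lemma eq_zero_of_isNCokernel {m : ℕ} (hk : IsNCokernel (m + 1) Z) {T : 𝒞} (α : P (m + 2) ⟶ T)
    (β : Q (m + 1) ⟶ T) (h₁ : a (m + 1) ≫ α + g (m + 1) ≫ β = 0) (h₂ : b m ≫ β = 0) :
    β = 0 := by
  have := hk.epi
  have e : t.fst (m + 2) ≫ α + t.snd (m + 1) ≫ β = 0 := by
    rw [← cancel_epi (Z.d (m + 1) (m + 2)), Preadditive.comp_add, reassoc_of% t.d_fst (m + 1),
      reassoc_of% t.d_snd_succ m, Preadditive.add_comp, Category.assoc, Category.assoc, h₂,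
      comp_zero, add_zero, ← Preadditive.comp_add, h₁, comp_zero, comp_zero]
  have e' := congrArg (t.inr (m + 1) ≫ ·) e
  simpa only [Preadditive.comp_add, reassoc_of% t.inr_fst (m + 1), reassoc_of% t.inr_snd (m + 1),
    zero_comp, zero_add, comp_zero] using e'

/-- The condition `h₂` ranges over `j` with `j + 1 = i`, so that it is empty in degree `0`, where
there is no incoming `Q`-term. -/
lemma exists_of_isNCokernel (hk : IsNCokernel n Z) {T : 𝒞} {i : ℕ} (hi : i < n)
    (α : P (i + 1) ⟶ T) (β : Q i ⟶ T) (h₁ : a i ≫ α + g i ≫ β = 0)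
    (h₂ : ∀ j (hj : j + 1 = i), b j ≫ eqToHom (congrArg Q hj) ≫ β = 0) :
    ∃ γ δ, a (i + 1) ≫ γ + g (i + 1) ≫ δ = α ∧ b i ≫ δ = β := by
  obtain ⟨u, hu⟩ := hk.exact T i hi (t.fst (i + 1) ≫ α + t.snd i ≫ β) (by
    rw [Preadditive.comp_add, reassoc_of% t.d_fst i]
    cases i with
    | zero => rw [reassoc_of% t.d_snd_zero, ← Preadditive.comp_add, h₁, comp_zero]
    | succ j =>
      have := h₂ j rfl
      rw [eqToHom_refl, Category.id_comp] at this
      rw [reassoc_of% t.d_snd_succ j, Preadditive.add_comp, Category.assoc, Category.assoc, this,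
        comp_zero, add_zero, ← Preadditive.comp_add, h₁, comp_zero])
  refine ⟨t.inl (i + 2) ≫ u, t.inr (i + 1) ≫ u, ?_, ?_⟩
  · rw [← Category.assoc, ← Category.assoc, ← Preadditive.add_comp, ← t.inl_d, Category.assoc, hu,
      Preadditive.comp_add, reassoc_of% t.inl_fst (i + 1), reassoc_of% t.inl_snd i, zero_comp,
      add_zero]
  · rw [← Category.assoc, ← t.inr_d, Category.assoc, hu, Preadditive.comp_add,
      reassoc_of% t.inr_fst i, reassoc_of% t.inr_snd i, zero_comp, zero_add]

end TotalData

variable [HasBinaryBiproducts 𝒞]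

/-- The differentials `[a; g]` and `[[a, 0], [g, b]]`. -/
noncomputable def totalD {P Q : CochainComplex 𝒞 ℕ} (a : ∀ i, P.X i ⟶ P.X (i + 1))
    (g : ∀ i, P.X i ⟶ Q.X i) (b : ∀ i, Q.X i ⟶ Q.X (i + 1)) :
    ∀ i, totalObj P Q i ⟶ totalObj P Q (i + 1)
  | 0 => biprod.lift (a 0) (g 0)
  | k + 1 => biprod.lift (biprod.fst ≫ a (k + 1)) (biprod.fst ≫ g (k + 1) + biprod.snd ≫ b k)

lemma inl_comp_matrix {A₁ A₂ B₁ B₂ : 𝒞} (a : A₁ ⟶ B₁) (g : A₁ ⟶ B₂) (b : A₂ ⟶ B₂) :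
    (biprod.inl : A₁ ⟶ A₁ ⊞ A₂) ≫ biprod.lift (biprod.fst ≫ a) (biprod.fst ≫ g + biprod.snd ≫ b) =
      a ≫ biprod.inl + g ≫ biprod.inr := by
  apply biprod.hom_ext <;> simp

lemma inr_comp_matrix {A₁ A₂ B₁ B₂ : 𝒞} (a : A₁ ⟶ B₁) (g : A₁ ⟶ B₂) (b : A₂ ⟶ B₂) :
    (biprod.inr : A₂ ⟶ A₁ ⊞ A₂) ≫ biprod.lift (biprod.fst ≫ a) (biprod.fst ≫ g + biprod.snd ≫ b) =
      b ≫ biprod.inr := by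
  apply biprod.hom_ext <;> simp

/-- The decomposition of a complex with the objects `P⁰, P¹ ⊕ Q⁰, P² ⊕ Q¹, …`. -/
noncomputable def totalData {P Q : CochainComplex 𝒞 ℕ} {a : ∀ i, P.X i ⟶ P.X (i + 1)}
    {g : ∀ i, P.X i ⟶ Q.X i} {b : ∀ i, Q.X i ⟶ Q.X (i + 1)}
    {D : ∀ i, totalObj P Q i ⟶ totalObj P Q (i + 1)} (h : ∀ i, D i ≫ D (i + 1) = 0)
    (hD : D = totalD a g b) : TotalData (CochainComplex.of (totalObj P Q) D h) P.X Q.X a g b where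
  inl i := match i with
    | 0 => 𝟙 (P.X 0)
    | k + 1 => (biprod.inl : P.X (k + 1) ⟶ P.X (k + 1) ⊞ Q.X k)
  fst i := match i with
    | 0 => 𝟙 (P.X 0)
    | k + 1 => (biprod.fst : P.X (k + 1) ⊞ Q.X k ⟶ P.X (k + 1))
  inr k := (biprod.inr : Q.X k ⟶ P.X (k + 1) ⊞ Q.X k)
  snd k := (biprod.snd : P.X (k + 1) ⊞ Q.X k ⟶ Q.X k)
  inl_fst i := match i with
    | 0 => Category.comp_id (𝟙 (P.X 0))
    | k + 1 => (biprod.inl_fst : (biprod.inl : P.X (k + 1) ⟶ P.X (k + 1) ⊞ Q.X k) ≫ _ = _)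
  inr_snd k := (biprod.inr_snd : (biprod.inr : Q.X k ⟶ P.X (k + 1) ⊞ Q.X k) ≫ _ = _)
  inl_snd k := (biprod.inl_snd : (biprod.inl : P.X (k + 1) ⟶ P.X (k + 1) ⊞ Q.X k) ≫ _ = _)
  inr_fst k := (biprod.inr_fst : (biprod.inr : Q.X k ⟶ P.X (k + 1) ⊞ Q.X k) ≫ _ = _)
  total_zero := Category.comp_id (𝟙 (P.X 0))
  total k := (biprod.total : _ = 𝟙 (P.X (k + 1) ⊞ Q.X k))
  inl_d i := by
    subst hD
    have e : (CochainComplex.of (totalObj P Q) (totalD a g b) h).d i (i + 1) = totalD a g b i :=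
      CochainComplex.of_d _ _ i
    rw [e]
    cases i with
    | zero =>
      refine (Category.id_comp (totalD a g b 0)).trans ?_
      exact (biprod.lift_eq : (biprod.lift (a 0) (g 0)) = _)
    | succ k => exact inl_comp_matrix _ _ _
  inr_d k := by
    subst hD
    have e : (CochainComplex.of (totalObj P Q) (totalD a g b) h).d (k + 1) (k + 2) =
      totalD a g b (k + 1) := CochainComplex.of_d _ _ (k + 1)
    rw [e]
    exact inr_comp_matrix _ _ _

/-- The decomposition of the complex `cone g`. -/
noncomputable def coneData {P Q : CochainComplex 𝒞 ℕ} (g : P ⟶ Q) :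
    TotalData (cone g) P.X Q.X (fun i => -P.d i (i + 1)) g.f (fun i => Q.d i (i + 1)) :=
  totalData (coneD_comp g) (by funext i; cases i <;> rfl)

/-- The decomposition of the complex `cocone g`. -/
noncomputable def coconeData {P Q : CochainComplex 𝒞 ℕ} (g : P ⟶ Q) :
    TotalData (cocone g) P.X Q.X (fun i => P.d i (i + 1)) g.f (fun i => -Q.d i (i + 1)) :=
  totalData (coconeD_comp g) (by funext i; cases i <;> rfl)

/-- The decomposition of the mapping cone. -/
noncomputable def mappingConeData {X Y : CochainComplex 𝒞 ℕ} (f : X ⟶ Y) :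
    TotalData (mappingCone f) (fun i => X.X (i + 1)) (fun i => Y.X (i + 1))
      (fun i => -X.d (i + 1) (i + 2)) (fun i => f.f (i + 1)) (fun i => Y.d (i + 1) (i + 2)) :=
  coneData (CochainComplex.truncate.map f)

/-- The decomposition of the mapping cocone. -/
noncomputable def mappingCoconeData [HasZeroObject 𝒞] {X Y : CochainComplex 𝒞 ℕ} (f : X ⟶ Y) :
    TotalData (mappingCocone n f) (upTo n X).X (upTo n Y).X
      (fun i => (upTo n X).d i (i + 1)) (upToMap n f).f (fun i => -(upTo n Y).d i (i + 1)) :=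
  coconeData (upToMap n f)

end TotalComplexes

/-! ### From `n`-pullback diagrams to sequences in `𝒳` -/

section NExactCategories

variable {𝒞 : Type u} [Category.{v} 𝒞] [Preadditive 𝒞] {n : ℕ}

/-- The upper row in (E2ᵒᵖ) starts in degree `1`; this supplies its missing left end. -/
lemma exists_augment (X : CochainComplex 𝒞 ℕ) {A : 𝒞} (j : A ⟶ X.X 1) (hj : j ≫ X.d 1 2 = 0) :
    ∃ (X' : CochainComplex 𝒞 ℕ) (e₀ : X'.X 0 ≅ A) (e : ∀ i, X'.X (i + 1) ≅ X.X (i + 1)),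
      X'.d 0 1 ≫ (e 0).hom = e₀.hom ≫ j ∧
      ∀ i, X'.d (i + 1) (i + 2) ≫ (e (i + 1)).hom = (e i).hom ≫ X.d (i + 1) (i + 2) :=
  ⟨CochainComplex.augment (CochainComplex.truncate.obj X) j hj, Iso.refl A,
    fun i => Iso.refl (X.X (i + 1)), (Category.comp_id j).trans (Category.id_comp j).symm,
    fun i => (Category.comp_id (X.d (i + 1) (i + 2))).trans (Category.id_comp _).symm⟩

section

variable [HasZeroObject 𝒞] [HasBinaryBiproducts 𝒞] {𝒳 : CochainComplex 𝒞 ℕ → Prop}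
  (h𝒳 : IsNExactCategory n 𝒳)

include h𝒳

/-- The last differential determines an `n`-kernel sequence up to homotopy. So `X` is a homotopy
retract of `Z`, hence `n`-exact, and closure under morphisms with two consecutive invertible
components applies. -/
lemma IsNExactCategory.mem_of_isNKernel {X Z : CochainComplex 𝒞 ℕ} (hX : IsNKernel n X)
    (hZ : 𝒳 Z) (u : X.X n ≅ Z.X n) (v : X.X (n + 1) ≅ Z.X (n + 1))
    (h : u.hom ≫ Z.d n (n + 1) = X.d n (n + 1) ≫ v.hom) : 𝒳 X := by
  obtain ⟨f, hf, hf'⟩ := (h𝒳.isNExact Z hZ).1.exists_hom u.hom v.hom h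
  obtain ⟨g, hg, hg'⟩ := hX.exists_hom u.inv v.inv (by
    rw [← cancel_epi u.hom, u.hom_inv_id_assoc, reassoc_of% h, v.hom_inv_id, Category.comp_id])
  obtain ⟨k, -, hk⟩ := hX.exists_nullMap (𝟙 X - f ≫ g) 0 (by simp [hf', hg'])
  refine (h𝒳.closed_consecutive X Z f ⟨hX, (h𝒳.isNExact Z hZ).2.of_nullMap hX.isNComplex g f hk⟩
    (h𝒳.isNExact Z hZ) n le_rfl ?_ ?_).mpr hZ
  · rw [hf]; infer_instance
  · rw [hf']; infer_instance

lemma IsNExactCategory.mem_of_isNCokernel {X Z : CochainComplex 𝒞 ℕ} (hX : IsNCokernel n X)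
    (hZ : 𝒳 Z) (u : X.X 0 ≅ Z.X 0) (v : X.X 1 ≅ Z.X 1)
    (h : u.hom ≫ Z.d 0 1 = X.d 0 1 ≫ v.hom) : 𝒳 X := by
  obtain ⟨f, hf, hf'⟩ := hX.exists_hom u.hom v.hom h
  obtain ⟨g, hg, hg'⟩ := (h𝒳.isNExact Z hZ).2.exists_hom u.inv v.inv (by
    rw [← cancel_epi u.hom, u.hom_inv_id_assoc, reassoc_of% h, v.hom_inv_id, Category.comp_id])
  obtain ⟨k, -, hk⟩ := hX.exists_nullMap (𝟙 X - f ≫ g) 0 (by simp [hf, hg])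
  refine (h𝒳.closed_consecutive X Z f ⟨(h𝒳.isNExact Z hZ).1.of_nullMap hX.isNComplex g f hk, hX⟩
    (h𝒳.isNExact Z hZ) 0 (Nat.zero_le n) ?_ ?_).mpr hZ
  · rw [hf]; infer_instance
  · rw [hf']; infer_instance

/-- The row from (E2ᵒᵖ) is completed by `Y⁰`, whose differential lifts `d_Y⁰` through the pullback.
Exactness of the cone and of `Y` makes it an `n`-kernel sequence, and its admissible last
differential puts it in `𝒳`. -/
theorem IsNExactCategory.exists_pullback (hn : 1 ≤ n) {Y : CochainComplex 𝒞 ℕ} (hY : 𝒳 Y) {D : 𝒞}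
    (c : D ⟶ Y.X (n + 1)) : ∃ (X : CochainComplex 𝒞 ℕ) (q : X ⟶ Y) (e : X.X (n + 1) ≅ D),
      𝒳 X ∧ IsIso (q.f 0) ∧ q.f (n + 1) = e.hom ≫ c := by
  obtain ⟨X, hX, hX0, hXD, f, hf, hp, Z, hZ, hZ₀, hZ₁, hd⟩ := h𝒳.pullback Y hY c
  obtain ⟨m, rfl⟩ : ∃ m, n = m + 1 := ⟨n - 1, by omega⟩
  have hYk := (h𝒳.isNExact Y hY).1
  have := hYk.mono
  have t := mappingConeData f
  -- The pair `(0, d_Y⁰)` is a cocycle in `X² ⊕ Y¹`; its lift to `X¹` is the new differential.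
  obtain ⟨j, hj, hj'⟩ := t.exists_of_isNKernel hp (Nat.succ_pos m) (0 : Y.X 0 ⟶ X.X 2) (Y.d 0 1)
    (by simp) (by simp)
  have hj' : j ≫ f.f 1 = Y.d 0 1 := hj' rfl
  have hj : j ≫ X.d 1 2 = 0 := by simpa using hj
  obtain ⟨X', e₀, e, he₀, he⟩ := exists_augment X j hj
  have hX'k : IsNKernel (m + 1) X' := by
    refine ⟨fun i hi => ?_, ⟨fun {T} u v huv => ?_⟩, fun T i hi g hg => ?_⟩
    · obtain ⟨k, rfl⟩ : ∃ k, i = k + 1 := ⟨i - 1, by omega⟩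
      exact (hX (k + 1) hi).of_iso (e k)
    · rw [← cancel_mono e₀.hom, ← cancel_mono (Y.d 0 1), ← hj', Category.assoc, Category.assoc,
        ← reassoc_of% he₀, reassoc_of% huv]
    · have hg₁ : (g ≫ (e i).hom) ≫ X.d (i + 1) (i + 2) = 0 := by
        rw [Category.assoc, ← he, reassoc_of% hg, zero_comp]
      obtain ⟨h, hh⟩ : ∃ h : T ⟶ Y.X i, h ≫ Y.d i (i + 1) = (g ≫ (e i).hom) ≫ f.f (i + 1) :=
        hYk.exact T i hi _ (by rw [Category.assoc, f.comm, ← Category.assoc, hg₁, zero_comp])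
      cases i with
      | zero =>
        refine ⟨h ≫ e₀.inv, ?_⟩
        rw [← cancel_mono (e 0).hom, Category.assoc, Category.assoc, he₀, e₀.inv_hom_id_assoc,
          ← sub_eq_zero]
        -- The difference between `g` and its candidate `h ≫ j` is killed by `d_X¹` and `f¹`, hence
        -- by the first differential of the cone, which is mono.
        refine t.eq_zero_of_isNKernel hp _ ?_ ?_
        · rw [Preadditive.comp_neg, Preadditive.sub_comp, Category.assoc, hj, hg₁]
          simp
        · rw [Preadditive.sub_comp, Category.assoc, hj', hh, sub_self]
      | succ k =>
        -- The pair `(g, -h)` is a cocycle in the cone; the sign in the cone differential reappears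
        -- in the witness `-x`.
        obtain ⟨x, hx, -⟩ := t.exists_of_isNKernel hp (Nat.lt_of_succ_lt hi)
          (g ≫ (e (k + 1)).hom) (-h) (by rw [Preadditive.comp_neg, hg₁, neg_zero])
          (by rw [Preadditive.neg_comp, hh, add_neg_cancel])
        refine ⟨-x ≫ (e k).inv, ?_⟩
        rw [← cancel_mono (e (k + 1)).hom, Category.assoc, he, Preadditive.neg_comp, Category.assoc,
          (e k).inv_hom_id_assoc, ← hx, Preadditive.comp_neg]
  refine ⟨X', CochainComplex.ofHom (fun i => match i with
    | 0 => e₀.hom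
    | i + 1 => (e i).hom ≫ f.f (i + 1)) (fun i => ?_), e (m + 1) ≪≫ eqToIso hXD, ?_, ?_, ?_⟩
  · cases i with
    | zero => exact (by rw [reassoc_of% he₀, hj'] :
        e₀.hom ≫ Y.d 0 1 = X'.d 0 1 ≫ (e 0).hom ≫ f.f 1)
    | succ i => exact (by rw [Category.assoc, f.comm, reassoc_of% he i] :
        ((e i).hom ≫ f.f (i + 1)) ≫ Y.d (i + 1) (i + 2) =
          X'.d (i + 1) (i + 2) ≫ (e (i + 1)).hom ≫ f.f (i + 2))
  · refine h𝒳.mem_of_isNKernel hX'k hZ (e m ≪≫ eqToIso hZ₀.symm)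
      (e (m + 1) ≪≫ eqToIso hZ₁.symm) ?_
    simp [reassoc_of% he m, hd]
  · exact (inferInstance : IsIso e₀.hom)
  · exact (by simp [hf] : (e (m + 1)).hom ≫ f.f (m + 2) =
      (e (m + 1) ≪≫ eqToIso hXD).hom ≫ c)

end

end NExactCategories

/-! ### Truncated rows and the completion of `n`-pushout diagrams -/

section Truncations

variable {𝒞 : Type u} [Category.{v} 𝒞] [Preadditive 𝒞] {n : ℕ}

/-- Extends a morphism into a truncated row to the completed row: `φ` transports the components up
to `n`, and `t` is the new last one. -/
lemma exists_hom_of_isIso {X Y P : CochainComplex 𝒞 ℕ} (φ : Y ⟶ P)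
    (hφ : ∀ i, i ≤ n → IsIso (φ.f i)) (hY : IsNComplex n Y) (f : X ⟶ P)
    (t : X.X (n + 1) ⟶ Y.X (n + 1))
    (ht : ∀ s : X.X n ⟶ Y.X n, s ≫ φ.f n = f.f n → s ≫ Y.d n (n + 1) = X.d n (n + 1) ≫ t) :
    ∃ q : X ⟶ Y, (∀ i, i ≤ n → q.f i ≫ φ.f i = f.f i) ∧ q.f (n + 1) = t := by
  have : ∀ i, ∃ s : X.X i ⟶ Y.X i, i ≤ n → s ≫ φ.f i = f.f i := fun i => by
    by_cases hi : i ≤ n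
    · have := hφ i hi
      exact ⟨f.f i ≫ inv (φ.f i), fun _ => by simp⟩
    · exact ⟨0, fun h => absurd h hi⟩
  choose s hs using this
  have hs' : ∀ i, i ≠ n + 1 → Function.update s (n + 1) t i = s i :=
    fun i hi => Function.update_of_ne hi _ _
  refine ⟨CochainComplex.ofHom (Function.update s (n + 1) t) fun i => ?_, fun i hi => ?_, by simp⟩
  · rcases lt_trichotomy i n with hi | rfl | hi
    · have := hφ (i + 1) (by omega)
      rw [hs' _ (by omega), hs' _ (by omega), ← cancel_mono (φ.f (i + 1)), Category.assoc,
        Category.assoc, hs _ (by omega), ← φ.comm, ← Category.assoc, hs _ (by omega), f.comm]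
    · rw [hs' _ (by omega), Function.update_self]
      exact ht _ (hs _ le_rfl)
    · exact (hY _ (by omega)).eq_of_tgt _ _
  · change Function.update s (n + 1) t i ≫ _ = _
    rw [hs' _ (by omega), hs i hi]

variable [HasZeroObject 𝒞]

open scoped ZeroObject

/-- The identity of `Xⁱ` for `i ≤ n`, and zero for `i > n`. -/
noncomputable def toUpToObj (n : ℕ) (X : CochainComplex 𝒞 ℕ) (i : ℕ) : X.X i ⟶ upToObj n X i :=
  if h : i ≤ n then eqToHom (upToObj_eq n X h).symm else 0

lemma toUpToObj_comp (n : ℕ) {X Y : CochainComplex 𝒞 ℕ} {i j : ℕ} (f : X.X i ⟶ Y.X j)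
    (hij : i ≤ j) : toUpToObj n X i ≫ upToHom n f = f ≫ toUpToObj n Y j := by
  unfold toUpToObj upToHom
  by_cases hi : i ≤ n <;> by_cases hj : j ≤ n
  all_goals first | omega | simp [hi, hj]

/-- The projection of `X` to its part in degrees `0, …, n`. -/
noncomputable def upToProj (n : ℕ) (X : CochainComplex 𝒞 ℕ) : X ⟶ upTo n X where
  f i := toUpToObj n X i
  comm' i j hij := by
    obtain rfl : i + 1 = j := hij
    exact toUpToObj_comp n (X.d i (i + 1)) (Nat.le_succ i)

lemma upToProj_f (X : CochainComplex 𝒞 ℕ) {i : ℕ} (hi : i ≤ n) :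
    (upToProj n X).f i = (eqToHom (upToObj_eq n X hi).symm : X.X i ⟶ upToObj n X i) :=
  dif_pos hi

lemma isIso_upToProj_f (X : CochainComplex 𝒞 ℕ) {i : ℕ} (hi : i ≤ n) :
    IsIso ((upToProj n X).f i) := by
  rw [upToProj_f X hi]
  exact (inferInstance : IsIso (eqToHom (upToObj_eq n X hi).symm))

lemma isZero_upTo_X (X : CochainComplex 𝒞 ℕ) {i : ℕ} (hi : n < i) : IsZero ((upTo n X).X i) := by
  have : (upTo n X).X i = (0 : 𝒞) := if_neg (by omega)
  rw [this]
  exact isZero_zero 𝒞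

lemma upToProj_naturality_f {X Y : CochainComplex 𝒞 ℕ} (f : X ⟶ Y) (i : ℕ) :
    (upToProj n X).f i ≫ (upToMap n f).f i = f.f i ≫ (upToProj n Y).f i :=
  toUpToObj_comp n (f.f i) le_rfl

lemma exists_comp_upToProj (X : CochainComplex 𝒞 ℕ) {i : ℕ} (hi : i ≤ n) {T : 𝒞}
    (x : T ⟶ (upTo n X).X i) : ∃ x', x' ≫ (upToProj n X).f i = x := by
  have := isIso_upToProj_f X hi
  exact ⟨x ≫ inv ((upToProj n X).f i), by simp⟩

lemma exists_upToProj_comp (X : CochainComplex 𝒞 ℕ) {i : ℕ} (hi : i ≤ n) {T : 𝒞}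
    (α : X.X i ⟶ T) : ∃ α', (upToProj n X).f i ≫ α' = α := by
  have := isIso_upToProj_f X hi
  exact ⟨inv ((upToProj n X).f i) ≫ α, by simp⟩

variable [HasBinaryBiproducts 𝒞]

/-- In general `α` is recovered only up to a map factoring through the next differential of `X`. At
`i + 1 = n` the next `X`-term is absent from the cocone, so there the equation is exact. -/
lemma IsNPushout.exists_desc {X Y : CochainComplex 𝒞 ℕ} {f : X ⟶ Y} (hf : IsNPushout n f) {T : 𝒞}
    {i : ℕ} (hi : i < n) (α : X.X (i + 1) ⟶ T) (β : Y.X i ⟶ T)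
    (h₁ : X.d i (i + 1) ≫ α + f.f i ≫ β = 0) (h₂ : ∀ j, Y.d j i ≫ β = 0) :
    ∃ δ : Y.X (i + 1) ⟶ T, Y.d i (i + 1) ≫ δ = -β ∧ (i + 1 = n → f.f (i + 1) ≫ δ = α) := by
  have t := mappingCoconeData (n := n) f
  have e₀ := isIso_upToProj_f X hi.le
  have e₁ := isIso_upToProj_f X (Nat.succ_le_of_lt hi)
  have e₂ := isIso_upToProj_f Y hi.le
  obtain ⟨γ, δ, h, h'⟩ := t.exists_of_isNCokernel hf hi (inv ((upToProj n X).f (i + 1)) ≫ α)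
    (inv ((upToProj n Y).f i) ≫ β) (by
      rw [← cancel_epi ((upToProj n X).f i), Preadditive.comp_add, ← Category.assoc,
        (upToProj n X).comm, ← Category.assoc ((upToProj n X).f i), upToProj_naturality_f]
      simpa using h₁) (fun j hj => by
        subst hj
        have e₃ := isIso_upToProj_f Y (show j ≤ n by omega)
        rw [← cancel_epi ((upToProj n Y).f j), eqToHom_refl, Category.id_comp, Preadditive.neg_comp,
          Preadditive.comp_neg, ← Category.assoc, (upToProj n Y).comm]
        simp [h₂])
  refine ⟨(upToProj n Y).f (i + 1) ≫ δ, ?_, fun hin => ?_⟩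
  · rw [← Category.assoc, ← (upToProj n Y).comm, Category.assoc]
    have := congrArg ((upToProj n Y).f i ≫ ·) h'
    simp only [Preadditive.neg_comp, Preadditive.comp_neg, IsIso.hom_inv_id_assoc] at this
    rw [← this, neg_neg]
  · have hγ : γ = 0 := (isZero_upTo_X X (show n < i + 2 by omega)).eq_of_src _ _
    rw [hγ, comp_zero, zero_add] at h
    rw [← Category.assoc, ← upToProj_naturality_f, Category.assoc, h, IsIso.hom_inv_id_assoc]

lemma IsNPushout.eq_zero {X Y : CochainComplex 𝒞 ℕ} {f : X ⟶ Y} (hf : IsNPushout n f) (hn : 1 ≤ n)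
    {T : 𝒞} (β : Y.X n ⟶ T) (h₁ : f.f n ≫ β = 0) (h₂ : ∀ j, Y.d j n ≫ β = 0) : β = 0 := by
  obtain ⟨m, rfl⟩ : ∃ m, n = m + 1 := ⟨n - 1, by omega⟩
  have t := mappingCoconeData (n := m + 1) f
  have e₀ := isIso_upToProj_f X (le_refl (m + 1))
  have e₁ := isIso_upToProj_f Y (le_refl (m + 1))
  have e₂ := isIso_upToProj_f Y (Nat.le_succ m)
  rw [← cancel_epi (inv ((upToProj (m + 1) Y).f (m + 1))), comp_zero]
  refine t.eq_zero_of_isNCokernel hf 0 _ ?_ ?_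
  · rw [comp_zero, zero_add, ← cancel_epi ((upToProj (m + 1) X).f (m + 1)), ← Category.assoc,
      upToProj_naturality_f]
    simp [h₁]
  · rw [← cancel_epi ((upToProj (m + 1) Y).f m), Preadditive.neg_comp, Preadditive.comp_neg,
      ← Category.assoc, (upToProj (m + 1) Y).comm]
    simp [h₂]

/-- The completed complex is the cocone of `g`, seen as a morphism from `Y` to `C` placed in degree
`n`; the shift in the cocone moves `C` to degree `n + 1`. -/
lemma exists_extend (hn : 1 ≤ n) (Y : CochainComplex 𝒞 ℕ) (hY : ∀ i, n < i → IsZero (Y.X i))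
    {C : 𝒞} (g : Y.X n ⟶ C) (hg : ∀ j, Y.d j n ≫ g = 0) :
    ∃ (Y' : CochainComplex 𝒞 ℕ) (φ : Y' ⟶ Y) (ψ : Y'.X (n + 1) ≅ C), IsNComplex n Y' ∧
      (∀ i, i ≤ n → IsIso (φ.f i)) ∧ Y'.d n (n + 1) ≫ ψ.hom = φ.f n ≫ g := by
  let S := (HomologicalComplex.single 𝒞 (ComplexShape.up ℕ) n).obj C
  have hS : ∀ i, i ≠ n → IsZero (S.X i) := fun i hi =>
    HomologicalComplex.isZero_single_obj_X (ComplexShape.up ℕ) n C i hi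
  let G : Y ⟶ S := HomologicalComplex.mkHomToSingle g fun i _ => hg i
  have hG : G.f n = g ≫ (HomologicalComplex.singleObjXSelf (ComplexShape.up ℕ) n C).inv :=
    HomologicalComplex.mkHomToSingle_f _ _
  have t := coconeData G
  refine ⟨cocone G, CochainComplex.ofHom t.fst fun i => (t.d_fst i).symm,
    ⟨t.snd n, t.inr n, t.hom_ext ((hY _ (by omega)).eq_of_tgt _ _) ?_, t.inr_snd n⟩ ≪≫
      HomologicalComplex.singleObjXSelf (ComplexShape.up ℕ) n C,
    t.isNComplex (fun i hi => hY i (by omega)) fun i hi => hS i (by omega), fun i hi => ?_, ?_⟩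
  · rw [Category.assoc, t.inr_snd, Category.comp_id, Category.id_comp]
  · change IsIso (t.fst i)
    refine ⟨t.inl i, ?_, t.inl_fst i⟩
    cases i with
    | zero => exact t.total_zero
    | succ i => rw [← t.total, (hS i (by omega)).eq_of_tgt (t.snd i) 0, zero_comp, add_zero]
  · obtain ⟨m, rfl⟩ : ∃ m, n = m + 1 := ⟨n - 1, by omega⟩
    have e := t.d_snd_succ m
    rw [(hS m (by omega)).eq_of_tgt (t.snd m) 0, zero_comp, add_zero, hG] at e
    rw [Iso.trans_hom, reassoc_of% e, Iso.inv_hom_id, Category.comp_id]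

/-- The row from (E2) is completed on the right by `Xⁿ⁺¹`, through the map induced by `d_Xⁿ`. Its
cokernel property is read off from the cocone and from `X`; its admissible first differential puts
it in `𝒳`. -/
theorem IsNExactCategory.exists_pushout {𝒳 : CochainComplex 𝒞 ℕ → Prop}
    (h𝒳 : IsNExactCategory n 𝒳) (hn : 1 ≤ n) {X : CochainComplex 𝒞 ℕ} (hX : 𝒳 X) {B : 𝒞}
    (a : X.X 0 ⟶ B) : ∃ (Y : CochainComplex 𝒞 ℕ) (q : X ⟶ Y) (e : Y.X 0 ≅ B),
      𝒳 Y ∧ IsIso (q.f (n + 1)) ∧ q.f 0 ≫ e.hom = a := by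
  obtain ⟨Y, hY, hYB, f, hf, hp, Z, hZ, hZ₀, hZ₁, hd⟩ := h𝒳.pushout X hX a
  have hXc := (h𝒳.isNExact X hX).2
  have := hXc.epi
  obtain ⟨g, hg, hfg⟩ : ∃ g : Y.X n ⟶ X.X (n + 1), (∀ j, Y.d j n ≫ g = 0) ∧
      f.f n ≫ g = X.d n (n + 1) := by
    obtain ⟨m, rfl⟩ : ∃ m, n = m + 1 := ⟨n - 1, by omega⟩
    obtain ⟨g, hg, hg'⟩ := hp.exists_desc (Nat.lt_succ_self m) (X.d (m + 1) (m + 2)) 0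
      (by simp) (by simp)
    refine ⟨g, fun j => ?_, hg' rfl⟩
    by_cases hj : j = m
    · subst hj
      simpa using hg
    · rw [Y.shape _ _ (by simpa using hj), zero_comp]
  obtain ⟨Y', φ, ψ, hY', hφ, hψ⟩ := exists_extend hn Y hY g hg
  have hφ₀ := hφ 0 (Nat.zero_le n)
  have hφ₁ := hφ 1 hn
  have hφn := hφ n le_rfl
  obtain ⟨q, hq, hq'⟩ := exists_hom_of_isIso φ hφ hY' f ψ.inv (fun s hs => by
    rw [← cancel_mono ψ.hom, Category.assoc, hψ, reassoc_of% hs, hfg]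
    simp)
  have hY'c : IsNCokernel n Y' := by
    refine ⟨hY', ?_, fun T i hi α hα => ?_⟩
    · have : Epi (q.f n ≫ Y'.d n (n + 1)) := by
        rw [q.comm, hq']
        infer_instance
      exact epi_of_epi (q.f n) _
    · have hφi := hφ i hi.le
      have hφi' := hφ (i + 1) hi
      set β := inv (φ.f (i + 1)) ≫ α with hβ
      have hβα : φ.f (i + 1) ≫ β = α := by simp [hβ]
      have hYβ : ∀ j, Y.d j (i + 1) ≫ β = 0 := fun j => by
        by_cases hj : j = i
        · subst hj
          rw [← cancel_epi (φ.f j), ← Category.assoc, φ.comm, Category.assoc, hβα, hα, comp_zero]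
        · rw [Y.shape _ _ (by simpa using hj), zero_comp]
      obtain ⟨a', ha'⟩ := hXc.exact T i hi (f.f (i + 1) ≫ β) (by
        rw [← Category.assoc, ← f.comm, Category.assoc, hYβ, comp_zero])
      rcases Nat.lt_or_ge (i + 1) n with hin | hin
      · obtain ⟨δ, hδ, -⟩ := hp.exists_desc hin (-a') β
          (by rw [Preadditive.comp_neg, ha', neg_add_cancel]) hYβ
        refine ⟨φ.f (i + 2) ≫ (-δ), ?_⟩
        rw [← Category.assoc, ← φ.comm, Category.assoc, Preadditive.comp_neg, hδ, neg_neg, hβα]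
      · obtain rfl : n = i + 1 := by omega
        -- At the top degree the uniqueness part of the `n`-pushout applies: `β - g ≫ a'` vanishes
        -- on both `Xⁿ` and `Yⁿ⁻¹`.
        have hβ' : β - g ≫ a' = 0 := hp.eq_zero hn _
          (by rw [Preadditive.comp_sub, reassoc_of% hfg, ha', sub_self])
          (fun j => by rw [Preadditive.comp_sub, hYβ, reassoc_of% hg j, zero_comp, sub_zero])
        refine ⟨ψ.hom ≫ a', ?_⟩
        rw [reassoc_of% hψ, ← sub_eq_zero.mp hβ', hβα]
  refine ⟨Y', q, asIso (φ.f 0) ≪≫ eqToIso hYB, ?_, ?_, ?_⟩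
  · refine h𝒳.mem_of_isNCokernel hY'c hZ (asIso (φ.f 0) ≪≫ eqToIso hZ₀.symm)
      (asIso (φ.f 1) ≪≫ eqToIso hZ₁.symm) ?_
    have := φ.comm 0 1
    rw [hd] at this
    simp [← reassoc_of% this]
  · rw [hq']
    infer_instance
  · rw [Iso.trans_hom, asIso_hom, reassoc_of% hq 0 (Nat.zero_le n), hf]
    simp

end Truncations

/-! ### Universal properties and mapping cones -/

section NExactCategories

variable {𝒞 : Type u} [Category.{v} 𝒞] [Preadditive 𝒞] {n : ℕ} [HasZeroObject 𝒞]
  [HasBinaryBiproducts 𝒞] {𝒳 : CochainComplex 𝒞 ℕ → Prop}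

namespace IsNExactCategory

variable (h𝒳 : IsNExactCategory n 𝒳) (hn : 1 ≤ n) {X Y Z : CochainComplex 𝒞 ℕ}

include h𝒳 hn

lemma exists_desc_of_isIso (hX : 𝒳 X) (hY : 𝒳 Y) (f : X ⟶ Y) [IsIso (f.f (n + 1))] {T : 𝒞}
    (φ : Y.X 0 ⟶ T) (u : X.X 1 ⟶ T) (h : X.d 0 1 ≫ u = f.f 0 ≫ φ) :
    ∃ v : Y.X 1 ⟶ T, Y.d 0 1 ≫ v = φ := by
  obtain ⟨W, q, e, hW, hq, hφ⟩ := h𝒳.exists_pushout hn hY φ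
  have hXc := (h𝒳.isNExact X hX).2
  -- In degree `0` the composite to the pushout factors through `d_X⁰` by means of `u`.
  obtain ⟨k, -, hk⟩ := hXc.exists_nullMap (f ≫ q) (u ≫ e.inv)
    (by rw [reassoc_of% h, ← hφ]; simp)
  have hk' := congrArg (fun r => r.f (n + 1)) hk
  simp only [nullMap_last hXc.isNComplex, HomologicalComplex.comp_f] at hk'
  -- The last component of `f ≫ q` is invertible and factors through `d_Wⁿ`, so the identity does
  -- too and `W` is contractible.
  obtain ⟨l, -, hl⟩ := (h𝒳.isNExact W hW).1.exists_nullMap (𝟙 W)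
    (inv (f.f (n + 1) ≫ q.f (n + 1)) ≫ k n)
    (by rw [Category.assoc, ← hk', IsIso.inv_hom_id]; rfl)
  have hl' := congrArg (fun r => r.f 0) hl
  simp only [nullMap_zero, HomologicalComplex.id_f] at hl'
  exact ⟨q.f 1 ≫ l 0 ≫ e.hom, by
    rw [← Category.assoc, ← q.comm, Category.assoc, ← reassoc_of% hl', hφ]⟩

/-- Dual contractibility argument: pull `X` back along `x` to `W`. Then `y` makes `W ⟶ X ⟶ Y`
null-homotopic, its invertible component in degree `0` makes `W` contractible, and a section of
`d_Wⁿ` gives the lift. -/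
lemma exists_lift_of_isIso (hX : 𝒳 X) (hY : 𝒳 Y) (f : X ⟶ Y) [IsIso (f.f 0)] {T : 𝒞}
    (x : T ⟶ X.X (n + 1)) (y : T ⟶ Y.X n) (h : y ≫ Y.d n (n + 1) = x ≫ f.f (n + 1)) :
    ∃ s : T ⟶ X.X n, s ≫ X.d n (n + 1) = x := by
  obtain ⟨W, q, e, hW, hq, hφ⟩ := h𝒳.exists_pullback hn hX x
  have hWc := (h𝒳.isNExact W hW).2
  obtain ⟨k, -, hk⟩ := (h𝒳.isNExact Y hY).1.exists_nullMap (q ≫ f) (e.hom ≫ y)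
    (by rw [HomologicalComplex.comp_f, hφ, Category.assoc, Category.assoc, h])
  have hk' := congrArg (fun r => r.f 0) hk
  simp only [nullMap_zero, HomologicalComplex.comp_f] at hk'
  obtain ⟨l, -, hl⟩ := hWc.exists_nullMap (𝟙 W) (k 0 ≫ inv (q.f 0 ≫ f.f 0))
    (by rw [← reassoc_of% hk', ← Category.assoc, IsIso.hom_inv_id]; rfl)
  have hl' := congrArg (fun r => r.f (n + 1)) hl
  simp only [nullMap_last hWc.isNComplex, HomologicalComplex.id_f] at hl'
  exact ⟨e.inv ≫ l n ≫ q.f n, by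
    rw [Category.assoc, Category.assoc, q.comm, ← reassoc_of% hl', hφ, e.inv_hom_id_assoc]⟩

/-- The universal property of pushouts of sequences in `𝒳`. -/
theorem exists_hom_of_pushout (hX : 𝒳 X) (hY : 𝒳 Y) (f : X ⟶ Y) [IsIso (f.f (n + 1))]
    (g : X ⟶ Z) (b : Y.X 0 ⟶ Z.X 0) (h : f.f 0 ≫ b = g.f 0) :
    ∃ p : Y ⟶ Z, p.f 0 = b ∧ f.f (n + 1) ≫ p.f (n + 1) = g.f (n + 1) := by
  obtain ⟨v, hv⟩ := h𝒳.exists_desc_of_isIso hn hX hY f (b ≫ Z.d 0 1) (g.f 1)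
    (by rw [← Category.assoc, h, g.comm])
  obtain ⟨p, hp, -⟩ := (h𝒳.isNExact Y hY).2.exists_hom b v hv.symm
  have hXc := (h𝒳.isNExact X hX).2
  obtain ⟨k, -, hk⟩ := hXc.exists_nullMap (f ≫ p - g) 0 (by simp [hp, h])
  have hk' := congrArg (fun r => r.f (n + 1)) hk
  simp only [nullMap_last hXc.isNComplex, HomologicalComplex.comp_f,
    HomologicalComplex.sub_f_apply] at hk'
  -- The correction lives in degrees `n` and `n + 1`, so it leaves degree `0` alone because `1 ≤ n`.
  refine ⟨p - singleNullMap n (inv (f.f (n + 1)) ≫ k n), ?_, ?_⟩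
  · rw [HomologicalComplex.sub_f_apply, singleNullMap_of_ne _ _ _ (by omega) (by omega), hp,
      sub_zero]
  · rw [HomologicalComplex.sub_f_apply, singleNullMap_succ, Category.assoc, ← hk']
    simp

/-- The universal property of pullbacks of sequences in `𝒳`. -/
theorem exists_hom_of_pullback (hX : 𝒳 X) (hY : 𝒳 Y) (f : X ⟶ Y) [IsIso (f.f 0)]
    (g : Z ⟶ Y) (c : Z.X (n + 1) ⟶ X.X (n + 1)) (h : c ≫ f.f (n + 1) = g.f (n + 1)) :
    ∃ p : Z ⟶ X, p.f (n + 1) = c ∧ p.f 0 ≫ f.f 0 = g.f 0 := by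
  obtain ⟨s, hs⟩ := h𝒳.exists_lift_of_isIso hn hX hY f (Z.d n (n + 1) ≫ c) (g.f n)
    (by rw [Category.assoc, h, g.comm])
  obtain ⟨p, -, hp⟩ := (h𝒳.isNExact X hX).1.exists_hom s c hs
  obtain ⟨k, -, hk⟩ := (h𝒳.isNExact Y hY).1.exists_nullMap (p ≫ f - g) 0 (by simp [hp, h])
  have hk' := congrArg (fun r => r.f 0) hk
  simp only [nullMap_zero, HomologicalComplex.comp_f, HomologicalComplex.sub_f_apply] at hk'
  -- The correction lives in degrees `0` and `1`, which again misses degree `n + 1`.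
  refine ⟨p - singleNullMap 0 (k 0 ≫ inv (f.f 0)), ?_, ?_⟩
  · rw [HomologicalComplex.sub_f_apply, singleNullMap_of_ne _ _ _ (by omega) (by omega), hp,
      sub_zero]
  · rw [HomologicalComplex.sub_f_apply, singleNullMap_self, ← Category.assoc, ← hk']
    simp

/-- The universal property compares the constructed pushout with `W` by a morphism with invertible
ends, and `𝒳` is closed under such comparisons. -/
lemma mem_of_pushout {W : CochainComplex 𝒞 ℕ} (hX : 𝒳 X) (hW : IsNExact n W) (f : X ⟶ W)
    [IsIso (f.f (n + 1))] : 𝒳 W := by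
  obtain ⟨Y, q, e, hY, hq, hf⟩ := h𝒳.exists_pushout hn hX (f.f 0)
  obtain ⟨p, hp, hp'⟩ := h𝒳.exists_hom_of_pushout hn hX hY q f e.hom hf
  refine (h𝒳.closed_ends Y W p (h𝒳.isNExact Y hY) hW ?_ ?_).mp hY
  · rw [hp]
    infer_instance
  · have : IsIso (q.f (n + 1) ≫ p.f (n + 1)) := by rwa [hp']
    exact IsIso.of_isIso_comp_left (q.f (n + 1)) _

lemma mem_of_pullback {W : CochainComplex 𝒞 ℕ} (hX : 𝒳 X) (hW : IsNExact n W) (f : W ⟶ X)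
    [IsIso (f.f 0)] : 𝒳 W := by
  obtain ⟨Y, q, e, hY, hq, hf⟩ := h𝒳.exists_pullback hn hX (f.f (n + 1))
  obtain ⟨p, hp, hp'⟩ := h𝒳.exists_hom_of_pullback hn hY hX q f e.inv (by rw [hf]; simp)
  refine (h𝒳.closed_ends W Y p hW (h𝒳.isNExact Y hY) ?_ ?_).mpr hY
  · have : IsIso (p.f 0 ≫ q.f 0) := by rwa [hp']
    exact IsIso.of_isIso_comp_right _ (q.f 0)
  · rw [hp]
    infer_instance

lemma isNKernel_mappingCone (hX : 𝒳 X) (hY : 𝒳 Y) (f : X ⟶ Y) [IsIso (f.f 0)] :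
    IsNKernel n (mappingCone f) := by
  have t := mappingConeData f
  have hXk := (h𝒳.isNExact X hX).1
  have hYk := (h𝒳.isNExact Y hY).1
  have := hYk.mono
  have key : ∀ i, i < n → ∀ (T : 𝒞) (x : T ⟶ X.X (i + 2)) (y : T ⟶ Y.X (i + 1)),
      x ≫ (-X.d (i + 2) (i + 3)) = 0 → x ≫ f.f (i + 2) + y ≫ Y.d (i + 1) (i + 2) = 0 →
      ∃ (x' : T ⟶ X.X (i + 1)) (z : T ⟶ Y.X i), x' ≫ X.d (i + 1) (i + 2) = x ∧
        z ≫ Y.d i (i + 1) = x' ≫ f.f (i + 1) + y := fun i hi T x y h₁ h₂ => by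
    obtain ⟨x', hx'⟩ : ∃ x' : T ⟶ X.X (i + 1), x' ≫ X.d (i + 1) (i + 2) = x := by
      rcases Nat.lt_or_ge (i + 1) n with hin | hin
      · exact hXk.exact T (i + 1) hin x (by simpa using h₁)
      · obtain rfl : n = i + 1 := by omega
        -- `X` need not be exact at `Xⁿ⁺¹`; the lift exists because `x ≫ fⁿ⁺¹` factors through
        -- `d_Yⁿ` by `-y`.
        exact h𝒳.exists_lift_of_isIso hn hX hY f x (-y) (by
          rw [Preadditive.neg_comp, eq_comm, ← add_eq_zero_iff_eq_neg, h₂])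
    obtain ⟨z, hz⟩ := hYk.exact T i hi (x' ≫ f.f (i + 1) + y) (by
      rw [Preadditive.add_comp, Category.assoc, f.comm, reassoc_of% hx', h₂])
    exact ⟨x', z, hx', hz⟩
  refine t.isNKernel (t.isNComplex (fun i hi => hXk.isNComplex _ (by omega))
    fun i hi => hYk.isNComplex _ (by omega)) (fun T x h₁ h₂ => ?_) (fun _ T x y h₁ h₂ => ?_)
    (fun j hj T x y h₁ h₂ => ?_)
  · obtain ⟨x', rfl⟩ := hXk.exact T 0 hn x (by simpa using h₁)
    have : x' = 0 := by
      rw [← cancel_mono (f.f 0), ← cancel_mono (Y.d 0 1), Category.assoc, f.comm, ← Category.assoc,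
        h₂]
      simp
    rw [this, zero_comp]
  · obtain ⟨x', z, rfl, hz⟩ := key 0 hn T x y h₁ h₂
    -- `Y⁰` is not a term of the cone, so `z` is transported to `X¹` through the inverse of `f⁰`.
    refine ⟨-x' + z ≫ inv (f.f 0) ≫ X.d 0 1, by simp, ?_⟩
    rw [Preadditive.add_comp, Category.assoc, Category.assoc]
    rw [← f.comm, IsIso.inv_hom_id_assoc, hz]
    simp
  · obtain ⟨x', z, rfl, hz⟩ := key (j + 1) hj T x y h₁ h₂
    exact ⟨-x', z, by simp, by rw [hz]; simp⟩

lemma isNCokernel_mappingCone (hX : 𝒳 X) (hY : 𝒳 Y) (f : X ⟶ Y) [IsIso (f.f 0)] :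
    IsNCokernel n (mappingCone f) := by
  have t := mappingConeData f
  have hXc := (h𝒳.isNExact X hX).2
  have hYc := (h𝒳.isNExact Y hY).2
  have := hYc.epi
  have key : ∀ i (T : 𝒞) (α : X.X (i + 2) ⟶ T) (β : Y.X (i + 1) ⟶ T),
      (-X.d (i + 1) (i + 2)) ≫ α + f.f (i + 1) ≫ β = 0 → Y.d i (i + 1) ≫ β = 0 →
      ∃ (γ : X.X (i + 3) ⟶ T) (δ : Y.X (i + 2) ⟶ T),
        (-X.d (i + 2) (i + 3)) ≫ γ + f.f (i + 2) ≫ δ = α ∧ Y.d (i + 1) (i + 2) ≫ δ = β :=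
      fun i T α β h₁ h₂ => by
    obtain ⟨δ, hδ⟩ := hYc.exists_desc i β h₂
    obtain ⟨γ, hγ⟩ := hXc.exists_desc (i + 1) (f.f (i + 2) ≫ δ - α) (by
      rw [Preadditive.comp_sub, ← Category.assoc, ← f.comm, Category.assoc, hδ, ← h₁,
        Preadditive.neg_comp]
      abel)
    exact ⟨γ, δ, by rw [Preadditive.neg_comp, hγ]; abel, hδ⟩
  refine t.isNCokernel (t.isNComplex (fun i hi => hXc.isNComplex _ (by omega))
    fun i hi => hYc.isNComplex _ (by omega)) hn (fun m hm T α β h₁ h₂ => ⟨?_, ?_⟩)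
    (fun T α β h₁ => ?_) (fun j hj T α β h₁ h₂ => ?_)
  · exact (hXc.isNComplex _ (by omega)).eq_of_src _ _
  · subst hm
    rw [← cancel_epi (Y.d (m + 1) (m + 2)), h₂, comp_zero]
  · refine key 0 T α β h₁ ?_
    -- The missing cocycle condition `d_Y⁰ ≫ β = 0` is checked after composing with the invertible
    -- `f⁰`.
    have h₁' : f.f 1 ≫ β = X.d 1 2 ≫ α := by
      rw [← sub_eq_zero, ← h₁, Preadditive.neg_comp]
      abel
    rw [← cancel_epi (f.f 0), ← Category.assoc, f.comm, Category.assoc, h₁']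
    simp
  · exact key (j + 1) T α β h₁ h₂

/-- The inclusions of the `Yⁱ` for `i ≥ 1`, together with `d_X⁰` after the inverse of `f⁰`, form a
morphism from `Y` to the cone. Its last component is invertible, so the cone is a pushout of `Y`. -/
theorem mappingCone_mem (hX : 𝒳 X) (hY : 𝒳 Y) (f : X ⟶ Y) [IsIso (f.f 0)] :
    𝒳 (mappingCone f) ∧ IsIso (fromConeLast n f) ∧ ∃ k : Y ⟶ mappingCone f,
      f.f 0 ≫ k.f 0 = X.d 0 1 ≫ toConeZero f ∧ k.f (n + 1) ≫ fromConeLast n f = 𝟙 _ := by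
  have hXk := (h𝒳.isNExact X hX).1
  let t := mappingConeData f
  have e₁ : (mappingConeData f).inl 0 = toConeZero f := rfl
  have e₂ : (mappingConeData f).snd n = fromConeLast n f := rfl
  have h₁ : t.inr n ≫ t.snd n = 𝟙 _ := t.inr_snd n
  have h₂ : t.snd n ≫ t.inr n = 𝟙 _ :=
    t.hom_ext ((hXk.isNComplex _ (by omega)).eq_of_tgt _ _) (by
      rw [Category.assoc, t.inr_snd, Category.comp_id, Category.id_comp])
  let k : Y ⟶ mappingCone f := CochainComplex.ofHom (fun i => match i with
    | 0 => inv (f.f 0) ≫ X.d 0 1 ≫ t.inl 0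
    | i + 1 => t.inr i) (fun i => by
      cases i with
      | zero =>
        refine (Category.assoc _ _ _).trans ?_
        rw [Category.assoc, t.inl_d, Preadditive.comp_add]
        simp only [Preadditive.neg_comp, Preadditive.comp_neg]
        rw [X.d_comp_d_assoc, ← f.comm_assoc]
        simp
      | succ i => exact t.inr_d i)
  have hk : IsIso (k.f (n + 1)) := ⟨t.snd n, h₁, h₂⟩
  refine ⟨h𝒳.mem_of_pushout hn hY ⟨h𝒳.isNKernel_mappingCone hn hX hY f,
    h𝒳.isNCokernel_mappingCone hn hX hY f⟩ k, ⟨t.inr n, h₂, h₁⟩, k, ?_, h₁⟩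
  exact IsIso.hom_inv_id_assoc (f.f 0) _

end IsNExactCategory

end NExactCategories

/-! ### Mapping cocones -/

section NExactCategories

variable {𝒞 : Type u} [Category.{v} 𝒞] [Preadditive 𝒞] {n : ℕ} [HasZeroObject 𝒞]
  [HasBinaryBiproducts 𝒞] {𝒳 : CochainComplex 𝒞 ℕ → Prop}

lemma isNComplex_mappingCocone {X Y : CochainComplex 𝒞 ℕ} (f : X ⟶ Y) :
    IsNComplex n (mappingCocone n f) :=
  (mappingCoconeData (n := n) f).isNComplex (fun _ hi => isZero_upTo_X _ (by omega))
    fun _ hi => isZero_upTo_X _ hi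

namespace IsNExactCategory

variable (h𝒳 : IsNExactCategory n 𝒳) (hn : 1 ≤ n) {X Y Z : CochainComplex 𝒞 ℕ}

include h𝒳 hn

lemma isNKernel_mappingCocone (hX : 𝒳 X) (hY : 𝒳 Y) (f : X ⟶ Y) [IsIso (f.f (n + 1))] :
    IsNKernel n (mappingCocone n f) := by
  have t := mappingCoconeData (n := n) f
  have hXk := (h𝒳.isNExact X hX).1
  have hYk := (h𝒳.isNExact Y hY).1
  have := hXk.mono
  have := hYk.mono
  have key : ∀ i, i < n → ∀ (T : 𝒞) (x : T ⟶ (upTo n X).X (i + 1)) (y : T ⟶ (upTo n Y).X i),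
      x ≫ (upTo n X).d (i + 1) (i + 2) = 0 →
      x ≫ (upToMap n f).f (i + 1) + y ≫ (-(upTo n Y).d i (i + 1)) = 0 →
      ∃ (x' : T ⟶ X.X i) (y' : T ⟶ Y.X i), x' ≫ X.d i (i + 1) ≫ (upToProj n X).f (i + 1) = x ∧
        y = y' ≫ (upToProj n Y).f i ∧ (x' ≫ f.f i - y') ≫ Y.d i (i + 1) = 0 :=
      fun i hi T x y h₁ h₂ => by
    obtain ⟨x, rfl⟩ := exists_comp_upToProj X hi x
    obtain ⟨y, rfl⟩ := exists_comp_upToProj Y hi.le y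
    have := isIso_upToProj_f Y hi
    have h₂' : x ≫ f.f (i + 1) = y ≫ Y.d i (i + 1) := by
      rw [← cancel_mono ((upToProj n Y).f (i + 1)), Category.assoc, Category.assoc,
        ← upToProj_naturality_f, ← (upToProj n Y).comm, ← sub_eq_zero, ← h₂, Preadditive.comp_neg,
        ← sub_eq_add_neg, Category.assoc, Category.assoc]
    have h₁' : x ≫ X.d (i + 1) (i + 2) = 0 := by
      rcases Nat.lt_or_ge (i + 1) n with hin | hin
      · have := isIso_upToProj_f X (show i + 2 ≤ n from hin)
        rw [← cancel_mono ((upToProj n X).f (i + 2)), Category.assoc, ← (upToProj n X).comm,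
          ← Category.assoc, h₁, zero_comp]
      · obtain rfl : n = i + 1 := by omega
        -- `Xⁿ⁺¹` is absent from the cocone; the cocycle condition there is recovered through the
        -- invertible `fⁿ⁺¹`.
        rw [← cancel_mono (f.f (i + 2)), Category.assoc, ← f.comm, reassoc_of% h₂']
        simp
    obtain ⟨x', rfl⟩ := hXk.exact T i hi x h₁'
    refine ⟨x', y, by simp, rfl, ?_⟩
    rw [Preadditive.sub_comp, Category.assoc, f.comm, ← h₂', Category.assoc, sub_self]
  refine t.isNKernel (isNComplex_mappingCocone f) (fun T x h₁ _ => ?_) (fun _ T x y h₁ h₂ => ?_)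
    (fun j hj T x y h₁ h₂ => ?_)
  · obtain ⟨x, rfl⟩ := exists_comp_upToProj X (Nat.zero_le n) x
    have := isIso_upToProj_f X hn
    have : x = 0 := by
      rw [← cancel_mono (X.d 0 1), ← cancel_mono ((upToProj n X).f 1), Category.assoc,
        ← (upToProj n X).comm, ← Category.assoc, h₁]
      simp
    rw [this, zero_comp]
  · obtain ⟨x', y, rfl, rfl, h⟩ := key 0 hn T x y h₁ h₂
    have h' : x' ≫ f.f 0 - y = 0 := by rw [← cancel_mono (Y.d 0 1), h, zero_comp]
    refine ⟨x' ≫ (upToProj n X).f 0, ?_, ?_⟩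
    · rw [Category.assoc, (upToProj n X).comm]
    · rw [Category.assoc, upToProj_naturality_f, ← sub_eq_zero.mp h', Category.assoc]
  · obtain ⟨x', y, rfl, rfl, h⟩ := key (j + 1) hj T x y h₁ h₂
    obtain ⟨z, hz⟩ := hYk.exact T j (Nat.lt_of_succ_lt hj) _ h
    refine ⟨x' ≫ (upToProj n X).f (j + 1), z ≫ (upToProj n Y).f j, ?_, ?_⟩
    · rw [Category.assoc, (upToProj n X).comm]
    · rw [Category.assoc, upToProj_naturality_f, Category.assoc, Preadditive.comp_neg,
        (upToProj n Y).comm, Preadditive.comp_neg, reassoc_of% hz, Preadditive.sub_comp,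
        Category.assoc]
      abel

lemma isNCokernel_mappingCocone (hX : 𝒳 X) (hY : 𝒳 Y) (f : X ⟶ Y) [IsIso (f.f (n + 1))] :
    IsNCokernel n (mappingCocone n f) := by
  have t := mappingCoconeData (n := n) f
  have hXc := (h𝒳.isNExact X hX).2
  have hYc := (h𝒳.isNExact Y hY).2
  have := hXc.epi
  have key : ∀ i, i < n → ∀ (T : 𝒞) (α : (upTo n X).X (i + 1) ⟶ T) (β : (upTo n Y).X i ⟶ T)
      (v : Y.X (i + 1) ⟶ T), Y.d i (i + 1) ≫ v = (upToProj n Y).f i ≫ β →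
      (upTo n X).d i (i + 1) ≫ α + (upToMap n f).f i ≫ β = 0 →
      ∃ (γ : (upTo n X).X (i + 2) ⟶ T) (δ : (upTo n Y).X (i + 1) ⟶ T),
        (upTo n X).d (i + 1) (i + 2) ≫ γ + (upToMap n f).f (i + 1) ≫ δ = α ∧
        (-(upTo n Y).d i (i + 1)) ≫ δ = β := fun i hi T α β v hv h => by
    have p₀ := isIso_upToProj_f Y hi.le
    have p₁ := isIso_upToProj_f X hi
    have h' : X.d i (i + 1) ≫ (upToProj n X).f (i + 1) ≫ α +
        f.f i ≫ (upToProj n Y).f i ≫ β = 0 := by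
      rw [← (upToProj n X).comm_assoc, ← Category.assoc (f.f i), ← upToProj_naturality_f,
        Category.assoc, ← Preadditive.comp_add, h, comp_zero]
    obtain ⟨γ, hγ⟩ := hXc.exists_desc i ((upToProj n X).f (i + 1) ≫ α + f.f (i + 1) ≫ v) (by
      rw [Preadditive.comp_add, ← Category.assoc _ (f.f (i + 1)), ← f.comm, Category.assoc, hv, h'])
    suffices ∃ (γ : (upTo n X).X (i + 2) ⟶ T) (δ : Y.X (i + 1) ⟶ T),
        X.d (i + 1) (i + 2) ≫ (upToProj n X).f (i + 2) ≫ γ + f.f (i + 1) ≫ δ =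
          (upToProj n X).f (i + 1) ≫ α ∧ -Y.d i (i + 1) ≫ δ = (upToProj n Y).f i ≫ β by
      obtain ⟨γ, δ, h₁, h₂⟩ := this
      obtain ⟨δ, rfl⟩ := exists_upToProj_comp Y hi δ
      refine ⟨γ, δ, ?_, ?_⟩
      · rw [← cancel_epi ((upToProj n X).f (i + 1)), ← h₁, Preadditive.comp_add,
          (upToProj n X).comm_assoc, ← Category.assoc _ _ δ, upToProj_naturality_f, Category.assoc]
      · rw [← cancel_epi ((upToProj n Y).f i), ← h₂, Preadditive.neg_comp, Preadditive.comp_neg,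
          (upToProj n Y).comm_assoc]
    rcases Nat.lt_or_ge (i + 1) n with hin | hin
    · obtain ⟨γ, rfl⟩ := exists_upToProj_comp X (show i + 2 ≤ n from hin) γ
      exact ⟨γ, -v, by rw [hγ, Preadditive.comp_neg]; abel, by rw [Preadditive.comp_neg, neg_neg, hv]⟩
    · obtain rfl : n = i + 1 := by omega
      -- `γ` starts at `Xⁿ⁺¹`, which the cocone omits, so it is absorbed into the `Y`-component
      -- through the inverse of `fⁿ⁺¹`.
      refine ⟨0, Y.d (i + 1) (i + 2) ≫ inv (f.f (i + 2)) ≫ γ - v, ?_, ?_⟩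
      · rw [comp_zero, comp_zero, zero_add, Preadditive.comp_sub, f.comm_assoc,
          IsIso.hom_inv_id_assoc, hγ]
        abel
      · rw [Preadditive.comp_sub, hv]
        simp
  refine t.isNCokernel (isNComplex_mappingCocone f) hn (fun m hm T α β h₁ h₂ => ?_)
    (fun T α β h₁ => ?_) (fun j hj T α β h₁ h₂ => ?_)
  · subst hm
    have hα : α = 0 := (isZero_upTo_X _ (by omega)).eq_of_src _ _
    have p := isIso_upToProj_f Y (le_refl (m + 1))
    refine ⟨hα, ?_⟩
    rw [hα, comp_zero, zero_add] at h₁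
    obtain ⟨ε, hε⟩ := hYc.exact T m (Nat.lt_succ_self m) ((upToProj (m + 1) Y).f (m + 1) ≫ β) (by
      rw [← (upToProj (m + 1) Y).comm_assoc, ← neg_eq_zero, ← Preadditive.comp_neg,
        ← Preadditive.neg_comp, h₂, comp_zero])
    have : ε = 0 := by
      rw [← cancel_epi (f.f (m + 2)), ← cancel_epi (X.d (m + 1) (m + 2)), ← f.comm_assoc, hε,
        ← Category.assoc, ← upToProj_naturality_f, Category.assoc, h₁]
      simp
    rw [← cancel_epi ((upToProj (m + 1) Y).f (m + 1)), ← hε, this, comp_zero, comp_zero]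
  · obtain ⟨v, hv⟩ := h𝒳.exists_desc_of_isIso hn hX hY f ((upToProj n Y).f 0 ≫ β)
      -- In degree `0` the map `β` need not satisfy a cocycle condition of its own; it extends over
      -- `d_Y⁰` because `-α` extends `f⁰ ≫ β` over `d_X⁰`.
      (-((upToProj n X).f 1 ≫ α)) (by
        rw [Preadditive.comp_neg, ← (upToProj n X).comm_assoc,
          ← Category.assoc (f.f 0), ← upToProj_naturality_f, Category.assoc, ← Preadditive.comp_neg,
          eq_comm]
        congr 1
        rw [eq_neg_iff_add_eq_zero, add_comm, h₁])
    exact key 0 hn T α β v hv h₁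
  · obtain ⟨v, hv⟩ := hYc.exists_desc j ((upToProj n Y).f (j + 1) ≫ β) (by
      rw [← (upToProj n Y).comm_assoc, ← neg_eq_zero, ← Preadditive.comp_neg,
        ← Preadditive.neg_comp, h₂, comp_zero])
    exact key (j + 1) hj T α β v hv h₁

/-- The projections to the `Xⁱ` for `i ≤ n`, completed by `d_Yⁿ` followed by the inverse of `fⁿ⁺¹`,
form a morphism to `X` that is invertible in degree `0`. So the cocone is a pullback of `X`. -/
theorem mappingCocone_mem (hX : 𝒳 X) (hY : 𝒳 Y) (f : X ⟶ Y) [IsIso (f.f (n + 1))] :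
    𝒳 (mappingCocone n f) ∧ IsIso (toCoconeZero n f) ∧ ∃ k : mappingCocone n f ⟶ X,
      toCoconeZero n f ≫ k.f 0 = 𝟙 _ ∧
        k.f (n + 1) ≫ f.f (n + 1) = fromCoconeLast n f ≫ Y.d n (n + 1) := by
  let t := mappingCoconeData (n := n) f
  have p := isIso_upToProj_f Y (le_refl n)
  have p₀ := isIso_upToProj_f X (Nat.zero_le n)
  have e₁ : toCoconeZero n f = (upToProj n X).f 0 ≫ t.inl 0 := by
    rw [upToProj_f X (Nat.zero_le n)]
    exact (Category.comp_id _).symm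
  have e₂ : fromCoconeLast n f ≫ (upToProj n Y).f n = t.snd n := by
    rw [upToProj_f Y le_rfl]
    have : ∀ {A B C : 𝒞} (s : A ⟶ B) (h : B = C), (s ≫ eqToHom h) ≫ eqToHom h.symm = s := by
      rintro A B _ s rfl
      simp
    exact this (C := Y.X n) (t.snd n) (upToObj_eq n Y le_rfl)
  have i₁ : IsIso (t.inl 0) := ⟨t.fst 0, t.inl_fst 0, t.total_zero⟩
  let φ : mappingCocone n f ⟶ upTo n X := CochainComplex.ofHom t.fst fun i => (t.d_fst i).symm
  have hd : (mappingCocone n f).d n (n + 1) ≫ fromCoconeLast n f ≫ Y.d n (n + 1) =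
      t.fst n ≫ (upToMap n f).f n ≫ inv ((upToProj n Y).f n) ≫ Y.d n (n + 1) := by
    have e₃ : fromCoconeLast n f = t.snd n ≫ inv ((upToProj n Y).f n) := by simp [← e₂]
    obtain ⟨m, rfl⟩ : ∃ m, n = m + 1 := ⟨n - 1, by omega⟩
    have p' := isIso_upToProj_f Y (Nat.le_succ m)
    have e₄ : (upTo (m + 1) Y).d m (m + 1) ≫ inv ((upToProj (m + 1) Y).f (m + 1)) ≫
        Y.d (m + 1) (m + 2) = 0 := by
      rw [← cancel_epi ((upToProj (m + 1) Y).f m), (upToProj (m + 1) Y).comm_assoc]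
      simp
    rw [e₃, Category.assoc, reassoc_of% t.d_snd_succ m, Preadditive.add_comp, Category.assoc,
      Category.assoc, Preadditive.neg_comp, e₄]
    simp
  obtain ⟨k, hk, hk'⟩ := exists_hom_of_isIso (upToProj n X) (fun i hi => isIso_upToProj_f X hi)
    (h𝒳.isNExact X hX).1.isNComplex φ
    (fromCoconeLast n f ≫ Y.d n (n + 1) ≫ inv (f.f (n + 1))) (fun s hs => by
      rw [← cancel_mono (f.f (n + 1))]
      simp only [Category.assoc, IsIso.inv_hom_id, Category.comp_id]
      rw [hd, ← f.comm, show t.fst n = s ≫ (upToProj n X).f n from hs.symm, Category.assoc,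
        ← Category.assoc _ ((upToMap n f).f n), upToProj_naturality_f]
      simp)
  have hk₀ : toCoconeZero n f ≫ k.f 0 = 𝟙 _ := by
    rw [← cancel_mono ((upToProj n X).f 0), Category.assoc, hk 0 (Nat.zero_le n), e₁,
      Category.assoc, show φ.f 0 = t.fst 0 from rfl, t.inl_fst]
    simp
  have i₂ : IsIso (toCoconeZero n f) := by
    rw [e₁]
    infer_instance
  have i₃ : IsIso (k.f 0) := by
    have : k.f 0 = inv (toCoconeZero n f) := by
      rw [← cancel_epi (toCoconeZero n f), hk₀, IsIso.hom_inv_id]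
    rw [this]
    infer_instance
  refine ⟨h𝒳.mem_of_pullback hn hX ⟨h𝒳.isNKernel_mappingCocone hn hX hY f,
    h𝒳.isNCokernel_mappingCocone hn hX hY f⟩ k, i₂, k, hk₀, ?_⟩
  rw [hk']
  simp

end IsNExactCategory

end NExactCategories

/-! ### Replacing terms by isomorphic objects -/

section Replacement

variable {𝒞 : Type u} [Category.{v} 𝒞] [Preadditive 𝒞] {n : ℕ}

/-- Classes with fixed ends require equalities of objects, while pushouts and pullbacks give their
ends only up to isomorphism. -/
lemma exists_iso_replace (X : CochainComplex 𝒞 ℕ) {k l : ℕ} (hkl : k ≠ l) {A B : 𝒞} (u : X.X k ≅ A)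
    (v : X.X l ≅ B) : ∃ (X' : CochainComplex 𝒞 ℕ) (φ : X ≅ X') (hk : X'.X k = A) (hl : X'.X l = B),
      φ.hom.f k ≫ eqToHom hk = u.hom ∧ φ.hom.f l ≫ eqToHom hl = v.hom := by
  let s : ∀ i, Σ Z, X.X i ≅ Z :=
    Function.update (Function.update (fun i => ⟨X.X i, Iso.refl _⟩) k ⟨A, u⟩) l ⟨B, v⟩
  have hk : s k = ⟨A, u⟩ := by simp [s, Function.update_of_ne hkl]
  have hl : s l = ⟨B, v⟩ := by simp [s]
  have key : ∀ {i : ℕ} {Z : 𝒞} {w : X.X i ≅ Z} (t : Σ Z, X.X i ≅ Z), t = ⟨Z, w⟩ →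
      ∃ h : t.1 = Z, t.2.hom ≫ eqToHom h = w.hom := by
    rintro i Z w _ rfl
    exact ⟨rfl, by simp⟩
  obtain ⟨hk, hk'⟩ := key _ hk
  obtain ⟨hl, hl'⟩ := key _ hl
  let X' : CochainComplex 𝒞 ℕ :=
    { X := fun i => (s i).1
      d := fun i j => (s i).2.inv ≫ X.d i j ≫ (s j).2.hom
      shape := fun i j h => by simp [X.shape i j h]
      d_comp_d' := fun i j k _ _ => by simp }
  exact ⟨X', HomologicalComplex.Hom.isoOfComponents (fun i => (s i).2)
    (fun i j _ => (s i).2.hom_inv_id_assoc _), hk, hl, hk', hl'⟩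

variable [HasZeroObject 𝒞]

lemma exists_isIso_d_zero (B : 𝒞) : ∃ X : CochainComplex 𝒞 ℕ, Nonempty (X.X 0 ≅ B) ∧
    IsIso (X.d 0 1) ∧ ∀ i, 2 ≤ i → IsZero (X.X i) := by
  let S := (HomologicalComplex.single 𝒞 (ComplexShape.up ℕ) 1).obj B
  have hS : ∀ i, i ≠ 1 → IsZero (S.X i) := fun i hi =>
    HomologicalComplex.isZero_single_obj_X (ComplexShape.up ℕ) 1 B i hi
  let w := HomologicalComplex.singleObjXSelf (ComplexShape.up ℕ) 1 B
  obtain ⟨X, e₀, e, h, -⟩ := exists_augment S w.inv ((hS 2 (by omega)).eq_of_tgt _ _)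
  refine ⟨X, ⟨e₀⟩, ?_, fun i hi => ?_⟩
  · have : X.d 0 1 = e₀.hom ≫ w.inv ≫ (e 0).inv := by
      rw [← cancel_mono (e 0).hom, h]
      simp
    rw [this]
    infer_instance
  · obtain ⟨k, rfl⟩ : ∃ k, i = k + 1 := ⟨i - 1, by omega⟩
    exact (hS _ (by omega)).of_iso (e k)

end Replacement

/-! ### Direct sums of complexes -/

section DirectSums

variable {𝒞 : Type u} [Category.{v} 𝒞] [Preadditive 𝒞] [HasBinaryBiproducts 𝒞] {n : ℕ}
  {X Y X' Y' : CochainComplex 𝒞 ℕ}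

/-- The inclusion of the first summand. -/
noncomputable def directSumInl (X Y : CochainComplex 𝒞 ℕ) : X ⟶ directSum X Y where
  f i := (biprod.inl : X.X i ⟶ X.X i ⊞ Y.X i)
  comm' i j _ := (biprod.inl_map (X.d i j) (Y.d i j))

/-- The inclusion of the second summand. -/
noncomputable def directSumInr (X Y : CochainComplex 𝒞 ℕ) : Y ⟶ directSum X Y where
  f i := (biprod.inr : Y.X i ⟶ X.X i ⊞ Y.X i)
  comm' i j _ := (biprod.inr_map (X.d i j) (Y.d i j))

/-- The projection to the first summand. -/
noncomputable def directSumFst (X Y : CochainComplex 𝒞 ℕ) : directSum X Y ⟶ X where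
  f i := (biprod.fst : X.X i ⊞ Y.X i ⟶ X.X i)
  comm' i j _ := (biprod.map_fst (X.d i j) (Y.d i j)).symm

/-- The projection to the second summand. -/
noncomputable def directSumSnd (X Y : CochainComplex 𝒞 ℕ) : directSum X Y ⟶ Y where
  f i := (biprod.snd : X.X i ⊞ Y.X i ⟶ Y.X i)
  comm' i j _ := (biprod.map_snd (X.d i j) (Y.d i j)).symm

lemma directSum_inl_fst (i : ℕ) : (directSumInl X Y).f i ≫ (directSumFst X Y).f i = 𝟙 _ :=
  (biprod.inl_fst : (biprod.inl : X.X i ⟶ X.X i ⊞ Y.X i) ≫ _ = _)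

lemma directSum_inr_snd (i : ℕ) : (directSumInr X Y).f i ≫ (directSumSnd X Y).f i = 𝟙 _ :=
  (biprod.inr_snd : (biprod.inr : Y.X i ⟶ X.X i ⊞ Y.X i) ≫ _ = _)

lemma directSum_total (i : ℕ) : (directSumFst X Y).f i ≫ (directSumInl X Y).f i +
    (directSumSnd X Y).f i ≫ (directSumInr X Y).f i = 𝟙 _ :=
  (biprod.total : _ = 𝟙 (X.X i ⊞ Y.X i))

lemma directSum_hom_ext {T : 𝒞} {i : ℕ} {u v : T ⟶ (directSum X Y).X i}
    (h₁ : u ≫ (directSumFst X Y).f i = v ≫ (directSumFst X Y).f i)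
    (h₂ : u ≫ (directSumSnd X Y).f i = v ≫ (directSumSnd X Y).f i) : u = v := by
  rw [← Category.comp_id u, ← Category.comp_id v, ← directSum_total, Preadditive.comp_add,
    Preadditive.comp_add, reassoc_of% h₁, reassoc_of% h₂]

lemma directSum_hom_ext' {T : 𝒞} {i : ℕ} {u v : (directSum X Y).X i ⟶ T}
    (h₁ : (directSumInl X Y).f i ≫ u = (directSumInl X Y).f i ≫ v)
    (h₂ : (directSumInr X Y).f i ≫ u = (directSumInr X Y).f i ≫ v) : u = v := by
  rw [← Category.id_comp u, ← Category.id_comp v, ← directSum_total, Preadditive.add_comp,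
    Preadditive.add_comp, Category.assoc, Category.assoc, Category.assoc, Category.assoc, h₁, h₂]

lemma isNComplex_directSum (hX : IsNComplex n X) (hY : IsNComplex n Y) :
    IsNComplex n (directSum X Y) := fun i hi => by
  rw [IsZero.iff_id_eq_zero]
  exact directSum_hom_ext ((hX i hi).eq_of_tgt _ _) ((hY i hi).eq_of_tgt _ _)

lemma isNKernel_directSum (hX : IsNKernel n X) (hY : IsNKernel n Y) :
    IsNKernel n (directSum X Y) := by
  have := hX.mono
  have := hY.mono
  refine ⟨isNComplex_directSum hX.isNComplex hY.isNComplex, ⟨fun u v huv => ?_⟩,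
    fun T i hi g hg => ?_⟩
  · apply directSum_hom_ext
    · rw [← cancel_mono (X.d 0 1), Category.assoc, Category.assoc, (directSumFst X Y).comm,
        reassoc_of% huv]
    · rw [← cancel_mono (Y.d 0 1), Category.assoc, Category.assoc, (directSumSnd X Y).comm,
        reassoc_of% huv]
  · obtain ⟨x, hx⟩ := hX.exact T i hi (g ≫ (directSumFst X Y).f (i + 1)) (by
      rw [Category.assoc, (directSumFst X Y).comm, reassoc_of% hg, zero_comp])
    obtain ⟨y, hy⟩ := hY.exact T i hi (g ≫ (directSumSnd X Y).f (i + 1)) (by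
      rw [Category.assoc, (directSumSnd X Y).comm, reassoc_of% hg, zero_comp])
    refine ⟨x ≫ (directSumInl X Y).f i + y ≫ (directSumInr X Y).f i, ?_⟩
    rw [Preadditive.add_comp, Category.assoc, Category.assoc, (directSumInl X Y).comm,
      (directSumInr X Y).comm, reassoc_of% hx, reassoc_of% hy, ← Preadditive.comp_add,
      directSum_total, Category.comp_id]

lemma isNCokernel_directSum (hX : IsNCokernel n X) (hY : IsNCokernel n Y) :
    IsNCokernel n (directSum X Y) := by
  have := hX.epi
  have := hY.epi
  refine ⟨isNComplex_directSum hX.isNComplex hY.isNComplex, ⟨fun u v huv => ?_⟩,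
    fun T i hi g hg => ?_⟩
  · apply directSum_hom_ext'
    · rw [← cancel_epi (X.d n (n + 1)), ← (directSumInl X Y).comm_assoc, huv,
        (directSumInl X Y).comm_assoc]
    · rw [← cancel_epi (Y.d n (n + 1)), ← (directSumInr X Y).comm_assoc, huv,
        (directSumInr X Y).comm_assoc]
  · obtain ⟨x, hx⟩ := hX.exact T i hi ((directSumInl X Y).f (i + 1) ≫ g) (by
      rw [← (directSumInl X Y).comm_assoc, hg, comp_zero])
    obtain ⟨y, hy⟩ := hY.exact T i hi ((directSumInr X Y).f (i + 1) ≫ g) (by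
      rw [← (directSumInr X Y).comm_assoc, hg, comp_zero])
    refine ⟨(directSumFst X Y).f (i + 2) ≫ x + (directSumSnd X Y).f (i + 2) ≫ y, ?_⟩
    rw [Preadditive.comp_add, ← (directSumFst X Y).comm_assoc, hx, ← (directSumSnd X Y).comm_assoc,
      hy, ← Category.assoc, ← Category.assoc, ← Preadditive.add_comp, directSum_total,
      Category.id_comp]

end DirectSums

/-! ### Trivial sequences and direct sums in `𝒳` -/

section NExactCategories

variable {𝒞 : Type u} [Category.{v} 𝒞] [Preadditive 𝒞] {n : ℕ} [HasZeroObject 𝒞]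
  [HasBinaryBiproducts 𝒞] {𝒳 : CochainComplex 𝒞 ℕ → Prop}

open scoped ZeroObject

namespace IsNExactCategory

variable (h𝒳 : IsNExactCategory n 𝒳) (hn : 1 ≤ n) {X Y Z : CochainComplex 𝒞 ℕ}

include h𝒳

lemma isAdmissibleMono_of_iso (hX : 𝒳 X) {A B : 𝒞} (u : X.X 0 ≅ A) (v : X.X 1 ≅ B) (f : A ⟶ B)
    (h : u.hom ≫ f = X.d 0 1 ≫ v.hom) : IsAdmissibleMono 𝒳 f := by
  obtain ⟨X', φ, hk, hl, hk', hl'⟩ := exists_iso_replace X zero_ne_one u v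
  refine ⟨X', h𝒳.mem_of_isNCokernel ((h𝒳.isNExact X hX).2.of_nullMap ?_ φ.hom φ.inv (h := 0) ?_)
    hX (HomologicalComplex.Hom.isoApp φ.symm 0) (HomologicalComplex.Hom.isoApp φ.symm 1)
    (φ.inv.comm 0 1), hk, hl, ?_⟩
  · exact fun i hi => ((h𝒳.isNExact X hX).1.isNComplex i hi).of_iso
      (HomologicalComplex.Hom.isoApp φ.symm i)
  · rw [φ.inv_hom_id, sub_self]
    exact eq_nullMap (by simp) (by simp)
  · rw [← cancel_epi u.hom, h, ← hk', ← hl']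
    simp

include hn

/-- Push the zero sequence out along `0 ⟶ B`. -/
lemma exists_left (B : 𝒞) : ∃ Y, 𝒳 Y ∧ Nonempty (Y.X 0 ≅ B) ∧ IsZero (Y.X (n + 1)) := by
  have hz : ∀ i, IsZero ((0 : CochainComplex 𝒞 ℕ).X i) := fun i =>
    (HomologicalComplex.eval 𝒞 _ i).map_isZero (isZero_zero _)
  obtain ⟨Y, q, e, hY, hq, -⟩ :=
    h𝒳.exists_pushout hn (h𝒳.zero 0 (isZero_zero _)) (0 : (0 : CochainComplex 𝒞 ℕ).X 0 ⟶ B)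
  exact ⟨Y, hY, ⟨e⟩, (hz (n + 1)).of_iso (asIso (q.f (n + 1))).symm⟩

lemma exists_right (B : 𝒞) : ∃ Y, 𝒳 Y ∧ Nonempty (Y.X (n + 1) ≅ B) ∧ IsZero (Y.X 0) := by
  have hz : ∀ i, IsZero ((0 : CochainComplex 𝒞 ℕ).X i) := fun i =>
    (HomologicalComplex.eval 𝒞 _ i).map_isZero (isZero_zero _)
  obtain ⟨Y, q, e, hY, hq, -⟩ :=
    h𝒳.exists_pullback hn (h𝒳.zero 0 (isZero_zero _)) (0 : B ⟶ (0 : CochainComplex 𝒞 ℕ).X (n + 1))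
  exact ⟨Y, hY, ⟨e⟩, (hz 0).of_iso (asIso (q.f 0))⟩

/-- Both `X` and the sequence from `exists_left` have last term zero, so a null-homotopic map that
is invertible in degree `0` already has invertible ends. -/
lemma mem_of_isIso_d_zero [IsIso (X.d 0 1)] (hX : ∀ i, 2 ≤ i → IsZero (X.X i)) : 𝒳 X := by
  obtain ⟨Y, hY, ⟨e⟩, hY'⟩ := h𝒳.exists_left hn (X.X 0)
  have hXe : IsNExact n X := by
    refine ⟨⟨fun i hi => hX i (by omega), inferInstance, fun T i hi g hg => ?_⟩,
      ⟨fun i hi => hX i (by omega), ⟨fun _ _ _ => (hX _ (by omega)).eq_of_src _ _⟩,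
        fun T i hi g hg => ?_⟩⟩
    · cases i with
      | zero => exact ⟨g ≫ inv (X.d 0 1), by simp⟩
      | succ i => exact ⟨0, (hX _ (by omega)).eq_of_tgt _ _⟩
    · cases i with
      | zero => exact ⟨0, by rw [← cancel_epi (X.d 0 1), hg]; simp⟩
      | succ i => exact ⟨0, (hX _ (by omega)).eq_of_src _ _⟩
  refine (h𝒳.closed_ends X Y (singleNullMap 0 (inv (X.d 0 1) ≫ e.inv)) hXe (h𝒳.isNExact Y hY)
    ?_ ?_).mpr hY
  · rw [singleNullMap_self, IsIso.hom_inv_id_assoc]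
    infer_instance
  · exact ⟨0, (hX _ (by omega)).eq_of_src _ _, hY'.eq_of_src _ _⟩

lemma mem_of_isIso_d_last [IsIso (X.d n (n + 1))] (hX : IsNComplex n X)
    (hX' : ∀ i, i < n → IsZero (X.X i)) : 𝒳 X := by
  obtain ⟨Y, hY, ⟨e⟩, hY'⟩ := h𝒳.exists_right hn (X.X (n + 1))
  have hXe : IsNExact n X := by
    refine ⟨⟨hX, ⟨fun _ _ _ => (hX' _ (by omega)).eq_of_tgt _ _⟩, fun T i hi g hg => ⟨0, ?_⟩⟩,
      ⟨hX, inferInstance, fun T i hi g hg => ?_⟩⟩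
    · rcases Nat.lt_or_ge (i + 1) n with hin | hin
      · exact (hX' _ hin).eq_of_tgt _ _
      · obtain rfl : n = i + 1 := by omega
        rw [← cancel_mono (X.d (i + 1) (i + 2)), hg]
        simp
    · rcases Nat.lt_or_ge (i + 1) n with hin | hin
      · exact ⟨0, (hX' _ hin).eq_of_src _ _⟩
      · obtain rfl : n = i + 1 := by omega
        exact ⟨inv (X.d (i + 1) (i + 2)) ≫ g, by simp⟩
  refine (h𝒳.closed_ends Y X (singleNullMap n (e.hom ≫ inv (X.d n (n + 1)))) (h𝒳.isNExact Y hY) hXe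
    ?_ ?_).mp hY
  · exact ⟨0, hY'.eq_of_src _ _, (hX' 0 hn).eq_of_src _ _⟩
  · rw [singleNullMap_succ, Category.assoc, IsIso.inv_hom_id, Category.comp_id]
    infer_instance

/-- The first differential factors as `d_X⁰ ⊕ 1` followed by `1 ⊕ d_Y⁰`, so it is an admissible mono
by (E1), and it determines the `n`-cokernel sequence `X ⊕ Y`. -/
theorem directSum_mem (hX : 𝒳 X) (hY : 𝒳 Y) : 𝒳 (directSum X Y) := by
  have key : ∀ {A B : 𝒞} (u : A ⟶ B), IsAdmissibleMono 𝒳 u → ∀ D : 𝒞,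
      IsAdmissibleMono 𝒳 (biprod.map u (𝟙 D)) ∧ IsAdmissibleMono 𝒳 (biprod.map (𝟙 D) u) := by
    rintro _ _ _ ⟨X, hX, rfl, rfl, rfl⟩ D
    obtain ⟨T, ⟨e⟩, hd, hT⟩ := exists_isIso_d_zero D
    have hT' := h𝒳.isNExact T (h𝒳.mem_of_isIso_d_zero hn hT)
    have hX' := h𝒳.isNExact X hX
    have hTz := hT (n + 1) (by omega)
    -- `T` vanishes from degree `2` on, so `X ⟶ X ⊕ T` is invertible in degree `n + 1` and `X ⊕ T`
    -- is a pushout of `X`.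
    have i₁ : IsIso ((directSumInl X T).f (n + 1)) :=
      ⟨_, directSum_inl_fst _, directSum_hom_ext
        (by rw [Category.assoc, directSum_inl_fst]; simp) (hTz.eq_of_tgt _ _)⟩
    have i₂ : IsIso ((directSumInr T X).f (n + 1)) :=
      ⟨_, directSum_inr_snd _, directSum_hom_ext (hTz.eq_of_tgt _ _)
        (by rw [Category.assoc, directSum_inr_snd]; simp)⟩
    have m₁ := h𝒳.mem_of_pushout hn hX (f := directSumInl X T)
      ⟨isNKernel_directSum hX'.1 hT'.1, isNCokernel_directSum hX'.2 hT'.2⟩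
    have m₂ := h𝒳.mem_of_pushout hn hX (f := directSumInr T X)
      ⟨isNKernel_directSum hT'.1 hX'.1, isNCokernel_directSum hT'.2 hX'.2⟩
    constructor
    · refine h𝒳.isAdmissibleMono_of_iso m₁ (biprod.mapIso (Iso.refl (X.X 0)) e)
        (biprod.mapIso (Iso.refl (X.X 1)) ((asIso (T.d 0 1)).symm ≪≫ e)) _ ?_
      change biprod.map (𝟙 (X.X 0)) e.hom ≫ _ =
        biprod.map (X.d 0 1) (T.d 0 1) ≫ biprod.map (𝟙 (X.X 1)) (inv (T.d 0 1) ≫ e.hom)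
      apply biprod.hom_ext <;> simp
    · refine h𝒳.isAdmissibleMono_of_iso m₂ (biprod.mapIso e (Iso.refl (X.X 0)))
        (biprod.mapIso ((asIso (T.d 0 1)).symm ≪≫ e) (Iso.refl (X.X 1))) _ ?_
      change biprod.map e.hom (𝟙 (X.X 0)) ≫ _ =
        biprod.map (T.d 0 1) (X.d 0 1) ≫ biprod.map (inv (T.d 0 1) ≫ e.hom) (𝟙 (X.X 1))
      apply biprod.hom_ext <;> simp
  obtain ⟨Z, hZ, h₀, h₁, h⟩ := h𝒳.mono_comp _ _
    (key (X.d 0 1) ⟨X, hX, rfl, rfl, by simp⟩ (Y.X 0)).1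
    (key (Y.d 0 1) ⟨Y, hY, rfl, rfl, by simp⟩ (X.X 1)).2
  replace h₀ : Z.X 0 = (directSum X Y).X 0 := h₀
  replace h₁ : Z.X 1 = (directSum X Y).X 1 := h₁
  refine h𝒳.mem_of_isNCokernel (isNCokernel_directSum (h𝒳.isNExact X hX).2 (h𝒳.isNExact Y hY).2) hZ
    (eqToIso h₀.symm) (eqToIso h₁.symm) ?_
  have h' : (directSum X Y).d 0 1 = eqToHom h₀.symm ≫ Z.d 0 1 ≫ eqToHom h₁ := by
    refine Eq.trans ?_ h
    change biprod.map (X.d 0 1) (Y.d 0 1) = _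
    apply biprod.hom_ext <;> simp
  rw [h']
  simp

end IsNExactCategory

end NExactCategories

/-! ### Morphisms with prescribed ends -/

namespace EndComplex

variable {𝒞 : Type u} [Category.{v} 𝒞] [Preadditive 𝒞] {n : ℕ} {A B C D : 𝒞}

lemma HasEnds.add {X : EndComplex n A C} {Y : EndComplex n B D} {f f' : X.K ⟶ Y.K} {a a' : A ⟶ B}
    {c c' : C ⟶ D} (hf : HasEnds f a c) (hf' : HasEnds f' a' c') :
    HasEnds (f + f') (a + a') (c + c') := by
  constructor
  · simp [hf.1, hf'.1]
  · simp [hf.2, hf'.2]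

lemma HasEnds.isIso_zero {X : EndComplex n A C} {Y : EndComplex n B D} {f : X.K ⟶ Y.K} {a : A ⟶ B}
    {c : C ⟶ D} (hf : HasEnds f a c) [IsIso a] : IsIso (f.f 0) := by
  rw [hf.1]
  infer_instance

lemma HasEnds.isIso_last {X : EndComplex n A C} {Y : EndComplex n B D} {f : X.K ⟶ Y.K} {a : A ⟶ B}
    {c : C ⟶ D} (hf : HasEnds f a c) [IsIso c] : IsIso (f.f (n + 1)) := by
  rw [hf.2]
  infer_instance

section

variable [HasBinaryBiproducts 𝒞] (X : EndComplex n A C) (Y : EndComplex n B D)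

lemma hasEnds_inl : HasEnds (X := X) (Y := X.sum Y) (directSumInl X.K Y.K) biprod.inl
    biprod.inl := by
  obtain ⟨X, hX, rfl, rfl⟩ := X
  obtain ⟨Y, hY, rfl, rfl⟩ := Y
  exact ⟨(by simp : (biprod.inl : X.X 0 ⟶ X.X 0 ⊞ Y.X 0) = 𝟙 _ ≫ biprod.inl ≫ 𝟙 _),
    (by simp : (biprod.inl : X.X (n + 1) ⟶ X.X (n + 1) ⊞ Y.X (n + 1)) = 𝟙 _ ≫ biprod.inl ≫ 𝟙 _)⟩

lemma hasEnds_inr : HasEnds (X := Y) (Y := X.sum Y) (directSumInr X.K Y.K) biprod.inr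
    biprod.inr := by
  obtain ⟨X, hX, rfl, rfl⟩ := X
  obtain ⟨Y, hY, rfl, rfl⟩ := Y
  exact ⟨(by simp : (biprod.inr : Y.X 0 ⟶ X.X 0 ⊞ Y.X 0) = 𝟙 _ ≫ biprod.inr ≫ 𝟙 _),
    (by simp : (biprod.inr : Y.X (n + 1) ⟶ X.X (n + 1) ⊞ Y.X (n + 1)) = 𝟙 _ ≫ biprod.inr ≫ 𝟙 _)⟩

lemma hasEnds_fst : HasEnds (X := X.sum Y) (Y := X) (directSumFst X.K Y.K) biprod.fst
    biprod.fst := by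
  obtain ⟨X, hX, rfl, rfl⟩ := X
  obtain ⟨Y, hY, rfl, rfl⟩ := Y
  exact ⟨(by simp : (biprod.fst : X.X 0 ⊞ Y.X 0 ⟶ X.X 0) = 𝟙 _ ≫ biprod.fst ≫ 𝟙 _),
    (by simp : (biprod.fst : X.X (n + 1) ⊞ Y.X (n + 1) ⟶ X.X (n + 1)) = 𝟙 _ ≫ biprod.fst ≫ 𝟙 _)⟩

lemma hasEnds_snd : HasEnds (X := X.sum Y) (Y := Y) (directSumSnd X.K Y.K) biprod.snd
    biprod.snd := by
  obtain ⟨X, hX, rfl, rfl⟩ := X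
  obtain ⟨Y, hY, rfl, rfl⟩ := Y
  exact ⟨(by simp : (biprod.snd : X.X 0 ⊞ Y.X 0 ⟶ Y.X 0) = 𝟙 _ ≫ biprod.snd ≫ 𝟙 _),
    (by simp : (biprod.snd : X.X (n + 1) ⊞ Y.X (n + 1) ⟶ Y.X (n + 1)) = 𝟙 _ ≫ biprod.snd ≫ 𝟙 _)⟩

variable {X Y}

lemma HasEnds.exists_lift {A' C' : 𝒞} {Z : EndComplex n A' C'} {f : Z.K ⟶ X.K} {g : Z.K ⟶ Y.K}
    {a : A' ⟶ A} {c : C' ⟶ C} {b : A' ⟶ B} {d : C' ⟶ D} (hf : HasEnds f a c)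
    (hg : HasEnds g b d) :
    ∃ k : Z.K ⟶ (X.sum Y).K, HasEnds k (biprod.lift a b) (biprod.lift c d) := by
  refine ⟨f ≫ directSumInl X.K Y.K + g ≫ directSumInr X.K Y.K, ?_⟩
  rw [biprod.lift_eq, biprod.lift_eq]
  exact (hf.comp (hasEnds_inl X Y)).add (hg.comp (hasEnds_inr X Y))

lemma HasEnds.exists_desc {A' C' : 𝒞} {Z : EndComplex n A' C'} {f : X.K ⟶ Z.K} {g : Y.K ⟶ Z.K}
    {a : A ⟶ A'} {c : C ⟶ C'} {b : B ⟶ A'} {d : D ⟶ C'} (hf : HasEnds f a c)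
    (hg : HasEnds g b d) :
    ∃ k : (X.sum Y).K ⟶ Z.K, HasEnds k (biprod.desc a b) (biprod.desc c d) := by
  refine ⟨directSumFst X.K Y.K ≫ f + directSumSnd X.K Y.K ≫ g, ?_⟩
  rw [biprod.desc_eq, biprod.desc_eq]
  exact ((hasEnds_fst X Y).comp hf).add ((hasEnds_snd X Y).comp hg)

end

end EndComplex

/-! ### Extension classes, pushforward and pullback -/

section Extensions

open EndComplex

variable {𝒞 : Type u} [Category.{v} 𝒞] [Preadditive 𝒞] {n : ℕ} {𝒳 : CochainComplex 𝒞 ℕ → Prop}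

lemma htpyClass_eq_iff {A C : 𝒞} {X Y : EndComplex n A C} :
    htpyClass X = htpyClass Y ↔ HtpyEquiv X Y :=
  Quotient.eq (r := EndComplex.setoid n A C)

/-- The class `[X]` of a sequence `X` in `𝒳`. -/
def YonedaExt.mk {A C : 𝒞} (X : EndComplex n A C) (hX : 𝒳 X.K) : YonedaExt n 𝒳 A C :=
  ⟨htpyClass X, X, hX, rfl⟩

/-- There is a morphism with the end components `a` and `c` between representatives of `ξ`
and `η`. -/
def ExtHom {A B C D : 𝒞} (a : A ⟶ B) (c : C ⟶ D) (ξ : YonedaExt n 𝒳 A C)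
    (η : YonedaExt n 𝒳 B D) : Prop :=
  ∃ (X : EndComplex n A C) (Y : EndComplex n B D) (f : X.K ⟶ Y.K), ξ.1 = htpyClass X ∧
    η.1 = htpyClass Y ∧ HasEnds f a c

namespace ExtHom

variable {A B C D A' C' : 𝒞} {a : A ⟶ B} {c : C ⟶ D} {ξ : YonedaExt n 𝒳 A C}
  {η : YonedaExt n 𝒳 B D}

/-- Homotopy equivalences are the identity on the ends, so composing with them changes
representatives but not `a` and `c`. -/
lemma exists_hom (h : ExtHom a c ξ η) {X : EndComplex n A C} {Y : EndComplex n B D}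
    (hX : ξ.1 = htpyClass X) (hY : η.1 = htpyClass Y) : ∃ f : X.K ⟶ Y.K, HasEnds f a c := by
  obtain ⟨X', Y', f, hX', hY', hf⟩ := h
  obtain ⟨u, -, hu, -⟩ := htpyClass_eq_iff.mp (hX.symm.trans hX')
  obtain ⟨v, -, hv, -⟩ := htpyClass_eq_iff.mp (hY'.symm.trans hY)
  exact ⟨u ≫ f ≫ v, by simpa using hu.comp (hf.comp hv)⟩

lemma refl (ξ : YonedaExt n 𝒳 A C) : ExtHom (𝟙 A) (𝟙 C) ξ ξ := by
  obtain ⟨X, -, hX⟩ := ξ.2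
  exact ⟨X, X, 𝟙 _, hX, hX, by simp [HasEnds]⟩

lemma comp (h : ExtHom a c ξ η) {b : B ⟶ A'} {d : D ⟶ C'} {ζ : YonedaExt n 𝒳 A' C'}
    (h' : ExtHom b d η ζ) : ExtHom (a ≫ b) (c ≫ d) ξ ζ := by
  obtain ⟨X, -, hX⟩ := ξ.2
  obtain ⟨Y, -, hY⟩ := η.2
  obtain ⟨Z, -, hZ⟩ := ζ.2
  obtain ⟨f, hf⟩ := h.exists_hom hX hY
  obtain ⟨g, hg⟩ := h'.exists_hom hY hZ
  exact ⟨X, Z, f ≫ g, hX, hZ, hf.comp hg⟩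

end ExtHom

section

variable [HasZeroObject 𝒞] [HasBinaryBiproducts 𝒞] (h𝒳 : IsNExactCategory n 𝒳) (hn : 1 ≤ n)
  {A B C D A' C' : 𝒞}

include h𝒳

lemma IsNExactCategory.mem_of_htpyEquiv {X Y : EndComplex n A C} (h : HtpyEquiv X Y)
    (hX : 𝒳 X.K) : 𝒳 Y.K := by
  obtain ⟨f, g, hf, hg, -, ⟨H⟩⟩ := h
  obtain ⟨k, hk⟩ := exists_sub_eq_nullMap H.symm
  exact (h𝒳.closed_ends X.K Y.K f (h𝒳.isNExact _ hX)
    ⟨(h𝒳.isNExact _ hX).1.of_nullMap Y.isNComplex f g hk,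
      (h𝒳.isNExact _ hX).2.of_nullMap Y.isNComplex f g hk⟩ hf.isIso_zero hf.isIso_last).mp hX

lemma IsNExactCategory.mem_of_eq (ξ : YonedaExt n 𝒳 A C) {X : EndComplex n A C}
    (h : ξ.1 = htpyClass X) : 𝒳 X.K := by
  obtain ⟨Y, hY, hY'⟩ := ξ.2
  exact h𝒳.mem_of_htpyEquiv (htpyClass_eq_iff.mp (hY'.symm.trans h)) hY

include hn

namespace ExtHom

/-- The universal property of `a_* ξ = η`. -/
lemma desc {ξ : YonedaExt n 𝒳 A C} {η : YonedaExt n 𝒳 B C} {ζ : YonedaExt n 𝒳 A' C'} {a : A ⟶ B}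
    {b : B ⟶ A'} {c : C ⟶ C'} (h : ExtHom a (𝟙 C) ξ η) (h' : ExtHom (a ≫ b) c ξ ζ) :
    ExtHom b c η ζ := by
  obtain ⟨X, -, hX⟩ := ξ.2
  obtain ⟨Y, -, hY⟩ := η.2
  obtain ⟨Z, -, hZ⟩ := ζ.2
  obtain ⟨f, hf⟩ := h.exists_hom hX hY
  obtain ⟨g, hg⟩ := h'.exists_hom hX hZ
  have := hf.isIso_last
  obtain ⟨p, hp, hp'⟩ := h𝒳.exists_hom_of_pushout hn (h𝒳.mem_of_eq ξ hX) (h𝒳.mem_of_eq η hY) f g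
    (eqToHom Y.left ≫ b ≫ eqToHom Z.left.symm) (by simp [hf.1, hg.1])
  refine ⟨Y, Z, p, hY, hZ, hp, ?_⟩
  rw [← cancel_epi (f.f (n + 1)), hp', hg.2, hf.2]
  simp

/-- The universal property of `c^* ξ = η`. -/
lemma lift {ξ : YonedaExt n 𝒳 A C} {η : YonedaExt n 𝒳 A D} {ζ : YonedaExt n 𝒳 A' C'} {c : D ⟶ C}
    {a : A' ⟶ A} {d : C' ⟶ D} (h : ExtHom (𝟙 A) c η ξ) (h' : ExtHom a (d ≫ c) ζ ξ) :
    ExtHom a d ζ η := by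
  obtain ⟨X, -, hX⟩ := η.2
  obtain ⟨Y, -, hY⟩ := ξ.2
  obtain ⟨Z, -, hZ⟩ := ζ.2
  obtain ⟨f, hf⟩ := h.exists_hom hX hY
  obtain ⟨g, hg⟩ := h'.exists_hom hZ hY
  have := hf.isIso_zero
  obtain ⟨p, hp, hp'⟩ := h𝒳.exists_hom_of_pullback hn (h𝒳.mem_of_eq η hX) (h𝒳.mem_of_eq ξ hY) f g
    (eqToHom Z.right ≫ d ≫ eqToHom X.right.symm) (by simp [hf.2, hg.2])
  refine ⟨Z, X, p, hZ, hX, ?_, hp⟩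
  rw [← cancel_mono (f.f 0), hp', hg.1, hf.1]
  simp

/-- The universal property yields a morphism back, and an endomorphism that is the identity in
degree `0` is homotopic to the identity by the comparison principle. -/
lemma eq {ξ η : YonedaExt n 𝒳 A C} (h : ExtHom (𝟙 A) (𝟙 C) ξ η) : ξ = η := by
  obtain ⟨X, -, hX⟩ := ξ.2
  obtain ⟨Y, -, hY⟩ := η.2
  obtain ⟨f, hf⟩ := h.exists_hom hX hY
  obtain ⟨g, hg⟩ := (h.desc h𝒳 hn (by simpa using refl ξ) : ExtHom _ _ η ξ).exists_hom hY hX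
  have key : ∀ {X : EndComplex n A C}, 𝒳 X.K → ∀ k : X.K ⟶ X.K, HasEnds k (𝟙 A) (𝟙 C) →
      Nonempty (Homotopy k (𝟙 X.K)) := fun {X} hX k hk => by
    obtain ⟨l, -, hl⟩ := (h𝒳.isNExact _ hX).2.exists_nullMap (k - 𝟙 X.K) 0 (by simp [hk.1])
    exact nonempty_homotopy hl
  apply Subtype.ext
  rw [hX, hY, htpyClass_eq_iff]
  exact ⟨f, g, hf, hg, key (h𝒳.mem_of_eq ξ hX) _ (by simpa using hf.comp hg),
    key (h𝒳.mem_of_eq η hY) _ (by simpa using hg.comp hf)⟩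

end ExtHom

lemma exists_extHom_left (a : A ⟶ B) (ξ : YonedaExt n 𝒳 A C) :
    ∃ η : YonedaExt n 𝒳 B C, ExtHom a (𝟙 C) ξ η := by
  obtain ⟨X, hX, hX'⟩ := ξ.2
  obtain ⟨Y, q, e, hY, hq, hq'⟩ := h𝒳.exists_pushout hn hX (eqToHom X.left ≫ a)
  obtain ⟨Z, φ, hk, hl, hk', hl'⟩ := exists_iso_replace Y (show 0 ≠ n + 1 by omega) e
    ((asIso (q.f (n + 1))).symm ≪≫ eqToIso X.right)
  have hYe := h𝒳.isNExact Y hY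
  have hZc : IsNComplex n Z := fun i hi =>
    (hYe.1.isNComplex i hi).of_iso (HomologicalComplex.Hom.isoApp φ.symm i)
  have e : 𝟙 Z - φ.inv ≫ φ.hom = nullMap 0 := by
    rw [φ.inv_hom_id, sub_self]
    exact eq_nullMap (by simp) (by simp)
  have hZ : 𝒳 Z := (h𝒳.closed_ends Y Z φ.hom hYe
    ⟨hYe.1.of_nullMap hZc φ.hom φ.inv e, hYe.2.of_nullMap hZc φ.hom φ.inv e⟩
    inferInstance inferInstance).mp hY
  refine ⟨YonedaExt.mk ⟨Z, hZc, hk, hl⟩ hZ, X, ⟨Z, hZc, hk, hl⟩, q ≫ φ.hom, hX', rfl, ?_, ?_⟩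
  · rw [← cancel_mono (eqToHom hk)]
    simp [hk', hq']
  · rw [← cancel_mono (eqToHom hl)]
    simp [hl']

lemma exists_extHom_right (c : D ⟶ C) (ξ : YonedaExt n 𝒳 A C) :
    ∃ η : YonedaExt n 𝒳 A D, ExtHom (𝟙 A) c η ξ := by
  obtain ⟨X, hX, hX'⟩ := ξ.2
  obtain ⟨Y, q, e, hY, hq, hq'⟩ := h𝒳.exists_pullback hn hX (c ≫ eqToHom X.right.symm)
  obtain ⟨Z, φ, hk, hl, hk', hl'⟩ := exists_iso_replace Y (show 0 ≠ n + 1 by omega)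
    (asIso (q.f 0) ≪≫ eqToIso X.left) e
  have hYe := h𝒳.isNExact Y hY
  have hZc : IsNComplex n Z := fun i hi =>
    (hYe.1.isNComplex i hi).of_iso (HomologicalComplex.Hom.isoApp φ.symm i)
  have e : 𝟙 Z - φ.inv ≫ φ.hom = nullMap 0 := by
    rw [φ.inv_hom_id, sub_self]
    exact eq_nullMap (by simp) (by simp)
  have hZ : 𝒳 Z := (h𝒳.closed_ends Y Z φ.hom hYe
    ⟨hYe.1.of_nullMap hZc φ.hom φ.inv e, hYe.2.of_nullMap hZc φ.hom φ.inv e⟩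
    inferInstance inferInstance).mp hY
  refine ⟨YonedaExt.mk ⟨Z, hZc, hk, hl⟩ hZ, ⟨Z, hZc, hk, hl⟩, X, φ.inv ≫ q, rfl, hX', ?_, ?_⟩
  · rw [← cancel_epi (φ.hom.f 0), ← cancel_mono (eqToHom X.left)]
    simpa using hk'.symm
  · rw [← cancel_epi (φ.hom.f (n + 1))]
    simp [reassoc_of% hl', hq']

end

variable [HasZeroObject 𝒞] [HasBinaryBiproducts 𝒞] (h𝒳 : IsNExactCategory n 𝒳) (hn : 1 ≤ n)
  {A B C D A' C' : 𝒞}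

/-- The extension `a_* ξ`. -/
noncomputable def pushExt (a : A ⟶ B) (ξ : YonedaExt n 𝒳 A C) : YonedaExt n 𝒳 B C :=
  (exists_extHom_left h𝒳 hn a ξ).choose

/-- The extension `c^* ξ`. -/
noncomputable def pullExt (c : D ⟶ C) (ξ : YonedaExt n 𝒳 A C) : YonedaExt n 𝒳 A D :=
  (exists_extHom_right h𝒳 hn c ξ).choose

lemma extHom_pushExt (a : A ⟶ B) (ξ : YonedaExt n 𝒳 A C) :
    ExtHom a (𝟙 C) ξ (pushExt h𝒳 hn a ξ) :=
  (exists_extHom_left h𝒳 hn a ξ).choose_spec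

lemma extHom_pullExt (c : D ⟶ C) (ξ : YonedaExt n 𝒳 A C) :
    ExtHom (𝟙 A) c (pullExt h𝒳 hn c ξ) ξ :=
  (exists_extHom_right h𝒳 hn c ξ).choose_spec

/-- A morphism with ends `a` and `c` factors first through `a_* ξ` and then through `c^* η`, leaving
a morphism with identity ends between the two. -/
lemma pushExt_eq_pullExt_iff {a : A ⟶ B} {c : C ⟶ D} {ξ : YonedaExt n 𝒳 A C}
    {η : YonedaExt n 𝒳 B D} : pushExt h𝒳 hn a ξ = pullExt h𝒳 hn c η ↔ ExtHom a c ξ η := by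
  constructor
  · intro h
    have := (extHom_pushExt h𝒳 hn a ξ).comp (h ▸ extHom_pullExt h𝒳 hn c η)
    simpa using this
  · intro h
    have h' : ExtHom (𝟙 B) c (pushExt h𝒳 hn a ξ) η :=
      (extHom_pushExt h𝒳 hn a ξ).desc h𝒳 hn (by simpa using h)
    exact ((extHom_pullExt h𝒳 hn c η).lift h𝒳 hn (by simpa using h')).eq h𝒳 hn

lemma pushExt_eq_iff {a : A ⟶ B} {ξ : YonedaExt n 𝒳 A C} {η : YonedaExt n 𝒳 B C} :
    pushExt h𝒳 hn a ξ = η ↔ ExtHom a (𝟙 C) ξ η := by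
  constructor
  · rintro rfl
    exact extHom_pushExt h𝒳 hn a ξ
  · intro h
    exact ((extHom_pushExt h𝒳 hn a ξ).desc h𝒳 hn (by simpa using h)).eq h𝒳 hn

lemma pullExt_eq_iff {c : D ⟶ C} {ξ : YonedaExt n 𝒳 A C} {η : YonedaExt n 𝒳 A D} :
    pullExt h𝒳 hn c ξ = η ↔ ExtHom (𝟙 A) c η ξ := by
  constructor
  · rintro rfl
    exact extHom_pullExt h𝒳 hn c ξ
  · intro h
    exact (((extHom_pullExt h𝒳 hn c ξ).lift h𝒳 hn (by simpa using h)).eq h𝒳 hn).symm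

lemma pushExt_id (ξ : YonedaExt n 𝒳 A C) : pushExt h𝒳 hn (𝟙 A) ξ = ξ :=
  (pushExt_eq_iff h𝒳 hn).mpr (ExtHom.refl ξ)

lemma pullExt_id (ξ : YonedaExt n 𝒳 A C) : pullExt h𝒳 hn (𝟙 C) ξ = ξ :=
  (pullExt_eq_iff h𝒳 hn).mpr (ExtHom.refl ξ)

lemma pushExt_comp (a : A ⟶ B) (b : B ⟶ A') (ξ : YonedaExt n 𝒳 A C) :
    pushExt h𝒳 hn (a ≫ b) ξ = pushExt h𝒳 hn b (pushExt h𝒳 hn a ξ) :=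
  (pushExt_eq_iff h𝒳 hn).mpr (by
    simpa using (extHom_pushExt h𝒳 hn a ξ).comp (extHom_pushExt h𝒳 hn b _))

lemma pullExt_comp (c : D ⟶ C) (d : C' ⟶ D) (ξ : YonedaExt n 𝒳 A C) :
    pullExt h𝒳 hn (d ≫ c) ξ = pullExt h𝒳 hn d (pullExt h𝒳 hn c ξ) :=
  (pullExt_eq_iff h𝒳 hn).mpr (by
    simpa using (extHom_pullExt h𝒳 hn d _).comp (extHom_pullExt h𝒳 hn c ξ))

lemma pushExt_pullExt (a : A ⟶ B) (c : D ⟶ C) (ξ : YonedaExt n 𝒳 A C) :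
    pushExt h𝒳 hn a (pullExt h𝒳 hn c ξ) = pullExt h𝒳 hn c (pushExt h𝒳 hn a ξ) :=
  (pushExt_eq_pullExt_iff h𝒳 hn).mpr (by
    simpa using (extHom_pullExt h𝒳 hn c ξ).comp (extHom_pushExt h𝒳 hn a ξ))

include h𝒳 hn in
-- One class serves all representatives: comparison maps of the summands give one of the direct sums
-- with identity ends.
lemma exists_sumExt (ξ : YonedaExt n 𝒳 A C) (η : YonedaExt n 𝒳 B D) :
    ∃ σ : YonedaExt n 𝒳 (A ⊞ B) (C ⊞ D), ∀ X Y, ξ.1 = htpyClass X → η.1 = htpyClass Y →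
      σ.1 = htpyClass (X.sum Y) := by
  obtain ⟨X, hX, hX'⟩ := ξ.2
  obtain ⟨Y, hY, hY'⟩ := η.2
  have m : ∀ (X : EndComplex n A C) (Y : EndComplex n B D), 𝒳 X.K → 𝒳 Y.K → 𝒳 (X.sum Y).K :=
    fun X Y hX hY => h𝒳.directSum_mem hn hX hY
  refine ⟨YonedaExt.mk (X.sum Y) (m _ _ hX hY), fun X₁ Y₁ h₁ h₂ => ?_⟩
  have h₁' := h𝒳.mem_of_eq ξ h₁
  have h₂' := h𝒳.mem_of_eq η h₂
  obtain ⟨f, -, hf, -⟩ := htpyClass_eq_iff.mp (hX'.symm.trans h₁)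
  obtain ⟨g, -, hg, -⟩ := htpyClass_eq_iff.mp (hY'.symm.trans h₂)
  obtain ⟨k, hk⟩ := ((hasEnds_fst X Y).comp hf).exists_lift ((hasEnds_snd X Y).comp hg)
  have : ExtHom (𝟙 _) (𝟙 _) (YonedaExt.mk (X.sum Y) (m _ _ hX hY))
      (YonedaExt.mk (X₁.sum Y₁) (m _ _ h₁' h₂')) := by
    refine ⟨_, _, k, rfl, rfl, ?_⟩
    convert hk using 1 <;> apply biprod.hom_ext <;> simp
  exact congrArg Subtype.val (this.eq h𝒳 hn)

/-- The extension `[X ⊕ Y]` for `ξ = [X]` and `η = [Y]`. -/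
noncomputable def sumExt (ξ : YonedaExt n 𝒳 A C) (η : YonedaExt n 𝒳 B D) :
    YonedaExt n 𝒳 (A ⊞ B) (C ⊞ D) :=
  (exists_sumExt h𝒳 hn ξ η).choose

lemma sumExt_eq (ξ : YonedaExt n 𝒳 A C) (η : YonedaExt n 𝒳 B D) {X : EndComplex n A C}
    {Y : EndComplex n B D} (hX : ξ.1 = htpyClass X) (hY : η.1 = htpyClass Y) :
    (sumExt h𝒳 hn ξ η).1 = htpyClass (X.sum Y) :=
  (exists_sumExt h𝒳 hn ξ η).choose_spec X Y hX hY

lemma ExtHom.lift_sumExt {a : A' ⟶ A} {c : C' ⟶ C} {b : A' ⟶ B} {d : C' ⟶ D}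
    {ζ : YonedaExt n 𝒳 A' C'} {ξ : YonedaExt n 𝒳 A C} {η : YonedaExt n 𝒳 B D}
    (h : ExtHom a c ζ ξ) (h' : ExtHom b d ζ η) :
    ExtHom (biprod.lift a b) (biprod.lift c d) ζ (sumExt h𝒳 hn ξ η) := by
  obtain ⟨X, -, hX⟩ := ξ.2
  obtain ⟨Y, -, hY⟩ := η.2
  obtain ⟨Z, -, hZ⟩ := ζ.2
  obtain ⟨f, hf⟩ := h.exists_hom hZ hX
  obtain ⟨g, hg⟩ := h'.exists_hom hZ hY
  obtain ⟨k, hk⟩ := hf.exists_lift hg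
  exact ⟨Z, X.sum Y, k, hZ, sumExt_eq h𝒳 hn ξ η hX hY, hk⟩

lemma ExtHom.desc_sumExt {a : A ⟶ A'} {c : C ⟶ C'} {b : B ⟶ A'} {d : D ⟶ C'}
    {ζ : YonedaExt n 𝒳 A' C'} {ξ : YonedaExt n 𝒳 A C} {η : YonedaExt n 𝒳 B D}
    (h : ExtHom a c ξ ζ) (h' : ExtHom b d η ζ) :
    ExtHom (biprod.desc a b) (biprod.desc c d) (sumExt h𝒳 hn ξ η) ζ := by
  obtain ⟨X, -, hX⟩ := ξ.2
  obtain ⟨Y, -, hY⟩ := η.2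
  obtain ⟨Z, -, hZ⟩ := ζ.2
  obtain ⟨f, hf⟩ := h.exists_hom hX hZ
  obtain ⟨g, hg⟩ := h'.exists_hom hY hZ
  obtain ⟨k, hk⟩ := hf.exists_desc hg
  exact ⟨X.sum Y, Z, k, sumExt_eq h𝒳 hn ξ η hX hY, hZ, hk⟩

lemma extHom_fst (ξ : YonedaExt n 𝒳 A C) (η : YonedaExt n 𝒳 B D) :
    ExtHom biprod.fst biprod.fst (sumExt h𝒳 hn ξ η) ξ := by
  obtain ⟨X, -, hX⟩ := ξ.2
  obtain ⟨Y, -, hY⟩ := η.2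
  exact ⟨X.sum Y, X, _, sumExt_eq h𝒳 hn ξ η hX hY, hX, hasEnds_fst X Y⟩

lemma extHom_snd (ξ : YonedaExt n 𝒳 A C) (η : YonedaExt n 𝒳 B D) :
    ExtHom biprod.snd biprod.snd (sumExt h𝒳 hn ξ η) η := by
  obtain ⟨X, -, hX⟩ := ξ.2
  obtain ⟨Y, -, hY⟩ := η.2
  exact ⟨X.sum Y, Y, _, sumExt_eq h𝒳 hn ξ η hX hY, hY, hasEnds_snd X Y⟩

end Extensions

/-! ### The group structure -/

section BaerSum

open EndComplex

open scoped ZeroObject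

variable {𝒞 : Type u} [Category.{v} 𝒞] [Preadditive 𝒞] [HasZeroObject 𝒞] [HasBinaryBiproducts 𝒞]
  {n : ℕ} {𝒳 : CochainComplex 𝒞 ℕ → Prop} (h𝒳 : IsNExactCategory n 𝒳) (hn : 1 ≤ n)
  {A B C D : 𝒞}

/-- The Baer sum. -/
noncomputable def addExt (ξ η : YonedaExt n 𝒳 A C) : YonedaExt n 𝒳 A C :=
  pullExt h𝒳 hn (biprod.lift (𝟙 C) (𝟙 C))
    (pushExt h𝒳 hn (biprod.desc (𝟙 A) (𝟙 A)) (sumExt h𝒳 hn ξ η))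

/-- The maps from `ξ` to `a_* ξ` and `b_* ξ` combine to one into their direct sum, with ends `(a,
b)` and the diagonal; the codiagonal then turns `(a, b)` into `a + b`. -/
lemma addExt_pushExt (a b : A ⟶ B) (ξ : YonedaExt n 𝒳 A C) :
    addExt h𝒳 hn (pushExt h𝒳 hn a ξ) (pushExt h𝒳 hn b ξ) = pushExt h𝒳 hn (a + b) ξ := by
  have h := ((extHom_pushExt h𝒳 hn a ξ).lift_sumExt h𝒳 hn (extHom_pushExt h𝒳 hn b ξ)).comp
    (extHom_pushExt h𝒳 hn (biprod.desc (𝟙 B) (𝟙 B)) _)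
  exact ((pushExt_eq_pullExt_iff h𝒳 hn).mpr (by simpa using h)).symm

lemma addExt_pullExt (c d : D ⟶ C) (ξ : YonedaExt n 𝒳 A C) :
    addExt h𝒳 hn (pullExt h𝒳 hn c ξ) (pullExt h𝒳 hn d ξ) = pullExt h𝒳 hn (c + d) ξ := by
  have h := (extHom_pullExt h𝒳 hn c ξ).desc_sumExt h𝒳 hn (extHom_pullExt h𝒳 hn d ξ)
  rw [addExt, (pushExt_eq_pullExt_iff h𝒳 hn).mpr h, ← pullExt_comp]
  simp

/-- The class is the pullback of the direct sum along the diagonal of `C`. Writing several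
extensions as images of a single one reduces identities for the Baer sum to identities between
morphisms. -/
lemma exists_pushExt_fst_snd (ξ : YonedaExt n 𝒳 A C) (η : YonedaExt n 𝒳 B C) :
    ∃ ζ : YonedaExt n 𝒳 (A ⊞ B) C, pushExt h𝒳 hn biprod.fst ζ = ξ ∧
      pushExt h𝒳 hn biprod.snd ζ = η := by
  refine ⟨pullExt h𝒳 hn (biprod.lift (𝟙 C) (𝟙 C)) (sumExt h𝒳 hn ξ η), ?_, ?_⟩
  · rw [pushExt_pullExt, (pushExt_eq_pullExt_iff h𝒳 hn).mpr (extHom_fst h𝒳 hn ξ η),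
      ← pullExt_comp, biprod.lift_fst, pullExt_id]
  · rw [pushExt_pullExt, (pushExt_eq_pullExt_iff h𝒳 hn).mpr (extHom_snd h𝒳 hn ξ η),
      ← pullExt_comp, biprod.lift_snd, pullExt_id]

include hn h𝒳 in
-- The two projections `A ⊞ A ⟶ A` agree, and they send a common class to `ξ` and to `η`.
lemma yonedaExt_subsingleton (hA : IsZero A) (ξ η : YonedaExt n 𝒳 A C) : ξ = η := by
  obtain ⟨ζ, rfl, rfl⟩ := exists_pushExt_fst_snd h𝒳 hn ξ η
  rw [hA.eq_of_tgt biprod.fst biprod.snd]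

/-- The class of the zero sequence. -/
noncomputable def zeroSequence :
    YonedaExt n 𝒳 ((0 : CochainComplex 𝒞 ℕ).X 0) ((0 : CochainComplex 𝒞 ℕ).X (n + 1)) :=
  YonedaExt.mk (ofComplex n 0 fun i _ =>
    (HomologicalComplex.eval 𝒞 (ComplexShape.up ℕ) i).map_isZero (isZero_zero _))
    (h𝒳.zero _ (isZero_zero _))

/-- The class of the split sequences. -/
noncomputable def zeroExt (A C : 𝒞) : YonedaExt n 𝒳 A C :=
  pushExt h𝒳 hn 0 (pullExt h𝒳 hn 0 (zeroSequence h𝒳))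

/-- The zero morphism factors through a zero object, over which there is only one class. -/
lemma pushExt_zero (ξ : YonedaExt n 𝒳 A C) :
    pushExt h𝒳 hn (0 : A ⟶ B) ξ = zeroExt h𝒳 hn B C := by
  have h : IsZero ((0 : CochainComplex 𝒞 ℕ).X 0) :=
    (HomologicalComplex.eval 𝒞 (ComplexShape.up ℕ) 0).map_isZero (isZero_zero _)
  rw [← zero_comp (Y := (0 : CochainComplex 𝒞 ℕ).X 0) (f := (0 : _ ⟶ B)), pushExt_comp, zeroExt,
    yonedaExt_subsingleton h𝒳 hn h (pushExt h𝒳 hn 0 ξ) _]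

lemma addExt_assoc (ξ η ζ : YonedaExt n 𝒳 A C) :
    addExt h𝒳 hn (addExt h𝒳 hn ξ η) ζ = addExt h𝒳 hn ξ (addExt h𝒳 hn η ζ) := by
  obtain ⟨θ, rfl, rfl⟩ := exists_pushExt_fst_snd h𝒳 hn ξ η
  obtain ⟨κ, rfl, rfl⟩ := exists_pushExt_fst_snd h𝒳 hn θ ζ
  simp only [← pushExt_comp, addExt_pushExt, add_assoc]

lemma addExt_comm (ξ η : YonedaExt n 𝒳 A C) :
    addExt h𝒳 hn ξ η = addExt h𝒳 hn η ξ := by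
  obtain ⟨θ, rfl, rfl⟩ := exists_pushExt_fst_snd h𝒳 hn ξ η
  rw [addExt_pushExt, addExt_pushExt, add_comm]

lemma zeroExt_addExt (ξ : YonedaExt n 𝒳 A C) : addExt h𝒳 hn (zeroExt h𝒳 hn A C) ξ = ξ := by
  have h := addExt_pushExt h𝒳 hn 0 (𝟙 A) ξ
  rwa [zero_add, pushExt_id, pushExt_zero] at h

lemma neg_addExt (ξ : YonedaExt n 𝒳 A C) :
    addExt h𝒳 hn (pushExt h𝒳 hn (-𝟙 A) ξ) ξ = zeroExt h𝒳 hn A C := by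
  have h := addExt_pushExt h𝒳 hn (-𝟙 A) (𝟙 A) ξ
  rwa [neg_add_cancel, pushExt_id, pushExt_zero] at h

variable (A C) in
/-- The group of Yoneda extensions of `C` by `A`. -/
@[nolint unusedArguments]
def ExtGroup (_ : IsNExactCategory n 𝒳) (_ : 1 ≤ n) : Type (max u v) :=
  YonedaExt n 𝒳 A C

noncomputable instance : AddCommGroup (ExtGroup A C h𝒳 hn) where
  add := addExt h𝒳 hn
  zero := zeroExt h𝒳 hn A C
  neg := pushExt h𝒳 hn (-𝟙 A)
  add_assoc := addExt_assoc h𝒳 hn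
  zero_add := zeroExt_addExt h𝒳 hn
  add_zero ξ := (addExt_comm h𝒳 hn ξ _).trans (zeroExt_addExt h𝒳 hn ξ)
  neg_add_cancel := neg_addExt h𝒳 hn
  add_comm := addExt_comm h𝒳 hn
  nsmul := @nsmulRec _ ⟨zeroExt h𝒳 hn A C⟩ ⟨addExt h𝒳 hn⟩
  zsmul := @zsmulRec _ ⟨zeroExt h𝒳 hn A C⟩ ⟨addExt h𝒳 hn⟩ ⟨pushExt h𝒳 hn (-𝟙 A)⟩
    (@nsmulRec _ ⟨zeroExt h𝒳 hn A C⟩ ⟨addExt h𝒳 hn⟩)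

/-- The homomorphism `a_*`. -/
noncomputable def pushHom (a : A ⟶ B) : ExtGroup A C h𝒳 hn →+ ExtGroup B C h𝒳 hn :=
  AddMonoidHom.mk' (pushExt h𝒳 hn a) fun ξ η => by
    change pushExt h𝒳 hn a (addExt h𝒳 hn ξ η) =
      addExt h𝒳 hn (pushExt h𝒳 hn a ξ) (pushExt h𝒳 hn a η)
    obtain ⟨θ, rfl, rfl⟩ := exists_pushExt_fst_snd h𝒳 hn ξ η
    simp only [← pushExt_comp, addExt_pushExt, Preadditive.add_comp]

/-- The homomorphism `c^*`. -/
noncomputable def pullHom (c : D ⟶ C) : ExtGroup A C h𝒳 hn →+ ExtGroup A D h𝒳 hn :=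
  AddMonoidHom.mk' (pullExt h𝒳 hn c) fun ξ η => by
    change pullExt h𝒳 hn c (addExt h𝒳 hn ξ η) =
      addExt h𝒳 hn (pullExt h𝒳 hn c ξ) (pullExt h𝒳 hn c η)
    obtain ⟨θ, rfl, rfl⟩ := exists_pushExt_fst_snd h𝒳 hn ξ η
    simp only [← pushExt_pullExt, addExt_pushExt]

/-- `0^* ξ` is idempotent for the addition because `0 + 0 = 0`, and a group has only one idempotent.
-/
lemma pullExt_zero (ξ : YonedaExt n 𝒳 A C) :
    pullExt h𝒳 hn (0 : D ⟶ C) ξ = zeroExt h𝒳 hn A D := by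
  have h := addExt_pullExt h𝒳 hn (0 : D ⟶ C) 0 ξ
  rw [add_zero] at h
  exact add_eq_left (M := ExtGroup A D h𝒳 hn).mp h

/-- The zero class is its own image under `0_*`, so the equation asks for a morphism from a
representative of the zero class to `X` with ends `0` and `g`. As it vanishes in degree `0`, it is
null-homotopic with `h⁰ = 0`, and its last component factors through `d_Xⁿ`. -/
lemma pullExt_eq_zeroExt_iff {X : CochainComplex 𝒞 ℕ} (hX : IsNComplex n X)
    {ξ : YonedaExt n 𝒳 (X.X 0) (X.X (n + 1))} (hξ : ξ.1 = htpyClass (ofComplex n X hX))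
    (g : D ⟶ X.X (n + 1)) :
    pullExt h𝒳 hn g ξ = zeroExt h𝒳 hn _ D ↔ ∃ h : D ⟶ X.X n, h ≫ X.d n (n + 1) = g := by
  rw [← pushExt_zero h𝒳 hn (zeroExt h𝒳 hn (X.X 0) D), eq_comm, pushExt_eq_pullExt_iff]
  obtain ⟨Y, hY, hY'⟩ := (zeroExt h𝒳 hn (X.X 0) D).2
  constructor
  · intro h
    obtain ⟨f, hf⟩ := h.exists_hom hY' hξ
    have hf' : f.f (n + 1) = eqToHom Y.right ≫ g :=
      hf.2.trans (congrArg (eqToHom Y.right ≫ ·) (Category.comp_id g))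
    obtain ⟨k, -, hk⟩ := (h𝒳.isNExact _ hY).2.exists_nullMap (Y := X) f 0 (by simp [hf.1]; rfl)
    rw [hk, nullMap_last Y.isNComplex] at hf'
    exact ⟨eqToHom Y.right.symm ≫ k n, by simp [hf']⟩
  · rintro ⟨h, rfl⟩
    refine ⟨Y, _, singleNullMap n (eqToHom Y.right ≫ h), hY', hξ, ?_, ?_⟩
    · rw [singleNullMap_of_ne _ _ _ (by omega) (by omega)]
      simp
    · rw [singleNullMap_succ]
      simp [ofComplex]

lemma pushExt_eq_zeroExt_iff {X : CochainComplex 𝒞 ℕ} (hX : IsNComplex n X)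
    {ξ : YonedaExt n 𝒳 (X.X 0) (X.X (n + 1))} (hξ : ξ.1 = htpyClass (ofComplex n X hX))
    (g : X.X 0 ⟶ B) :
    pushExt h𝒳 hn g ξ = zeroExt h𝒳 hn B _ ↔ ∃ h : X.X 1 ⟶ B, X.d 0 1 ≫ h = g := by
  rw [← pullExt_zero h𝒳 hn (zeroExt h𝒳 hn B (X.X (n + 1))), pushExt_eq_pullExt_iff]
  obtain ⟨Y, hY, hY'⟩ := (zeroExt h𝒳 hn B (X.X (n + 1))).2
  constructor
  · intro h
    obtain ⟨f, hf⟩ := h.exists_hom hξ hY'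
    have hf' : f.f 0 = g ≫ eqToHom Y.left.symm := hf.1.trans (Category.id_comp _)
    obtain ⟨k, -, hk⟩ := (h𝒳.isNExact _ hY).1.exists_nullMap (X := X) f 0 (by simp [hf.2]; rfl)
    rw [hk, nullMap_zero] at hf'
    exact ⟨k 0 ≫ eqToHom Y.left, by simp [reassoc_of% hf']⟩
  · rintro ⟨h, rfl⟩
    refine ⟨_, Y, singleNullMap 0 (h ≫ eqToHom Y.left.symm), hξ, hY', ?_, ?_⟩
    · rw [singleNullMap_self]
      exact (by simp : X.d 0 1 ≫ h ≫ eqToHom Y.left.symm =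
        𝟙 _ ≫ (X.d 0 1 ≫ h) ≫ eqToHom Y.left.symm)
    · rw [singleNullMap_of_ne _ _ _ (by omega) (by omega)]
      simp

end BaerSum

/-! ### The bifunctor of Yoneda extensions -/

section Bifunctor

variable {𝒞 : Type u} [Category.{v} 𝒞] [Preadditive 𝒞] [HasZeroObject 𝒞] [HasBinaryBiproducts 𝒞]
  {n : ℕ} {𝒳 : CochainComplex 𝒞 ℕ → Prop} (h𝒳 : IsNExactCategory n 𝒳) (hn : 1 ≤ n)
  [∀ A C : 𝒞, Small.{w} (ExtGroup A C h𝒳 hn)]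

/-- A homomorphism between groups of extensions, in the universe `w`. -/
noncomputable def shrinkHom {A B C D : 𝒞} (φ : ExtGroup A C h𝒳 hn →+ ExtGroup B D h𝒳 hn) :
    AddCommGrpCat.of (Shrink.{w} (ExtGroup A C h𝒳 hn)) ⟶
      AddCommGrpCat.of (Shrink.{w} (ExtGroup B D h𝒳 hn)) :=
  AddCommGrpCat.ofHom ((Shrink.addEquiv.symm.toAddMonoidHom.comp φ).comp
    Shrink.addEquiv.toAddMonoidHom)

lemma equivShrink_symm_shrinkHom {A B C D : 𝒞}
    (φ : ExtGroup A C h𝒳 hn →+ ExtGroup B D h𝒳 hn) (x : Shrink.{w} (ExtGroup A C h𝒳 hn)) :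
    (equivShrink (ExtGroup B D h𝒳 hn)).symm ((shrinkHom h𝒳 hn φ).hom x) =
      φ ((equivShrink (ExtGroup A C h𝒳 hn)).symm x) :=
  (equivShrink (ExtGroup B D h𝒳 hn)).symm_apply_apply _

lemma shrinkHom_id (A C : 𝒞) :
    shrinkHom.{w} h𝒳 hn (AddMonoidHom.id (ExtGroup A C h𝒳 hn)) = 𝟙 _ := by
  ext x
  rw [equivShrink_symm_shrinkHom]
  rfl

lemma shrinkHom_comp {A B C D A' C' : 𝒞} (φ : ExtGroup A C h𝒳 hn →+ ExtGroup B D h𝒳 hn)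
    (ψ : ExtGroup B D h𝒳 hn →+ ExtGroup A' C' h𝒳 hn) :
    shrinkHom.{w} h𝒳 hn (ψ.comp φ) = shrinkHom h𝒳 hn φ ≫ shrinkHom h𝒳 hn ψ := by
  ext x
  change (equivShrink _).symm _ = (equivShrink _).symm ((shrinkHom h𝒳 hn ψ).hom _)
  rw [equivShrink_symm_shrinkHom, equivShrink_symm_shrinkHom]
  exact congrArg ψ (equivShrink_symm_shrinkHom h𝒳 hn φ x).symm

/-- The bifunctor of Yoneda extensions. -/
noncomputable def yonedaBifunctor : 𝒞ᵒᵖ ⥤ 𝒞 ⥤ AddCommGrpCat.{w} where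
  obj C :=
    { obj A := AddCommGrpCat.of (Shrink.{w} (ExtGroup A C.unop h𝒳 hn))
      map a := shrinkHom h𝒳 hn (pushHom h𝒳 hn a)
      map_id A := by
        rw [← shrinkHom_id]
        exact congrArg _ (AddMonoidHom.ext (pushExt_id h𝒳 hn))
      map_comp a b := by
        rw [← shrinkHom_comp]
        exact congrArg _ (AddMonoidHom.ext (pushExt_comp h𝒳 hn a b)) }
  map c :=
    { app A := shrinkHom h𝒳 hn (pullHom h𝒳 hn c.unop)
      naturality A B a := by
        rw [← shrinkHom_comp, ← shrinkHom_comp]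
        exact congrArg _ (AddMonoidHom.ext fun ξ => (pushExt_pullExt h𝒳 hn a c.unop ξ).symm) }
  map_id C := by
    ext1; ext1 A
    refine Eq.trans ?_ (shrinkHom_id h𝒳 hn A C.unop)
    exact congrArg (shrinkHom h𝒳 hn) (AddMonoidHom.ext (pullExt_id h𝒳 hn))
  map_comp c d := by
    ext1; ext1 A
    refine Eq.trans ?_ (shrinkHom_comp h𝒳 hn (pullHom h𝒳 hn c.unop) (pullHom h𝒳 hn d.unop))
    exact congrArg (shrinkHom h𝒳 hn) (AddMonoidHom.ext (pullExt_comp h𝒳 hn c.unop d.unop))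

/-- The elements of the group of extensions are the classes of sequences. -/
noncomputable def yonedaEquiv (A C : 𝒞) :
    Extn (yonedaBifunctor.{w} h𝒳 hn) C A ≃ YonedaExt n 𝒳 A C :=
  (equivShrink.{w} (ExtGroup A C h𝒳 hn)).symm

lemma yonedaEquiv_push {A B C : 𝒞} (a : A ⟶ B) (δ : Extn (yonedaBifunctor.{w} h𝒳 hn) C A) :
    yonedaEquiv h𝒳 hn B C (push _ a δ) = pushExt h𝒳 hn a (yonedaEquiv h𝒳 hn A C δ) :=
  equivShrink_symm_shrinkHom h𝒳 hn _ _

lemma yonedaEquiv_pull {A C D : 𝒞} (c : D ⟶ C) (δ : Extn (yonedaBifunctor.{w} h𝒳 hn) C A) :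
    yonedaEquiv h𝒳 hn A D (pull _ c δ) = pullExt h𝒳 hn c (yonedaEquiv h𝒳 hn A C δ) :=
  equivShrink_symm_shrinkHom h𝒳 hn _ _

lemma yonedaEquiv_add {A C : 𝒞} (δ ρ : Extn (yonedaBifunctor.{w} h𝒳 hn) C A) :
    yonedaEquiv h𝒳 hn A C (δ + ρ) =
      addExt h𝒳 hn (yonedaEquiv h𝒳 hn A C δ) (yonedaEquiv h𝒳 hn A C ρ) :=
  equivShrink_symm_add (α := ExtGroup A C h𝒳 hn) δ ρ

lemma yonedaEquiv_zero (A C : 𝒞) :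
    yonedaEquiv h𝒳 hn A C (0 : Extn (yonedaBifunctor.{w} h𝒳 hn) C A) = zeroExt h𝒳 hn A C :=
  equivShrink_symm_zero (α := ExtGroup A C h𝒳 hn)

lemma isBiadditive_yonedaBifunctor : IsBiadditive (yonedaBifunctor.{w} h𝒳 hn) where
  push_add a a' δ := (yonedaEquiv h𝒳 hn _ _).injective (by
    simp only [yonedaEquiv_push, yonedaEquiv_add, addExt_pushExt])
  pull_add c c' δ := (yonedaEquiv h𝒳 hn _ _).injective (by
    simp only [yonedaEquiv_pull, yonedaEquiv_add, addExt_pullExt])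

/-- A morphism with an identity end already determines the pulled back or pushed out class; its cone
or cocone then has the required exactness. -/
lemma isYonedaBifunctor_yonedaBifunctor :
    IsYonedaBifunctor n 𝒳 (yonedaBifunctor.{w} h𝒳 hn) (yonedaEquiv h𝒳 hn) where
  pull_iff {A C D} c ξ η Y hY := by
    rw [← (yonedaEquiv h𝒳 hn A D).apply_eq_iff_eq, yonedaEquiv_pull, pullExt_eq_iff]
    constructor
    · intro h
      obtain ⟨X, hX, hX'⟩ := (yonedaEquiv h𝒳 hn A D η).2
      obtain ⟨f, hf⟩ := h.exists_hom hX' hY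
      have := hf.isIso_zero
      exact ⟨X, f, hX', hf, h𝒳.isNKernel_mappingCone hn hX (h𝒳.mem_of_eq _ hY) f⟩
    · rintro ⟨X, f, hX, hf, -⟩
      exact ⟨X, Y, f, hX, hY, hf⟩
  push_iff {A B C} a ξ η X hX := by
    rw [← (yonedaEquiv h𝒳 hn B C).apply_eq_iff_eq, yonedaEquiv_push, pushExt_eq_iff]
    constructor
    · intro h
      obtain ⟨Y, hY, hY'⟩ := (yonedaEquiv h𝒳 hn B C η).2
      obtain ⟨f, hf⟩ := h.exists_hom hX hY'
      have := hf.isIso_last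
      exact ⟨Y, f, hY', hf, h𝒳.isNCokernel_mappingCocone hn (h𝒳.mem_of_eq _ hX) hY f⟩
    · rintro ⟨Y, f, hY, hf, -⟩
      exact ⟨X, Y, f, hX, hY, hf⟩
  baer_sum {A C} ξ η X Y hX hY := by
    refine ⟨(yonedaEquiv h𝒳 hn (A ⊞ A) (C ⊞ C)).symm
      (sumExt h𝒳 hn (yonedaEquiv h𝒳 hn A C ξ) (yonedaEquiv h𝒳 hn A C η)), ?_, ?_⟩
    · rw [Equiv.apply_symm_apply]
      exact sumExt_eq h𝒳 hn _ _ hX hY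
    · apply (yonedaEquiv h𝒳 hn A C).injective
      rw [yonedaEquiv_add, yonedaEquiv_pull, yonedaEquiv_push, Equiv.apply_symm_apply, addExt]

end Bifunctor

/-! ### Classes of cones and cocones -/

section Exangulated

open EndComplex

variable {𝒞 : Type u} [Category.{v} 𝒞] [Preadditive 𝒞] {n : ℕ} {𝒳 : CochainComplex 𝒞 ℕ → Prop}
  {X Y : CochainComplex 𝒞 ℕ} {hX : IsNComplex n X} {hY : IsNComplex n Y}
  {ξ : YonedaExt n 𝒳 (X.X 0) (X.X (n + 1))} {η : YonedaExt n 𝒳 (Y.X 0) (Y.X (n + 1))}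

lemma ExtHom.exists_hom_ofComplex {a : X.X 0 ⟶ Y.X 0} {c : X.X (n + 1) ⟶ Y.X (n + 1)}
    (h : ExtHom a c ξ η) (hξ : ξ.1 = htpyClass (ofComplex n X hX))
    (hη : η.1 = htpyClass (ofComplex n Y hY)) :
    ∃ f : X ⟶ Y, f.f 0 = a ∧ f.f (n + 1) = c := by
  obtain ⟨f, hf⟩ := h.exists_hom hξ hη
  exact ⟨f, hf.1.trans ((Category.id_comp _).trans (Category.comp_id _)),
    hf.2.trans ((Category.id_comp _).trans (Category.comp_id _))⟩

lemma ExtHom.of_hom (f : X ⟶ Y) (hξ : ξ.1 = htpyClass (ofComplex n X hX))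
    (hη : η.1 = htpyClass (ofComplex n Y hY)) : ExtHom (f.f 0) (f.f (n + 1)) ξ η :=
  ⟨_, _, f, hξ, hη, ((Category.id_comp _).trans (Category.comp_id _)).symm,
    ((Category.id_comp _).trans (Category.comp_id _)).symm⟩

variable [HasZeroObject 𝒞] [HasBinaryBiproducts 𝒞] (h𝒳 : IsNExactCategory n 𝒳) (hn : 1 ≤ n)

include h𝒳 hn

/-- The morphism `k` from `Y` to the cone gives the relation `k⁰_* [Y] = (kⁿ⁺¹)^* [M_f]`. The
remaining maps identify the formal ends `X¹` and `0 ⊕ Yⁿ⁺¹` of the cone with `X¹` and `Yⁿ⁺¹`. -/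
lemma pushExt_pullExt_mappingCone (hξ : ξ.1 = htpyClass (ofComplex n X hX))
    (hη : η.1 = htpyClass (ofComplex n Y hY)) (h : X.X 0 = Y.X 0) (f : X ⟶ Y)
    (hf : f.f 0 = eqToHom h) :
    ∃ hM : IsNComplex n (mappingCone f),
      (pushExt h𝒳 hn (toConeZero f) (pullExt h𝒳 hn (fromConeLast n f)
        (pushExt h𝒳 hn (X.d 0 1) (pushExt h𝒳 hn (eqToHom h.symm) η)))).1 =
          htpyClass (ofComplex n (mappingCone f) hM) := by
  have : IsIso (f.f 0) := by rw [hf]; infer_instance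
  have hX' : 𝒳 X := h𝒳.mem_of_eq ξ hξ
  have hY' : 𝒳 Y := h𝒳.mem_of_eq η hη
  obtain ⟨hM, hp, k, hk, hk'⟩ := h𝒳.mappingCone_mem hn hX' hY' f
  have hM' := (h𝒳.isNExact _ hM).1.isNComplex
  refine ⟨hM', congrArg Subtype.val (?_ : _ = YonedaExt.mk (ofComplex n _ hM') hM)⟩
  have e : eqToHom h.symm ≫ X.d 0 1 ≫ toConeZero f = k.f 0 := by
    rw [← hk, hf, ← Category.assoc, eqToHom_trans, eqToHom_refl, Category.id_comp]
  have e' : fromConeLast n f ≫ k.f (n + 1) = 𝟙 _ := by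
    rw [← cancel_mono (fromConeLast n f), Category.assoc, hk', Category.comp_id, Category.id_comp]
  rw [pushExt_pullExt, ← pushExt_comp, ← pushExt_comp, e,
    (pushExt_eq_pullExt_iff h𝒳 hn).mpr (ExtHom.of_hom k (hY := hM') hη
      (rfl : (YonedaExt.mk (ofComplex n _ hM') hM).1 = _)), ← pullExt_comp, e', pullExt_id]

lemma pushExt_pullExt_mappingCocone (hξ : ξ.1 = htpyClass (ofComplex n X hX))
    (hη : η.1 = htpyClass (ofComplex n Y hY)) (h : X.X (n + 1) = Y.X (n + 1)) (f : X ⟶ Y)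
    (hf : f.f (n + 1) = eqToHom h) :
    ∃ hN : IsNComplex n (mappingCocone n f),
      (pushExt h𝒳 hn (toCoconeZero n f) (pullExt h𝒳 hn (fromCoconeLast n f)
        (pullExt h𝒳 hn (Y.d n (n + 1)) (pullExt h𝒳 hn (eqToHom h.symm) ξ)))).1 =
          htpyClass (ofComplex n (mappingCocone n f) hN) := by
  have : IsIso (f.f (n + 1)) := by rw [hf]; infer_instance
  have hX' : 𝒳 X := h𝒳.mem_of_eq ξ hξ
  have hY' : 𝒳 Y := h𝒳.mem_of_eq η hη
  obtain ⟨hN, ht, k, hk, hk'⟩ := h𝒳.mappingCocone_mem hn hX' hY' f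
  have hN' := (h𝒳.isNExact _ hN).1.isNComplex
  refine ⟨hN', congrArg Subtype.val (?_ : _ = YonedaExt.mk (ofComplex n _ hN') hN)⟩
  have e : fromCoconeLast n f ≫ Y.d n (n + 1) ≫ eqToHom h.symm = k.f (n + 1) := by
    rw [← Category.assoc, ← hk', hf, Category.assoc, eqToHom_trans, eqToHom_refl, Category.comp_id]
  have e' : k.f 0 ≫ toCoconeZero n f = 𝟙 _ := by
    rw [← cancel_epi (toCoconeZero n f), reassoc_of% hk, Category.comp_id]
  rw [← pullExt_comp, ← pullExt_comp, Category.assoc, e,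
    ← (pushExt_eq_pullExt_iff h𝒳 hn).mpr (ExtHom.of_hom k (hX := hN')
      (rfl : (YonedaExt.mk (ofComplex n _ hN') hN).1 = _) hξ), ← pushExt_comp, e', pushExt_id]

end Exangulated

/-! ### The `n`-exangulated structure -/

section Main

open EndComplex

variable {𝒞 : Type u} [Category.{v} 𝒞] [Preadditive 𝒞] [HasZeroObject 𝒞] [HasBinaryBiproducts 𝒞]
  {n : ℕ} {𝒳 : CochainComplex 𝒞 ℕ → Prop} (h𝒳 : IsNExactCategory n 𝒳) (hn : 1 ≤ n)
  [∀ A C : 𝒞, Small.{w} (ExtGroup A C h𝒳 hn)]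

/-- The realization of extension classes by sequences. -/
noncomputable def yonedaRealization : Correspondence n (yonedaBifunctor.{w} h𝒳 hn) :=
  fun A C δ => (yonedaEquiv h𝒳 hn A C δ).1

lemma exists_realizes_iff (X : CochainComplex 𝒞 ℕ) :
    (∃ δ, Realizes (yonedaRealization.{w} h𝒳 hn) X δ) ↔ 𝒳 X := by
  constructor
  · rintro ⟨δ, hX, h⟩
    exact h𝒳.mem_of_eq _ h
  · intro h
    have hX := (h𝒳.isNExact _ h).1.isNComplex
    exact ⟨(yonedaEquiv h𝒳 hn _ _).symm (YonedaExt.mk (ofComplex n X hX) h), hX,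
      congrArg Subtype.val ((yonedaEquiv h𝒳 hn _ _).apply_symm_apply _)⟩

lemma isInflation_iff {A B : 𝒞} (f : A ⟶ B) :
    IsInflation (yonedaRealization.{w} h𝒳 hn) f ↔ IsAdmissibleMono 𝒳 f := by
  simp only [IsInflation, IsAdmissibleMono, exists_and_right, exists_realizes_iff]

lemma isDeflation_iff {A B : 𝒞} (f : A ⟶ B) :
    IsDeflation (yonedaRealization.{w} h𝒳 hn) f ↔ IsAdmissibleEpi n 𝒳 f := by
  simp only [IsDeflation, IsAdmissibleEpi, exists_and_right, exists_realizes_iff]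

lemma isExactRealization_yonedaRealization :
    IsExactRealization (yonedaRealization.{w} h𝒳 hn) where
  lift X Y δ ρ := by
    rintro ⟨hX, hδ⟩ ⟨hY, hρ⟩ a c h
    have h' := congrArg (yonedaEquiv h𝒳 hn _ _) h
    rw [yonedaEquiv_push, yonedaEquiv_pull, pushExt_eq_pullExt_iff] at h'
    exact h'.exists_hom_ofComplex hδ hρ
  isNExangle X δ := by
    rintro ⟨hX, hδ⟩
    have hX' := h𝒳.isNExact _ (h𝒳.mem_of_eq _ hδ)
    refine ⟨hX, hX'.1.exact, fun T g => ?_, hX'.2.exact, fun T g => ?_⟩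
    · rw [← pullExt_eq_zeroExt_iff h𝒳 hn hX hδ, ← (yonedaEquiv h𝒳 hn _ _).apply_eq_iff_eq,
        yonedaEquiv_pull, yonedaEquiv_zero]
    · rw [← pushExt_eq_zeroExt_iff h𝒳 hn hX hδ, ← (yonedaEquiv h𝒳 hn _ _).apply_eq_iff_eq,
        yonedaEquiv_push, yonedaEquiv_zero]
  zero_left X _ hX := by
    have h := h𝒳.mem_of_isIso_d_zero hn hX
    have hX' := (h𝒳.isNExact _ h).1.isNComplex
    refine ⟨hX', congrArg Subtype.val (?_ : _ = YonedaExt.mk (ofComplex n X hX') h)⟩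
    rw [yonedaEquiv_zero, ← pullExt_zero h𝒳 hn (YonedaExt.mk (ofComplex n X hX') h),
      -- The end term in degree `n + 1` is zero, so its identity is `0` and the class equals its
      -- pullback along `0`.
      (hX (n + 1) (by omega)).eq_of_src 0 (𝟙 _), pullExt_id]
  zero_right X hX' _ hX := by
    have h := h𝒳.mem_of_isIso_d_last hn hX' hX
    refine ⟨hX', congrArg Subtype.val (?_ : _ = YonedaExt.mk (ofComplex n X hX') h)⟩
    rw [yonedaEquiv_zero, ← pushExt_zero h𝒳 hn (YonedaExt.mk (ofComplex n X hX') h),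
      (hX 0 (by omega)).eq_of_src 0 (𝟙 _), pushExt_id]

lemma isNExangulated_yonedaBifunctor :
    IsNExangulated n (yonedaBifunctor.{w} h𝒳 hn) (yonedaRealization h𝒳 hn) where
  isBiadditive := isBiadditive_yonedaBifunctor h𝒳 hn
  isExactRealization := isExactRealization_yonedaRealization h𝒳 hn
  inflation_comp f g := by
    simpa only [isInflation_iff] using h𝒳.mono_comp f g
  deflation_comp f g := by
    simpa only [isDeflation_iff] using h𝒳.epi_comp f g
  good_lift X Y h c ρ := by
    rintro ⟨hX, hδ⟩ ⟨hY, hρ⟩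
    rw [yonedaRealization, yonedaEquiv_pull, yonedaEquiv_push] at hδ
    have e : ExtHom (eqToHom h) c (pullExt h𝒳 hn c (pushExt h𝒳 hn (eqToHom h.symm)
        (yonedaEquiv h𝒳 hn _ _ ρ))) (yonedaEquiv h𝒳 hn _ _ ρ) := by
      rw [← pushExt_eq_pullExt_iff h𝒳 hn, pushExt_pullExt, ← pushExt_comp, eqToHom_trans,
        eqToHom_refl, pushExt_id]
    obtain ⟨f, hf, hf'⟩ := e.exists_hom_ofComplex hδ hρ
    refine ⟨f, hf, hf', ?_⟩
    obtain ⟨hM, hM'⟩ := pushExt_pullExt_mappingCone h𝒳 hn hδ hρ h f hf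
    refine ⟨hM, ?_⟩
    simpa only [yonedaRealization, yonedaEquiv_push, yonedaEquiv_pull] using hM'
  good_colift X Y h a δ := by
    rintro ⟨hX, hδ⟩ ⟨hY, hρ⟩
    rw [yonedaRealization, yonedaEquiv_push, yonedaEquiv_pull] at hρ
    have e : ExtHom a (eqToHom h) (yonedaEquiv h𝒳 hn _ _ δ) (pushExt h𝒳 hn a
        (pullExt h𝒳 hn (eqToHom h.symm) (yonedaEquiv h𝒳 hn _ _ δ))) := by
      rw [← pushExt_eq_pullExt_iff h𝒳 hn, ← pushExt_pullExt, ← pullExt_comp, eqToHom_trans,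
        eqToHom_refl, pullExt_id]
    obtain ⟨f, hf, hf'⟩ := e.exists_hom_ofComplex hδ hρ
    refine ⟨f, hf, hf', ?_⟩
    obtain ⟨hN, hN'⟩ := pushExt_pullExt_mappingCocone h𝒳 hn hδ hρ h f hf'
    refine ⟨hN, ?_⟩
    simpa only [yonedaRealization, yonedaEquiv_push, yonedaEquiv_pull] using hN'

end Main

end NExang

theorem mainTheorem5 {𝒞 : Type u} [Category.{v} 𝒞] [Preadditive 𝒞] [HasZeroObject 𝒞]
    [HasBinaryBiproducts 𝒞] (n : ℕ) (hn : 1 ≤ n) (𝒳 : CochainComplex 𝒞 ℕ → Prop)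
    (h𝒳 : NExang.IsNExactCategory n 𝒳)
    (hsmall : ∀ A C : 𝒞, Small.{w} (NExang.YonedaExt n 𝒳 A C)) :
    ∃ (E : 𝒞ᵒᵖ ⥤ 𝒞 ⥤ AddCommGrpCat.{w})
      (cls : ∀ A C : 𝒞, NExang.Extn E C A ≃ NExang.YonedaExt n 𝒳 A C),
      NExang.IsYonedaBifunctor n 𝒳 E cls ∧ NExang.IsBiadditive E ∧
        NExang.IsNExangulated n E (fun A C δ => (cls A C δ).1) := by
  have : ∀ A C : 𝒞, Small.{w} (NExang.ExtGroup A C h𝒳 hn) := hsmall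
  exact ⟨NExang.yonedaBifunctor h𝒳 hn, NExang.yonedaEquiv h𝒳 hn,
    NExang.isYonedaBifunctor_yonedaBifunctor h𝒳 hn, NExang.isBiadditive_yonedaBifunctor h𝒳 hn,
    NExang.isNExangulated_yonedaBifunctor h𝒳 hn⟩
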